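/- Let $\delta$ be the one-dimensional real representation of $O(2)$ given by the determinant, let $W=O(2)/SO(2)$, and let $\widetilde{\mathbb Q}$ be the sign representation of $W$. For a virtual finite-dimensional real representation $U=V_1-V_0$ of $O(2)$, write $b(U)\in\mathbb Z$ for the multiplicity of $\delta$ in $U$, that is, $b(U)=\dim\mathrm{Hom}_{O(2)}(\delta,V_1)-\dim\mathrm{Hom}_{O(2)}(\delta,V_0)$, and say that $U^{O(2)}=0$ if $\dim V_1^{O(2)}=\dim V_0^{O(2)}$. Let $H_n^{SO(2)}(S^U)$ $(n\in\mathbb Z)$ be the rational $SO(2)$-equivariant Borel homology of the virtual sphere $S^U$, i.e. the reduced rational homology of the homotopy orbits $EO(2)_+\wedge_{SO(2)}S^U$, with its residual action of $W$. Then: (1) In degrees counted from $b(U)$, the action of $W$ on $H_*^{SO(2)}(S^U)$ depends only on the parity of $b(U)$: if $U,U'$ are virtual representations with $U^{O(2)}=0=U'^{O(2)}$ and $b(U)\equiv b(U')\pmod 2$, then for every $n\in\mathbb Z$ such that $H_{b(U)+n}^{SO(2)}(S^U)$ and $H_{b(U')+n}^{SO(2)}(S^{U'})$ are both non-zero, these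 two are isomorphic as representations of $W$. (2) Suspending by $\delta$ shifts degree by one and tensors with the sign representation: if $U^{O(2)}=0$, then $H_{n+1}^{SO(2)}(S^{U\oplus\delta})\cong H_n^{SO(2)}(S^U)\otimes\widetilde{\mathbb Q}$ as representations of $W$, for every $n\in\mathbb Z$. -/

import Mathlib

universe u v

open CategoryTheory Opposite

namespace BorelO2

noncomputable section

/-! ### The group `O(2)`, its subgroup `SO(2)` and the quotient `W = O(2)/SO(2)` -/

/-- The compact Lie group `O(2)`. -/
abbrev O2 : Type := Matrix.orthogonalGroup (Fin 2) ℝ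

/-- The determinant `O(2) → ℝ`. -/
def det : O2 →* ℝ := Matrix.detMonoidHom.comp (Submonoid.subtype _)

/-- The subgroup `SO(2)` of `O(2)`. -/
def SO2 : Subgroup O2 := det.ker

instance : SO2.Normal := inferInstanceAs det.ker.Normal

/-- The group `W = O(2)/SO(2)` of order two. -/
abbrev W : Type := O2 ⧸ SO2

/-- The sign of the determinant, as a character of `W` with rational values. -/
def signChar : W →* ℚ :=
  QuotientGroup.lift SO2
    ((SignType.castHom (α := ℚ)).toMonoidHom.comp ((signHom (α := ℝ)).toMonoidHom.comp det))
    (by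
      intro g hg
      have h : det g = 1 := hg
      simp [h])

/-- The sign representation of `W` on `ℚ`. -/
def signRep : Representation ℚ W ℚ :=
  (Algebra.lmul ℚ ℚ).toMonoidHom.comp signChar

lemma continuous_det : Continuous det :=
  (Continuous.matrix_det continuous_subtype_val :
    Continuous fun g : O2 => (g : Matrix (Fin 2) (Fin 2) ℝ).det)

instance : CompactSpace O2 := by
  have h1 : IsClosed {A : Matrix (Fin 2) (Fin 2) ℝ | A ∈ Matrix.orthogonalGroup (Fin 2) ℝ} := by
    have : {A : Matrix (Fin 2) (Fin 2) ℝ | A ∈ Matrix.orthogonalGroup (Fin 2) ℝ}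
        = {A | A * star A = 1} := by
      ext A
      exact Matrix.mem_unitaryGroup_iff
    rw [this]
    exact isClosed_eq (by fun_prop) continuous_const
  have h2 : IsCompact (Set.univ.pi fun _ : Fin 2 => Set.univ.pi fun _ : Fin 2 =>
      Set.Icc (-1 : ℝ) 1) :=
    isCompact_univ_pi fun _ => isCompact_univ_pi fun _ => isCompact_Icc
  have h3 : IsCompact {A : Matrix (Fin 2) (Fin 2) ℝ | A ∈ Matrix.orthogonalGroup (Fin 2) ℝ} := by
    refine h2.of_isClosed_subset h1 ?_
    intro A hA i _ j _
    have := entry_norm_bound_of_unitary (𝕜 := ℝ) hA i j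
    rw [Real.norm_eq_abs, abs_le] at this
    exact this
  exact isCompact_iff_compactSpace.mp h3

/-! ### Real representations of `O(2)` and formal differences of them -/

/-- A finite-dimensional real representation of `O(2)` (with jointly continuous action). -/
structure RealRep where
  carrier : Type u
  [normedGroup : NormedAddCommGroup carrier]
  [normedSpace : NormedSpace ℝ carrier]
  [finiteDim : FiniteDimensional ℝ carrier]
  ρ : Representation ℝ O2 carrier
  continuous_act : Continuous fun p : O2 × carrier => ρ p.1 p.2

attribute [instance] RealRep.normedGroup RealRep.normedSpace RealRep.finiteDim

namespace RealRep

/-- The real dimension. -/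
def dim (V : RealRep.{u}) : ℕ := Module.finrank ℝ V.carrier

/-- The dimension of the subspace fixed by `O(2)`. -/
def fixedDim (V : RealRep.{u}) : ℕ := Module.finrank ℝ V.ρ.invariants

/-- The direct sum of two representations. -/
def sum (V : RealRep.{u}) (V' : RealRep.{v}) : RealRep.{max u v} where
  carrier := V.carrier × V'.carrier
  ρ := V.ρ.prod V'.ρ
  continuous_act :=
    (V.continuous_act.comp
        (continuous_fst.prodMk (continuous_fst.comp continuous_snd))).prodMk
      (V'.continuous_act.comp
        (continuous_fst.prodMk (continuous_snd.comp continuous_snd)))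

/-- The trivial representation on `ℝ ^ n`. -/
def triv (n : ℕ) : RealRep.{0} where
  carrier := Fin n → ℝ
  ρ := Representation.trivial ℝ O2 (Fin n → ℝ)
  continuous_act := continuous_snd

/-- The representation `δ` of `O(2)` on `ℝ` through the determinant. -/
def delta : RealRep.{0} where
  carrier := ℝ
  ρ := (Algebra.lmul ℝ ℝ).toMonoidHom.comp det
  continuous_act := (continuous_det.comp continuous_fst).mul continuous_snd

/-- The multiplicity of `δ` in `V`, that is, `dim Hom_{O(2)}(δ, V)`. -/
def mult (V : RealRep.{u}) : ℕ :=
  Module.finrank ℝ (Representation.IntertwiningMap delta.ρ V.ρ)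

/-- The action of `O(2)` on the one-point compactification `S^V`, fixing the point at infinity. -/
def sphereAct (V : RealRep.{u}) (g : O2) : OnePoint V.carrier → OnePoint V.carrier :=
  OnePoint.map (V.ρ g)

end RealRep

/-- A virtual representation `pos - neg` of `O(2)`. An honest representation is the case in which
`neg` has dimension zero. -/
structure VirtualRep where
  pos : RealRep.{u}
  neg : RealRep.{u}

namespace VirtualRep

/-- The virtual dimension of the `O(2)`-fixed points. -/
def fixedDim (U : VirtualRep.{u}) : ℤ := (U.pos.fixedDim : ℤ) - U.neg.fixedDim

/-- The multiplicity `b(U)` of `δ`. -/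
def b (U : VirtualRep.{u}) : ℤ := (U.pos.mult : ℤ) - U.neg.mult

/-- The virtual representation `U ⊕ δ`. -/
def addDelta (U : VirtualRep.{u}) : VirtualRep.{u} := ⟨U.pos.sum RealRep.delta, U.neg⟩

end VirtualRep

/-! ### Singular simplices -/

/-- The standard topological simplex of dimension `q`. -/
abbrev Simplex (q : SimplexCategory) : Type := stdSimplex ℝ (Fin (q.len + 1))

/-- The affine map of standard simplices induced by a map of vertices. -/
def Simplex.map {p q : SimplexCategory} (θ : p ⟶ q) : C(Simplex p, Simplex q) :=
  ⟨stdSimplex.map θ.toOrderHom, stdSimplex.continuous_map _⟩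

/-- The singular `q`-simplices of a space. For `X = O(2)` these form the `q`-simplices of the
simplicial group `Sing O(2)`, with pointwise multiplication. -/
abbrev Sing (X : Type u) [TopologicalSpace X] (q : SimplexCategory) : Type u :=
  C(Simplex q, X)

/-- The simplicial operator on singular simplices. -/
def Sing.pull {X : Type u} [TopologicalSpace X] {p q : SimplexCategory} (θ : p ⟶ q)
    (x : Sing X q) : Sing X p :=
  x.comp (Simplex.map θ)

section pull

variable {X : Type u} [TopologicalSpace X] {p q r : SimplexCategory}

@[simp] lemma pull_id (x : Sing X q) : Sing.pull (𝟙 q) x = x := by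
  ext t
  exact congrArg x (stdSimplex.map_id_apply t)

lemma pull_comp (θ : p ⟶ q) (η : q ⟶ r) (x : Sing X r) :
    Sing.pull (θ ≫ η) x = Sing.pull θ (Sing.pull η x) := by
  ext t
  exact congrArg x (stdSimplex.map_comp_apply θ.toOrderHom η.toOrderHom t).symm

@[simp] lemma pull_const (θ : p ⟶ q) (x : X) :
    Sing.pull θ (ContinuousMap.const _ x) = ContinuousMap.const _ x := rfl

@[simp] lemma pull_mul (θ : p ⟶ q) (g h : Sing O2 q) :
    Sing.pull θ (g * h) = Sing.pull θ g * Sing.pull θ h := rfl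

@[simp] lemma pull_one (θ : p ⟶ q) : Sing.pull θ (1 : Sing O2 q) = 1 := rfl

@[simp] lemma pull_inv (θ : p ⟶ q) (g : Sing O2 q) :
    Sing.pull θ g⁻¹ = (Sing.pull θ g)⁻¹ := rfl

end pull

/-- `Sing SO(2)`, as a subgroup of `Sing O(2)` in each simplicial degree. -/
def SingSO2 (q : SimplexCategory) : Subgroup (Sing O2 q) where
  carrier := {g | ∀ t, g t ∈ SO2}
  mul_mem' ha hb t := SO2.mul_mem (ha t) (hb t)
  one_mem' _ := SO2.one_mem
  inv_mem' ha t := SO2.inv_mem (ha t)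

instance (q : SimplexCategory) : (SingSO2 q).Normal where
  conj_mem n hn g t := Subgroup.Normal.conj_mem inferInstance (n t) (hn t) (g t)

lemma pull_mem_SingSO2 {p q : SimplexCategory} (θ : p ⟶ q) {g : Sing O2 q}
    (hg : g ∈ SingSO2 q) : Sing.pull θ g ∈ SingSO2 p := fun _ => hg _

/-! ### Simplicial rational vector spaces with an action of `Sing O(2)` -/

/-- A simplicial rational vector space with an action of the simplicial group `Sing O(2)`. -/
structure SimplicialRep where
  obj : SimplicialObject (ModuleCat.{u} ℚ)
  ρ : ∀ q : SimplexCategory, Representation ℚ (Sing O2 q) (obj.obj (op q))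
  map_act : ∀ {p q : SimplexCategory} (θ : p ⟶ q) (g : Sing O2 q) (a : obj.obj (op q)),
    (obj.map θ.op).hom (ρ q g a) = ρ p (Sing.pull θ g) ((obj.map θ.op).hom a)

/-! ### Reduced singular chains on `S^V` -/

namespace RealRep

variable (V : RealRep.{u})

lemma continuous_sphereAct :
    Continuous fun p : O2 × OnePoint V.carrier => V.sphereAct p.1 p.2 := by
  rw [continuous_iff_continuousAt]
  rintro ⟨g, x⟩
  induction x using OnePoint.rec with
  | coe x =>
    have ho : Topology.IsOpenEmbedding
        (Prod.map (id : O2 → O2) ((↑) : V.carrier → OnePoint V.carrier)) :=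
      Topology.IsOpenEmbedding.id.prodMap OnePoint.isOpenEmbedding_coe
    have hc : Continuous ((fun p : O2 × OnePoint V.carrier => V.sphereAct p.1 p.2) ∘
        Prod.map (id : O2 → O2) ((↑) : V.carrier → OnePoint V.carrier)) :=
      OnePoint.continuous_coe.comp V.continuous_act
    exact (ho.continuousAt_iff (x := (g, x))).1 hc.continuousAt
  | infty =>
    have key : ∀ s : Set V.carrier, IsCompact s →
        IsCompact ((fun p : O2 × V.carrier => V.ρ p.1 p.2) '' (Set.univ ×ˢ s)) :=
      fun s hs => (isCompact_univ.prod hs).image V.continuous_act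
    change Filter.Tendsto _ (nhds (g, OnePoint.infty)) (nhds OnePoint.infty)
    rw [nhds_prod_eq, (OnePoint.hasBasis_nhds_infty (X := V.carrier)).tendsto_right_iff]
    rintro s ⟨-, hs⟩
    have hc := key s hs
    have hmem := (OnePoint.hasBasis_nhds_infty (X := V.carrier)).mem_of_mem
      ⟨hc.isClosed, hc⟩
    filter_upwards [Filter.prod_mem_prod Filter.univ_mem hmem]
    rintro ⟨h, y⟩ ⟨-, hy⟩
    induction y using OnePoint.rec with
    | infty => right; rfl
    | coe y =>
      left
      refine ⟨V.ρ h y, ?_, rfl⟩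
      intro hys
      have hy' : y ∉ ((fun p : O2 × V.carrier => V.ρ p.1 p.2) '' (Set.univ ×ˢ s)) := by
        simpa using hy
      refine hy' ⟨(h⁻¹, V.ρ h y), ⟨Set.mem_univ _, hys⟩, ?_⟩
      simp

/-- The pointwise action of a singular simplex of `O(2)` on a singular simplex of `S^V`. -/
def singAct {q : SimplexCategory} (g : Sing O2 q) (x : Sing (OnePoint V.carrier) q) :
    Sing (OnePoint V.carrier) q where
  toFun t := V.sphereAct (g t) (x t)
  continuous_toFun := V.continuous_sphereAct.comp (g.continuous.prodMk x.continuous)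

lemma sphereAct_one (x : OnePoint V.carrier) : V.sphereAct 1 x = x := by
  induction x using OnePoint.rec <;> simp [sphereAct]

lemma sphereAct_mul (g h : O2) (x : OnePoint V.carrier) :
    V.sphereAct (g * h) x = V.sphereAct g (V.sphereAct h x) := by
  induction x using OnePoint.rec <;> simp [sphereAct]

/-- The span of the constant simplex at the base point `∞` of `S^V`. -/
def baseChains (q : SimplexCategory) : Submodule ℚ (Sing (OnePoint V.carrier) q →₀ ℚ) :=
  Submodule.span ℚ {Finsupp.single (ContinuousMap.const _ OnePoint.infty) 1}

lemma baseChains_le {p q : SimplexCategory}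
    (f : Sing (OnePoint V.carrier) p → Sing (OnePoint V.carrier) q)
    (hf : f (ContinuousMap.const _ OnePoint.infty) = ContinuousMap.const _ OnePoint.infty) :
    V.baseChains p ≤ (V.baseChains q).comap (Finsupp.lmapDomain ℚ ℚ f) := by
  rw [baseChains, Submodule.span_le, Set.singleton_subset_iff]
  simp only [SetLike.mem_coe, Submodule.mem_comap, Finsupp.lmapDomain_apply,
    Finsupp.mapDomain_single, hf]
  exact Submodule.subset_span rfl

lemma singAct_const {q : SimplexCategory} (g : Sing O2 q) :
    V.singAct g (ContinuousMap.const _ OnePoint.infty) =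
      ContinuousMap.const _ OnePoint.infty := rfl

/-- The rational singular `q`-chains on `S^V` relative to the base point. -/
abbrev RelChains (q : SimplexCategory) : Type u :=
  (Sing (OnePoint V.carrier) q →₀ ℚ) ⧸ V.baseChains q

/-- The simplicial operators on relative chains. -/
def chainPull {p q : SimplexCategory} (θ : p ⟶ q) : V.RelChains q →ₗ[ℚ] V.RelChains p :=
  Submodule.mapQ _ _ (Finsupp.lmapDomain ℚ ℚ (Sing.pull θ)) (V.baseChains_le _ (pull_const _ _))

/-- The action of a singular simplex of `O(2)` on relative chains. -/
def chainAct {q : SimplexCategory} (g : Sing O2 q) : V.RelChains q →ₗ[ℚ] V.RelChains q :=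
  Submodule.mapQ _ _ (Finsupp.lmapDomain ℚ ℚ (V.singAct g)) (V.baseChains_le _ (V.singAct_const g))

/-- The class of a singular simplex in the relative chains. -/
def simplexClass {q : SimplexCategory} (x : Sing (OnePoint V.carrier) q) : V.RelChains q :=
  Submodule.Quotient.mk (Finsupp.single x 1)

lemma relChains_ext {q : SimplexCategory} {M : Type v} [AddCommGroup M] [Module ℚ M]
    {f f' : V.RelChains q →ₗ[ℚ] M} (h : ∀ x, f (V.simplexClass x) = f' (V.simplexClass x)) : f = f' := by
  apply Submodule.linearMap_qext
  apply Finsupp.lhom_ext'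
  intro x
  apply LinearMap.ext_ring
  exact h x

lemma chainPull_class {p q : SimplexCategory} (θ : p ⟶ q) (x : Sing (OnePoint V.carrier) q) :
    V.chainPull θ (V.simplexClass x) = V.simplexClass (Sing.pull θ x) :=
  congrArg Submodule.Quotient.mk Finsupp.mapDomain_single

lemma chainAct_class {q : SimplexCategory} (g : Sing O2 q) (x : Sing (OnePoint V.carrier) q) :
    V.chainAct g (V.simplexClass x) = V.simplexClass (V.singAct g x) :=
  congrArg Submodule.Quotient.mk Finsupp.mapDomain_single

/-- The simplicial vector space of rational singular chains on `S^V` relative to the base point,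
with the action of `Sing O(2)`. -/
def sphereChains : SimplicialRep.{u} where
  obj :=
    { obj q := ModuleCat.of ℚ (V.RelChains q.unop)
      map θ := ModuleCat.ofHom (V.chainPull θ.unop)
      map_id q := by
        apply ModuleCat.hom_ext
        apply V.relChains_ext
        intro x
        exact (V.chainPull_class _ x).trans (congrArg V.simplexClass (pull_id x))
      map_comp θ η := by
        apply ModuleCat.hom_ext
        apply V.relChains_ext
        intro x
        change V.chainPull (η.unop ≫ θ.unop) (V.simplexClass x) =
          V.chainPull η.unop (V.chainPull θ.unop (V.simplexClass x))
        simp only [chainPull_class, pull_comp] }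
  ρ q :=
    { toFun g := V.chainAct g
      map_one' := by
        apply V.relChains_ext
        intro x
        have : V.singAct 1 x = x := by ext t; exact V.sphereAct_one _
        exact (V.chainAct_class _ x).trans (congrArg V.simplexClass this)
      map_mul' g h := by
        apply V.relChains_ext
        intro x
        have : V.singAct (g * h) x = V.singAct g (V.singAct h x) := by
          ext t; exact V.sphereAct_mul _ _ _
        change V.chainAct (g * h) (V.simplexClass x) = V.chainAct g (V.chainAct h (V.simplexClass x))
        simp only [chainAct_class, this] }
  map_act {p q} θ g a := by
    have h : V.chainPull θ ∘ₗ V.chainAct g = V.chainAct (Sing.pull θ g) ∘ₗ V.chainPull θ := by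
      apply V.relChains_ext
      intro x
      simp only [LinearMap.comp_apply, chainAct_class, chainPull_class]
      rfl
    exact LinearMap.congr_fun h a

end RealRep

/-! ### Function objects -/

namespace SimplicialRep

/-- The `q`-simplices of the simplicial vector space of maps `A → B`: the maps of simplicial
vector spaces `A ⊗ ℚ[Δ^q] → B`. -/
def homModule (A B : SimplicialRep.{u}) (q : SimplexCategory) :
    Submodule ℚ (∀ p : SimplexCategory,
      (p ⟶ q) → (A.obj.obj (op p) →ₗ[ℚ] B.obj.obj (op p))) where
  carrier := {f | ∀ (p p' : SimplexCategory) (t : p' ⟶ p) (s : p ⟶ q) (a : A.obj.obj (op p)),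
    (B.obj.map t.op).hom (f p s a) = f p' (t ≫ s) ((A.obj.map t.op).hom a)}
  add_mem' hf hg p p' t s a := by simp [hf p p' t s a, hg p p' t s a]
  zero_mem' p p' t s a := by simp
  smul_mem' c f hf p p' t s a := by simp [hf p p' t s a]

/-- The simplicial operators on maps `A → B`. -/
def homPull (A B : SimplicialRep.{u}) {q r : SimplexCategory} (θ : r ⟶ q) :
    homModule A B q →ₗ[ℚ] homModule A B r where
  toFun f := ⟨fun p s => f.1 p (s ≫ θ), fun p p' t s a => by
    simpa only [Category.assoc] using f.2 p p' t (s ≫ θ) a⟩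
  map_add' _ _ := rfl
  map_smul' _ _ := rfl

/-- The conjugation action on maps `A → B`. -/
def homAct (A B : SimplicialRep.{u}) {q : SimplexCategory} (g : Sing O2 q) :
    homModule A B q →ₗ[ℚ] homModule A B q where
  toFun f := ⟨fun p s => B.ρ p (Sing.pull s g) ∘ₗ f.1 p s ∘ₗ A.ρ p (Sing.pull s g)⁻¹,
    fun p p' t s a => by
      simp only [LinearMap.comp_apply]
      rw [B.map_act, f.2 p p' t s, A.map_act, pull_comp, pull_inv]⟩
  map_add' f f' := by
    apply Subtype.ext
    funext p s
    ext a
    simp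
  map_smul' c f := by
    apply Subtype.ext
    funext p s
    ext a
    simp

/-- The simplicial vector space of maps `A → B`, with `Sing O(2)` acting by conjugation. -/
def hom (A B : SimplicialRep.{u}) : SimplicialRep.{u} where
  obj :=
    { obj q := ModuleCat.of ℚ (homModule A B q.unop)
      map θ := ModuleCat.ofHom (homPull A B θ.unop)
      map_id q := by
        apply ModuleCat.hom_ext
        apply LinearMap.ext
        intro f
        apply Subtype.ext
        funext p s
        exact congrArg (f.1 p) (Category.comp_id s)
      map_comp θ η := by
        apply ModuleCat.hom_ext
        apply LinearMap.ext
        intro f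
        apply Subtype.ext
        funext p s
        exact congrArg (f.1 p) (Category.assoc s η.unop θ.unop).symm }
  ρ q :=
    { toFun g := homAct A B g
      map_one' := by
        apply LinearMap.ext
        intro f
        apply Subtype.ext
        funext p s
        apply LinearMap.ext
        intro a
        change B.ρ p (Sing.pull s 1) (f.1 p s (A.ρ p (Sing.pull s 1)⁻¹ a)) = f.1 p s a
        simp
      map_mul' g h := by
        apply LinearMap.ext
        intro f
        apply Subtype.ext
        funext p s
        apply LinearMap.ext
        intro a
        change B.ρ p (Sing.pull s (g * h)) (f.1 p s (A.ρ p (Sing.pull s (g * h))⁻¹ a)) =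
          B.ρ p (Sing.pull s g) (B.ρ p (Sing.pull s h) (f.1 p s
            (A.ρ p (Sing.pull s h)⁻¹ (A.ρ p (Sing.pull s g)⁻¹ a))))
        rw [pull_mul, mul_inv_rev, map_mul, map_mul]
        rfl }
  map_act {p q} θ g f := by
    apply Subtype.ext
    funext r s
    apply LinearMap.ext
    intro a
    change B.ρ r (Sing.pull (s ≫ θ) g) (f.1 r (s ≫ θ) (A.ρ r (Sing.pull (s ≫ θ) g)⁻¹ a)) =
      B.ρ r (Sing.pull s (Sing.pull θ g)) (f.1 r (s ≫ θ)
        (A.ρ r (Sing.pull s (Sing.pull θ g))⁻¹ a))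
    rw [pull_comp]

end SimplicialRep

/-! ### The Borel construction -/

/-- The `q`-simplices of the contractible free simplicial `Sing O(2)`-set `E O(2)`. -/
abbrev EO2 (q : SimplexCategory) : Type := Fin (q.len + 1) → Sing O2 q

/-- The simplicial operators of `E O(2)`. -/
def EO2.pull {p q : SimplexCategory} (θ : p ⟶ q) (e : EO2 q) : EO2 p :=
  fun i => Sing.pull θ (e (θ.toOrderHom i))

lemma EO2.pull_id {q : SimplexCategory} (e : EO2 q) : EO2.pull (𝟙 q) e = e :=
  funext fun i => BorelO2.pull_id (e i)

lemma EO2.pull_comp {p q r : SimplexCategory} (θ : p ⟶ q) (η : q ⟶ r) (e : EO2 r) :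
    EO2.pull (θ ≫ η) e = EO2.pull θ (EO2.pull η e) :=
  funext fun _ => BorelO2.pull_comp θ η _

namespace SimplicialRep

variable (A : SimplicialRep.{u})

/-- The diagonal action of `Sing O(2)` on `ℚ[E O(2)] ⊗ A` in simplicial degree `q`, written as
the finitely supported functions from `E O(2)` to `A`. -/
def diagRep (q : SimplexCategory) :
    Representation ℚ (Sing O2 q) (EO2 q →₀ A.obj.obj (op q)) where
  toFun g := Finsupp.lmapDomain _ ℚ (fun e : EO2 q => fun i => g * e i) ∘ₗ
    Finsupp.mapRange.linearMap (A.ρ q g)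
  map_one' := by
    ext e a : 2
    simp
  map_mul' g h := by
    ext e a : 2
    simp [mul_assoc]

/-- The simplicial operators of `ℚ[E O(2)] ⊗ A`. -/
def diagMap {p q : SimplexCategory} (θ : p ⟶ q) :
    (EO2 q →₀ A.obj.obj (op q)) →ₗ[ℚ] (EO2 p →₀ A.obj.obj (op p)) :=
  Finsupp.lmapDomain _ ℚ (EO2.pull θ) ∘ₗ Finsupp.mapRange.linearMap (A.obj.map θ.op).hom

@[simp] lemma diagRep_single {q : SimplexCategory} (g : Sing O2 q) (e : EO2 q)
    (a : A.obj.obj (op q)) :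
    A.diagRep q g (Finsupp.single e a) = Finsupp.single (fun i => g * e i) (A.ρ q g a) := by
  simp [diagRep]

@[simp] lemma diagMap_single {p q : SimplexCategory} (θ : p ⟶ q) (e : EO2 q)
    (a : A.obj.obj (op q)) :
    A.diagMap θ (Finsupp.single e a) =
      Finsupp.single (EO2.pull θ e) ((A.obj.map θ.op).hom a) := by
  simp [diagMap]

lemma diagMap_diagRep {p q : SimplexCategory} (θ : p ⟶ q) (g : Sing O2 q) :
    A.diagMap θ ∘ₗ A.diagRep q g = A.diagRep p (Sing.pull θ g) ∘ₗ A.diagMap θ := by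
  ext e a : 2
  simp only [LinearMap.comp_apply, Finsupp.lsingle_apply, diagRep_single, diagMap_single,
    A.map_act]
  rfl

/-- `(ℚ[E O(2)] ⊗ A) / Sing SO(2)` in simplicial degree `q`. -/
abbrev borelObj (q : SimplexCategory) : Type u :=
  Representation.Coinvariants ((A.diagRep q).comp (SingSO2 q).subtype)

/-- The simplicial operators of the Borel construction. -/
def borelMap {p q : SimplexCategory} (θ : p ⟶ q) : A.borelObj q →ₗ[ℚ] A.borelObj p :=
  Representation.Coinvariants.lift _
    (Representation.Coinvariants.mk ((A.diagRep p).comp (SingSO2 p).subtype) ∘ₗ A.diagMap θ) (by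
      rintro ⟨g, hg⟩
      have h := A.diagMap_diagRep θ g
      apply LinearMap.ext
      intro x
      have hx := LinearMap.congr_fun h x
      simp only [LinearMap.comp_apply] at hx
      change Representation.Coinvariants.mk _ (A.diagMap θ (A.diagRep q g x)) = _
      rw [hx]
      exact (Representation.Coinvariants.mk_eq_iff _).2
        (Representation.Coinvariants.mem_ker_of_eq
          (⟨Sing.pull θ g, pull_mem_SingSO2 θ hg⟩ : SingSO2 p) (A.diagMap θ x) _ rfl))

/-- The Borel construction (homotopy orbits) `(ℚ[E O(2)] ⊗ A) / Sing SO(2)`. -/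
def borel : SimplicialObject (ModuleCat.{u} ℚ) where
  obj q := ModuleCat.of ℚ (A.borelObj q.unop)
  map θ := ModuleCat.ofHom (A.borelMap θ.unop)
  map_id q := by
    apply ModuleCat.hom_ext
    apply Representation.Coinvariants.hom_ext
    apply Finsupp.lhom_ext
    intro e a
    change Representation.Coinvariants.mk _ (A.diagMap (𝟙 q.unop) (Finsupp.single e a)) =
      Representation.Coinvariants.mk _ (Finsupp.single e a)
    rw [A.diagMap_single, EO2.pull_id, op_id]
    congr 2
    exact congrArg (fun f => f.hom a) (A.obj.map_id q)
  map_comp θ η := by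
    apply ModuleCat.hom_ext
    apply Representation.Coinvariants.hom_ext
    apply Finsupp.lhom_ext
    intro e a
    change Representation.Coinvariants.mk _
        (A.diagMap (η.unop ≫ θ.unop) (Finsupp.single e a)) =
      Representation.Coinvariants.mk _ (A.diagMap η.unop (A.diagMap θ.unop (Finsupp.single e a)))
    rw [A.diagMap_single, A.diagMap_single, A.diagMap_single, EO2.pull_comp]
    congr 2
    exact congrArg (fun f => f.hom a) (A.obj.map_comp θ η)

/-- The residual action of `O(2)` on the Borel construction. -/
def borelAct : O2 →* End A.borel where
  toFun g :=
    { app q := ModuleCat.ofHom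
        ((A.diagRep q.unop).toCoinvariants (SingSO2 q.unop) (ContinuousMap.const _ g))
      naturality q r θ := by
        apply ModuleCat.hom_ext
        apply Representation.Coinvariants.hom_ext
        apply LinearMap.ext
        intro x
        have hx := LinearMap.congr_fun
          (A.diagMap_diagRep θ.unop (ContinuousMap.const _ g)) x
        exact congrArg (Representation.Coinvariants.mk _) hx.symm }
  map_one' := by
    apply NatTrans.ext
    funext q
    apply ModuleCat.hom_ext
    exact map_one ((A.diagRep q.unop).toCoinvariants (SingSO2 q.unop))
  map_mul' g h := by
    apply NatTrans.ext
    funext q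
    apply ModuleCat.hom_ext
    exact map_mul ((A.diagRep q.unop).toCoinvariants (SingSO2 q.unop))
      (ContinuousMap.const _ g) (ContinuousMap.const _ h)

lemma borelAct_of_mem {g : O2} (hg : g ∈ SO2) : A.borelAct g = 1 := by
  apply NatTrans.ext
  funext q
  apply ModuleCat.hom_ext
  apply Representation.Coinvariants.hom_ext
  apply LinearMap.ext
  intro x
  exact (Representation.Coinvariants.mk_eq_iff _).2
    (Representation.Coinvariants.mem_ker_of_eq
      (⟨ContinuousMap.const _ g, fun _ => hg⟩ : SingSO2 q.unop) x _ rfl)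

end SimplicialRep

/-- The homology (of the alternating face map complex) of a simplicial rational vector space,
graded by the integers; it is zero in negative degrees. -/
def simplicialHomology : ℤ → (SimplicialObject (ModuleCat.{u} ℚ) ⥤ ModuleCat.{u} ℚ)
  | Int.ofNat k => AlgebraicTopology.alternatingFaceMapComplex _ ⋙
      HomologicalComplex.homologyFunctor _ _ k
  | Int.negSucc _ => (Functor.const _).obj (ModuleCat.of ℚ PUnit)

namespace SimplicialRep

/-- The `SO(2)`-equivariant Borel homology of `A` in degree `k`. -/
abbrev borelHomology (A : SimplicialRep.{u}) (k : ℤ) : ModuleCat.{u} ℚ :=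
  (simplicialHomology k).obj A.borel

/-- The action of `W = O(2)/SO(2)` on the `SO(2)`-equivariant Borel homology of `A`. -/
def borelHomologyRep (A : SimplicialRep.{u}) (k : ℤ) :
    Representation ℚ W (A.borelHomology k) :=
  QuotientGroup.lift SO2
    ((ModuleCat.endRingEquiv (A.borelHomology k)).toMonoidHom.comp
      (((simplicialHomology k).mapEnd A.borel).comp A.borelAct))
    (by
      intro g hg
      change (ModuleCat.endRingEquiv (A.borelHomology k))
        ((simplicialHomology k).mapEnd A.borel (A.borelAct g)) = 1
      rw [A.borelAct_of_mem hg, map_one, map_one])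

end SimplicialRep

/-! ### Borel homology of virtual spheres -/

namespace VirtualRep

variable (U : VirtualRep.{u})

/-- A chain-level model for the `dim neg`-fold suspension of the virtual sphere
`S^U = F(S^neg, S^pos)`: the maps from the reduced chains on `S^neg` to the reduced chains on
`S^(pos ⊕ ℝ^d)`, where `d = dim neg` and `ℝ^d` is fixed by `O(2)`. The suspension makes all the
homology of the mapping complex live in non-negative degrees. -/
def suspendedSphere : SimplicialRep.{u} :=
  SimplicialRep.hom U.neg.sphereChains (U.pos.sum (RealRep.triv U.neg.dim)).sphereChains

/-- The Borel homology `H_n^{SO(2)}(S^U)` with rational coefficients. -/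
abbrev H (n : ℤ) : ModuleCat.{u} ℚ := U.suspendedSphere.borelHomology (n + U.neg.dim)

/-- The action of `W = O(2)/SO(2)` on `H_n^{SO(2)}(S^U)`. -/
def HRep (n : ℤ) : Representation ℚ W (U.H n) :=
  U.suspendedSphere.borelHomologyRep (n + U.neg.dim)

end VirtualRep

end

end BorelO2

/-!
The Borel homology of an object with one-dimensional homology, concentrated in degree `p`, is the
Borel homology of a point shifted by `p` and twisted by a power of the sign; everything is
then a matter of determining the shift and the exponent.

* *Reduction to a point.* A simplicial representation `A` with `H_*(A) = ℚ` in degree `p`, on which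
  the reflection acts by `(-1) ^ k`, is looped down `p` times. The path object is contractible, and
  the Borel construction is exact, so each loop shifts the Borel homology by one. In degree zero `A`
  maps by a homology isomorphism to the constant representation `ℚ`, twisted by the `k`-th power of
  the sign (`SimplicialRep.tw_of_conc`). The relation `SimplicialRep.Tw k A n B m` records an
  isomorphism between Borel homology in degrees `n` and `m` that is equivariant up to the `k`-th
  power of the sign.
* *The Borel homology of a point.* The Gysin sequence of the standard representation on the plane
  gives an isomorphism of degree two, twisted by the sign, since the reflection reverses the
  orientation of the plane, and the punctured plane has the Borel homology of a contractible
  space in positive degrees because `SO(2)` acts on it with quotient a half-line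
  (`SimplicialRep.tw_periodicity`). Thus the Borel homology of a point is zero in odd degrees, and
  in degree `2 * i` it is the `i`-th power of the sign, twisting that in degree `0`.
* *Spheres.* The homology of `S^V` is computed by adding one eigenvector of the reflection at a time,
  with a Mayer–Vietoris sequence, for which excision is proved by barycentric subdivision. The
  exponent is the dimension of the `-1`-eigenspace (`RealRep.exists_conc_sphereChains`).
* *Function objects.* If `A` and `B` have one-dimensional homology in degrees `d` and `d + m`, then
  maps from `A` to `B` have one-dimensional homology in degree `m`, and the exponents add
  (`SimplicialRep.conc_hom`). Looping `B` reduces this to `m = 0`, and there the Dold–Kan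
  correspondence shows that a map that is zero on homology is null-homotopic.
* *The exponent.* Averaging over rotations shows that the trace of the reflection on `V` is the
  dimension of the fixed subspace minus the multiplicity of `δ` (`RealRep.trace_refl_eq`). For
  `U^{O(2)} = 0`, the dimension of `U` and the exponent of `S^U` modulo two are therefore tied to
  `b(U)`.
-/

namespace BorelO2

noncomputable section

/-! ### Homology of simplicial rational vector spaces -/

open Simplicial

/-- Simplicial rational vector spaces. -/
abbrev SMod := SimplicialObject (ModuleCat.{u} ℚ)

namespace SMod

/-- The simplicial operator of a simplicial vector space, as a linear map. -/
def pl (X : SMod.{u}) {p q : SimplexCategory} (θ : p ⟶ q) : X.obj (op q) →ₗ[ℚ] X.obj (op p) :=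
  (X.map θ.op).hom

@[simp] lemma pl_id (X : SMod.{u}) {q : SimplexCategory} (x : X.obj (op q)) :
    X.pl (𝟙 q) x = x :=
  congrArg (fun f => f.hom x) (X.map_id (op q))

lemma pl_comp (X : SMod.{u}) {p q r : SimplexCategory} (θ : p ⟶ q) (η : q ⟶ r)
    (x : X.obj (op r)) : X.pl (θ ≫ η) x = X.pl θ (X.pl η x) :=
  congrArg (fun f => f.hom x) (X.map_comp η.op θ.op)

/-- The linear map in degree `q` of a morphism. -/
def ap {X Y : SMod.{u}} (f : X ⟶ Y) (q : SimplexCategory) :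
    X.obj (op q) →ₗ[ℚ] Y.obj (op q) := (f.app (op q)).hom

lemma ap_pl {X Y : SMod.{u}} (f : X ⟶ Y) {p q : SimplexCategory} (θ : p ⟶ q)
    (x : X.obj (op q)) : ap f p (X.pl θ x) = Y.pl θ (ap f q x) :=
  congrArg (fun f => f.hom x) (f.naturality θ.op)

@[simp] lemma ap_id (X : SMod.{u}) (q : SimplexCategory) (x : X.obj (op q)) :
    ap (𝟙 X) q x = x := rfl

@[simp] lemma ap_comp {X Y Z : SMod.{u}} (f : X ⟶ Y) (g : Y ⟶ Z) (q : SimplexCategory)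
    (x : X.obj (op q)) : ap (f ≫ g) q x = ap g q (ap f q x) := rfl

lemma hom_ext' {X Y : SMod.{u}} {f g : X ⟶ Y} (h : ∀ q x, ap f q x = ap g q x) : f = g := by
  apply NatTrans.ext
  funext q
  apply ModuleCat.hom_ext
  apply LinearMap.ext
  exact h q.unop

/-- A morphism of simplicial vector spaces from a natural family of linear maps. -/
def homMk {X Y : SMod.{u}} (f : ∀ q, X.obj (op q) →ₗ[ℚ] Y.obj (op q))
    (h : ∀ {p q : SimplexCategory} (θ : p ⟶ q) (x : X.obj (op q)),
      f p (X.pl θ x) = Y.pl θ (f q x)) : X ⟶ Y where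
  app q := ModuleCat.ofHom (f q.unop)
  naturality _ _ θ := by
    apply ModuleCat.hom_ext
    apply LinearMap.ext
    exact h θ.unop

/-- A simplicial vector space from vector spaces and linear simplicial operators. -/
def mk (M : SimplexCategory → Type u) [∀ q, AddCommGroup (M q)] [∀ q, Module ℚ (M q)]
    (pull : ∀ {p q : SimplexCategory}, (p ⟶ q) → (M q →ₗ[ℚ] M p))
    (pull_id : ∀ q x, pull (𝟙 q) x = x)
    (pull_comp : ∀ {p q r : SimplexCategory} (θ : p ⟶ q) (η : q ⟶ r) (x : M r),
      pull (θ ≫ η) x = pull θ (pull η x)) : SMod.{u} where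
  obj q := ModuleCat.of ℚ (M q.unop)
  map θ := ModuleCat.ofHom (pull θ.unop)
  map_id q := by
    apply ModuleCat.hom_ext
    apply LinearMap.ext
    exact pull_id q.unop
  map_comp θ η := by
    apply ModuleCat.hom_ext
    apply LinearMap.ext
    exact pull_comp η.unop θ.unop

/-- The alternating face map complex. -/
abbrev cx (X : SMod.{u}) : ChainComplex (ModuleCat.{u} ℚ) ℕ :=
  (AlgebraicTopology.alternatingFaceMapComplex _).obj X

/-- The `n`-th homology functor. -/
def Hn (n : ℕ) : SMod.{u} ⥤ ModuleCat.{u} ℚ :=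
  AlgebraicTopology.alternatingFaceMapComplex _ ⋙ HomologicalComplex.homologyFunctor _ _ n

instance (n : ℕ) : (Hn.{u} n).Additive := by unfold Hn; infer_instance

/-- The map on homology, as a linear map. -/
def hm {X Y : SMod.{u}} (n : ℕ) (f : X ⟶ Y) : (Hn n).obj X →ₗ[ℚ] (Hn n).obj Y := ((Hn n).map f).hom

@[simp] lemma hm_id (X : SMod.{u}) (n : ℕ) (x) : hm n (𝟙 X) x = x := by simp [hm]

lemma hm_comp {X Y Z : SMod.{u}} (n : ℕ) (f : X ⟶ Y) (g : Y ⟶ Z) (x) :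
    hm n (f ≫ g) x = hm n g (hm n f x) := by simp [hm]

lemma hm_neg {X Y : SMod.{u}} (n : ℕ) (f : X ⟶ Y) (x) : hm n (-f) x = - hm n f x := by
  simp [hm, Functor.map_neg]

lemma hm_zero {X Y : SMod.{u}} (n : ℕ) (x) : hm n (0 : X ⟶ Y) x = 0 := by
  simp [hm]

/-- The boundary map. -/
def bd (X : SMod.{u}) (n : ℕ) : X.obj (op ⦋n + 1⦌) →ₗ[ℚ] X.obj (op ⦋n⦌) :=
  ∑ i : Fin (n + 2), (-1 : ℚ) ^ (i : ℕ) • X.pl (SimplexCategory.δ i)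

lemma cx_d (X : SMod.{u}) (n : ℕ) : ((cx X).d (n + 1) n).hom = X.bd n := by
  change ((((AlgebraicTopology.alternatingFaceMapComplex _).obj X)).d (n + 1) n).hom = _
  rw [AlgebraicTopology.alternatingFaceMapComplex_obj_d]
  apply LinearMap.ext
  intro x
  simp only [AlgebraicTopology.AlternatingFaceMapComplex.objD, bd, ModuleCat.hom_sum,
    LinearMap.sum_apply]
  apply Finset.sum_congr rfl
  intro i _
  rw [ModuleCat.hom_zsmul]
  simp only [LinearMap.smul_apply]
  rcases neg_one_pow_eq_or ℤ (i : ℕ) with h | h <;>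
  rcases neg_one_pow_eq_or ℚ (i : ℕ) with h' | h'
  · rw [h, h']; simp; rfl
  · exfalso
    have : ((-1 : ℤ) ^ (i : ℕ) : ℚ) = 1 := by exact_mod_cast h
    push_cast at this; rw [this] at h'; norm_num at h'
  · exfalso
    have : (((-1 : ℤ) ^ (i : ℕ) : ℤ) : ℚ) = -1 := by rw [h]; norm_num
    push_cast at this; rw [this] at h'; norm_num at h'
  · rw [h, h']; simp; rfl

/-- The boundary map out of degree `n`, which is zero for `n = 0`. -/
def bd' (X : SMod.{u}) (n : ℕ) : X.obj (op ⦋n⦌) →ₗ[ℚ] X.obj (op ⦋n - 1⦌) :=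
  ((cx X).d n (n - 1)).hom

@[simp] lemma bd'_zero (X : SMod.{u}) : X.bd' 0 = 0 := by
  simp [bd']

@[simp] lemma bd'_succ (X : SMod.{u}) (n : ℕ) : X.bd' (n + 1) = X.bd n := X.cx_d n

lemma ap_bd {X Y : SMod.{u}} (f : X ⟶ Y) (n : ℕ) (x) :
    ap f ⦋n⦌ (X.bd n x) = Y.bd n (ap f ⦋n + 1⦌ x) := by
  simp [bd, LinearMap.sum_apply, map_sum, ap_pl]

lemma ap_bd' {X Y : SMod.{u}} (f : X ⟶ Y) (n : ℕ) (x) :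
    ap f ⦋n - 1⦌ (X.bd' n x) = Y.bd' n (ap f ⦋n⦌ x) := by
  cases n with
  | zero => simp
  | succ n => simpa using ap_bd f n x

lemma bd'_bd (X : SMod.{u}) (n : ℕ) (x) : X.bd' n (X.bd n x) = 0 := by
  rw [← X.cx_d n]
  exact congrArg (fun f => f.hom x) ((cx X).d_comp_d (n + 1) n (n - 1))

lemma bd_bd (X : SMod.{u}) (n : ℕ) (x) : X.bd n (X.bd (n + 1) x) = 0 := by
  simpa using X.bd'_bd (n + 1) x

/-- The cycles of degree `n`. -/
abbrev cyc (X : SMod.{u}) (n : ℕ) : Submodule ℚ (X.obj (op ⦋n⦌)) := LinearMap.ker (X.bd' n)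

lemma next_down (n : ℕ) : (ComplexShape.down ℕ).next n = n - 1 := by
  cases n <;> simp

/-- The inclusion of the cycles of degree `n` as a morphism. -/
def cycι (X : SMod.{u}) (n : ℕ) : ModuleCat.of ℚ (X.cyc n) ⟶ (cx X).X n :=
  ModuleCat.ofHom (X.cyc n).subtype

lemma cycι_d (X : SMod.{u}) (n : ℕ) : X.cycι n ≫ (cx X).d n (n - 1) = 0 := by
  apply ModuleCat.hom_ext
  apply LinearMap.ext
  intro x
  exact x.2

/-- The comparison of elementwise cycles with the abstract object of cycles. -/
def toCyc (X : SMod.{u}) (n : ℕ) : ModuleCat.of ℚ (X.cyc n) ⟶ (cx X).cycles n :=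
  (cx X).liftCycles (X.cycι n) (n - 1) (next_down n) (X.cycι_d n)

lemma iCycles_toCyc (X : SMod.{u}) (n : ℕ) (x : X.cyc n) :
    ((cx X).iCycles n).hom ((X.toCyc n).hom x) = x.1 :=
  congrArg (fun f : ModuleCat.of ℚ (X.cyc n) ⟶ (cx X).X n => f.hom x)
    ((cx X).liftCycles_i (X.cycι n) (n - 1) (next_down n) (X.cycι_d n))

lemma iCycles_injective (X : SMod.{u}) (n : ℕ) :
    Function.Injective ((cx X).iCycles n).hom :=
  (ModuleCat.mono_iff_injective _).1 inferInstance

/-- The homology class of a cycle. -/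
def cls (X : SMod.{u}) (n : ℕ) : X.cyc n →ₗ[ℚ] (Hn n).obj X :=
  (X.toCyc n ≫ (cx X).homologyπ n).hom

lemma cls_apply (X : SMod.{u}) (n : ℕ) (x : X.cyc n) :
    X.cls n x = ((cx X).homologyπ n).hom ((X.toCyc n).hom x) := rfl

/-- Morphisms preserve cycles. -/
def cycMap {X Y : SMod.{u}} (f : X ⟶ Y) (n : ℕ) (x : X.cyc n) : Y.cyc n :=
  ⟨ap f ⦋n⦌ x.1, by
    have h := ap_bd' f n x.1
    have hx : X.bd' n x.1 = 0 := x.2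
    rw [LinearMap.mem_ker, ← h, hx, map_zero]⟩

lemma hm_cls {X Y : SMod.{u}} (f : X ⟶ Y) (n : ℕ) (x : X.cyc n) :
    hm n f (X.cls n x) = Y.cls n (cycMap f n x) := by
  let F : cx X ⟶ cx Y := (AlgebraicTopology.alternatingFaceMapComplex _).map f
  let c : ModuleCat.of ℚ (X.cyc n) ⟶ ModuleCat.of ℚ (Y.cyc n) := ModuleCat.ofHom
    { toFun := cycMap f n
      map_add' a b := Subtype.ext (map_add _ _ _)
      map_smul' a b := Subtype.ext (map_smul _ _ _) }
  have key : (X.toCyc n ≫ (cx X).homologyπ n) ≫ HomologicalComplex.homologyMap F n =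
      c ≫ (Y.toCyc n ≫ (cx Y).homologyπ n) := by
    rw [Category.assoc, HomologicalComplex.homologyπ_naturality, ← Category.assoc, toCyc, toCyc,
      HomologicalComplex.liftCycles_comp_cyclesMap, ← Category.assoc,
      HomologicalComplex.comp_liftCycles]
    rfl
  exact congrArg (fun f => f.hom x) key

lemma cls_surjective (X : SMod.{u}) (n : ℕ) : Function.Surjective (X.cls n) := by
  intro h
  have h1 : Function.Surjective ((cx X).homologyπ n).hom :=
    (ModuleCat.epi_iff_surjective _).1 inferInstance
  obtain ⟨z, rfl⟩ := h1 h
  have hz : X.bd' n (((cx X).iCycles n).hom z) = 0 :=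
    congrArg (fun f => f.hom z) ((cx X).iCycles_d n (n - 1))
  refine ⟨⟨((cx X).iCycles n).hom z, hz⟩, ?_⟩
  refine (X.cls_apply n _).trans (congrArg _ (X.iCycles_injective n ?_))
  exact X.iCycles_toCyc n _

lemma cls_eq_zero_iff (X : SMod.{u}) (n : ℕ) (x : X.cyc n) :
    X.cls n x = 0 ↔ ∃ y, X.bd n y = x.1 := by
  have hp : (ComplexShape.down ℕ).prev n = n + 1 := by simp
  have hE : (ShortComplex.mk ((cx X).toCycles (n + 1) n) ((cx X).homologyπ n)
      (by simp)).Exact :=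
    ShortComplex.exact_of_g_is_cokernel _ ((cx X).homologyIsCokernel (n + 1) n hp)
  rw [ShortComplex.moduleCat_exact_iff] at hE
  have hi : ∀ y, ((cx X).iCycles n).hom (((cx X).toCycles (n + 1) n).hom y) = X.bd n y := by
    intro y
    rw [← X.cx_d n]
    exact congrArg (fun f => f.hom y) ((cx X).toCycles_i (n + 1) n)
  constructor
  · intro h
    obtain ⟨y, hy⟩ := hE ((X.toCyc n).hom x) h
    exact ⟨y, (hi y).symm.trans ((congrArg ((cx X).iCycles n).hom hy).trans
      (X.iCycles_toCyc n x))⟩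
  · rintro ⟨y, hy⟩
    have h3 : ((cx X).toCycles (n + 1) n).hom y = (X.toCyc n).hom x :=
      X.iCycles_injective n ((hi y).trans (hy.trans (X.iCycles_toCyc n x).symm))
    rw [cls_apply, ← h3]
    exact congrArg (fun f => f.hom y) ((cx X).toCycles_comp_homologyπ (n + 1) n)

end SMod
end
end BorelO2

namespace BorelO2

noncomputable section

open Simplicial

namespace SMod

/-! ### Long exact sequences -/

/-- A degreewise short exact sequence of simplicial vector spaces. -/
structure Ses {X Y Z : SMod.{u}} (i : X ⟶ Y) (p : Y ⟶ Z) : Prop where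
  inj : ∀ q, Function.Injective (ap i q)
  exact : ∀ q, Function.Exact (ap i q) (ap p q)
  surj : ∀ q, Function.Surjective (ap p q)

namespace Ses

variable {X Y Z : SMod.{u}} {i : X ⟶ Y} {p : Y ⟶ Z} (h : Ses i p)

include h in
lemma comp_eq_zero : i ≫ p = 0 := by
  apply hom_ext'
  intro q x
  exact (h.exact q).apply_apply_eq_zero x

/-- The associated short complex of chain complexes. -/
def shortComplex : ShortComplex (ChainComplex (ModuleCat.{u} ℚ) ℕ) :=
  ShortComplex.mk ((AlgebraicTopology.alternatingFaceMapComplex _).map i)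
    ((AlgebraicTopology.alternatingFaceMapComplex _).map p) (by
      rw [← Functor.map_comp, h.comp_eq_zero, Functor.map_zero])

lemma shortExact : h.shortComplex.ShortExact := by
  apply HomologicalComplex.shortExact_of_degreewise_shortExact
  intro n
  apply ModuleCat.shortComplex_shortExact
  · exact h.exact ⦋n⦌
  · exact h.inj ⦋n⦌
  · exact h.surj ⦋n⦌

/-- The connecting map. -/
def δ (n : ℕ) : (Hn (n + 1)).obj Z →ₗ[ℚ] (Hn n).obj X :=
  (h.shortExact.δ (n + 1) n rfl).hom

include h in
lemma exact₂ (n : ℕ) : Function.Exact (hm n i) (hm n p) :=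
  (ShortComplex.ShortExact.moduleCat_exact_iff_function_exact _).1
    (h.shortExact.homology_exact₂ n)

lemma exact₃ (n : ℕ) : Function.Exact (hm (n + 1) p) (h.δ n) :=
  (ShortComplex.ShortExact.moduleCat_exact_iff_function_exact _).1
    (h.shortExact.homology_exact₃ (n + 1) n rfl)

lemma exact₁ (n : ℕ) : Function.Exact (h.δ n) (hm n i) :=
  (ShortComplex.ShortExact.moduleCat_exact_iff_function_exact _).1
    (h.shortExact.homology_exact₁ (n + 1) n rfl)

include h in
lemma surjective_zero : Function.Surjective (hm 0 p) := by
  intro z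
  obtain ⟨⟨z, hz⟩, rfl⟩ := Z.cls_surjective 0 z
  obtain ⟨y, rfl⟩ := h.surj ⦋0⦌ z
  exact ⟨Y.cls 0 ⟨y, by simp⟩, hm_cls p 0 _⟩

lemma δ_naturality {X' Y' Z' : SMod.{u}} {i' : X' ⟶ Y'} {p' : Y' ⟶ Z'} (h' : Ses i' p')
    (a : X ⟶ X') (b : Y ⟶ Y') (c : Z ⟶ Z') (hab : i ≫ b = a ≫ i') (hbc : p ≫ c = b ≫ p')
    (n : ℕ) (z) : h'.δ n (hm (n + 1) c z) = hm n a (h.δ n z) := by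
  let F := AlgebraicTopology.alternatingFaceMapComplex (ModuleCat.{u} ℚ)
  let φ : h.shortComplex ⟶ h'.shortComplex :=
    { τ₁ := F.map a
      τ₂ := F.map b
      τ₃ := F.map c
      comm₁₂ := by
        change F.map a ≫ F.map i' = F.map i ≫ F.map b
        rw [← F.map_comp, ← F.map_comp, hab]
      comm₂₃ := by
        change F.map b ≫ F.map p' = F.map p ≫ F.map c
        rw [← F.map_comp, ← F.map_comp, hbc] }
  have := HomologicalComplex.HomologySequence.δ_naturality φ h.shortExact h'.shortExact
    (n + 1) n rfl
  exact congrArg (fun f => f.hom z) this.symm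

lemma δ_bijective (n : ℕ) (h1 : Subsingleton ((Hn (n + 1)).obj Y))
    (h0 : Subsingleton ((Hn n).obj Y)) : Function.Bijective (h.δ n) := by
  constructor
  · rw [injective_iff_map_eq_zero]
    intro z hz
    obtain ⟨y, rfl⟩ := (h.exact₃ n z).1 hz
    rw [Subsingleton.elim y 0, map_zero]
  · intro x
    exact (h.exact₁ n x).1 (Subsingleton.elim _ _)

include h in
lemma injective_hm_i (n : ℕ) (h1 : Subsingleton ((Hn (n + 1)).obj Z)) :
    Function.Injective (hm n i) := by
  rw [injective_iff_map_eq_zero]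
  intro x hx
  obtain ⟨z, rfl⟩ := (h.exact₁ n x).1 hx
  rw [Subsingleton.elim z 0, map_zero]

include h in
lemma surjective_hm_i (n : ℕ) (h1 : Subsingleton ((Hn n).obj Z)) :
    Function.Surjective (hm n i) := fun y => (h.exact₂ n y).1 (Subsingleton.elim _ _)

include h in
lemma injective_hm_p (n : ℕ) (h1 : Subsingleton ((Hn n).obj X)) :
    Function.Injective (hm n p) := by
  rw [injective_iff_map_eq_zero]
  intro y hy
  obtain ⟨x, rfl⟩ := (h.exact₂ n y).1 hy
  rw [Subsingleton.elim x 0, map_zero]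

include h in
lemma surjective_hm_p_succ (n : ℕ) (h1 : Subsingleton ((Hn n).obj X)) :
    Function.Surjective (hm (n + 1) p) :=
  fun z => (h.exact₃ n z).1 (Subsingleton.elim _ _)

include h in
lemma bijective_hm_p (hX : ∀ n, Subsingleton ((Hn n).obj X)) (n : ℕ) :
    Function.Bijective (hm n p) := by
  refine ⟨h.injective_hm_p n (hX n), ?_⟩
  cases n with
  | zero => exact h.surjective_zero
  | succ n => exact h.surjective_hm_p_succ n (hX n)

include h in
lemma subsingleton_left (n : ℕ) (hs : Function.Surjective (hm (n + 1) p))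
    (hi : Function.Injective (hm n p)) : Subsingleton ((Hn n).obj X) := by
  have : ∀ x : (Hn n).obj X, x = 0 := by
    intro x
    have h1 : hm n p (hm n i x) = 0 := (h.exact₂ n).apply_apply_eq_zero x
    obtain ⟨z, rfl⟩ := (h.exact₁ n x).1 (hi (h1.trans (map_zero _).symm))
    obtain ⟨y, rfl⟩ := hs z
    exact (h.exact₃ n).apply_apply_eq_zero y
  exact ⟨fun a b => (this a).trans (this b).symm⟩

end Ses

lemma hm_bijective_of_bijective {X Y : SMod.{u}} (f : X ⟶ Y)
    (hf : ∀ q, Function.Bijective (ap f q)) (n : ℕ) : Function.Bijective (hm n f) := by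
  have : ∀ q, IsIso (f.app q) := fun q => by
    rw [ConcreteCategory.isIso_iff_bijective]
    exact hf q.unop
  have : IsIso f := NatIso.isIso_of_isIso_app f
  have : IsIso ((Hn n).map f) := inferInstance
  exact (ConcreteCategory.isIso_iff_bijective ((Hn n).map f)).1 this

/-! ### Simplicial homotopies -/

/-- The constant operator at the vertex `i`. -/
abbrev cst (p q : SimplexCategory) (i : Fin (q.len + 1)) : p ⟶ q := SimplexCategory.const p q i

lemma comp_cst {p q r : SimplexCategory} (θ : p ⟶ q) (i : Fin (r.len + 1)) :
    θ ≫ cst q r i = cst p r i := rfl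

/-- The operator `q ⟶ ⦋1⦌` that is constantly `0`. -/
abbrev c0 (q : SimplexCategory) : q ⟶ ⦋1⦌ := cst q ⦋1⦌ 0
/-- The operator `q ⟶ ⦋1⦌` that is constantly `1`. -/
abbrev c1 (q : SimplexCategory) : q ⟶ ⦋1⦌ := cst q ⦋1⦌ 1

/-- A simplicial homotopy between maps of simplicial vector spaces, as a natural family of linear
maps `X_q → Y_q` indexed by the `q`-simplices of `Δ¹`. -/
structure Htpy {X Y : SMod.{u}} (f g : X ⟶ Y) where
  K : ∀ q, (q ⟶ ⦋1⦌) → (X.obj (op q) →ₗ[ℚ] Y.obj (op q))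
  nat : ∀ {p q : SimplexCategory} (η : p ⟶ q) (θ : q ⟶ ⦋1⦌) (x : X.obj (op q)),
    Y.pl η (K q θ x) = K p (η ≫ θ) (X.pl η x)
  zero : ∀ q x, K q (c0 q) x = ap f q x
  one : ∀ q x, K q (c1 q) x = ap g q x

namespace Htpy

variable {X Y : SMod.{u}} {f g : X ⟶ Y} (H : Htpy f g)

/-- The components of the combinatorial homotopy. -/
def h {n : ℕ} (i : Fin (n + 1)) : X.obj (op ⦋n⦌) →ₗ[ℚ] Y.obj (op ⦋n + 1⦌) :=
  H.K ⦋n + 1⦌ (SimplexCategory.toMk₁ i.succ.castSucc) ∘ₗ X.pl (SimplexCategory.σ i)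

lemma pl_h {n : ℕ} {p : SimplexCategory} (η : p ⟶ ⦋n + 1⦌) (i : Fin (n + 1)) (x) :
    Y.pl η (H.h i x) = H.K p (η ≫ SimplexCategory.toMk₁ i.succ.castSucc)
      (X.pl (η ≫ SimplexCategory.σ i) x) := by
  simp only [h, LinearMap.comp_apply]
  rw [H.nat, pl_comp]

lemma h_pl {n : ℕ} {q : SimplexCategory} (η : ⦋n⦌ ⟶ q) (i : Fin (n + 1)) (x) :
    H.h i (X.pl η x) = H.K ⦋n + 1⦌ (SimplexCategory.toMk₁ i.succ.castSucc)
      (X.pl (SimplexCategory.σ i ≫ η) x) := by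
  simp only [h, LinearMap.comp_apply]
  rw [pl_comp]

open SimplexCategory in
/-- The associated combinatorial homotopy. -/
def toHomotopy : SimplicialObject.Homotopy f g where
  h i := ModuleCat.ofHom (H.h i)
  h_zero_comp_δ_zero n := by
    apply ModuleCat.hom_ext
    apply LinearMap.ext
    intro x
    refine (H.pl_h (SimplexCategory.δ 0) 0 x).trans ?_
    rw [show (SimplexCategory.δ (0 : Fin (n + 2)) ≫ toMk₁ (Fin.succ 0).castSucc) = c1 ⦋n⦌ from ?_]
    · have : SimplexCategory.δ (0 : Fin (n + 2)) ≫ SimplexCategory.σ 0 = 𝟙 _ :=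
        SimplexCategory.δ_comp_σ_self (i := (0 : Fin (n + 1)))
      rw [this, pl_id, H.one]
      rfl
    · rw [δ_comp_toMk₁_of_lt _ _ (by simp)]
      rfl
  h_last_comp_δ_last n := by
    apply ModuleCat.hom_ext
    apply LinearMap.ext
    intro x
    refine (H.pl_h (SimplexCategory.δ (Fin.last (n + 1))) (Fin.last n) x).trans ?_
    rw [show (SimplexCategory.δ (Fin.last (n + 1)) ≫ toMk₁ (Fin.last n).succ.castSucc) = c0 ⦋n⦌
      from ?_]
    · have : SimplexCategory.δ (Fin.last (n + 1)) ≫ SimplexCategory.σ (Fin.last n) = 𝟙 _ :=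
        SimplexCategory.δ_comp_σ_succ (i := Fin.last n)
      rw [this, pl_id, H.zero]
      rfl
    · rw [δ_comp_toMk₁_of_le _ _ (by simp)]
      refine ConcreteCategory.hom_ext _ _ (fun k ↦ ?_)
      exact toMk₁_of_castSucc_lt _ _ (by simp)
  h_succ_comp_δ_castSucc_of_lt {n} i j hij := by
    apply ModuleCat.hom_ext
    apply LinearMap.ext
    intro x
    refine (H.pl_h (SimplexCategory.δ i.castSucc) j.succ x).trans
      (Eq.trans ?_ (H.h_pl (SimplexCategory.δ i) j x).symm)
    rw [δ_comp_σ_of_le hij, δ_comp_toMk₁_of_lt _ _ (by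
      simp only [Fin.lt_def, Fin.le_def, Fin.val_castSucc, Fin.val_succ] at *; omega)]
    congr 2
  h_succ_comp_δ_castSucc_succ {n} j := by
    apply ModuleCat.hom_ext
    apply LinearMap.ext
    intro x
    refine (H.pl_h (SimplexCategory.δ j.castSucc.succ) j.succ x).trans
      (Eq.trans ?_ (H.pl_h (SimplexCategory.δ j.castSucc.succ) j.castSucc x).symm)
    rw [show δ j.castSucc.succ ≫ σ j.succ = 𝟙 _ from δ_comp_σ_self (i := j.succ),
      δ_comp_σ_succ (i := j.castSucc), δ_comp_toMk₁_of_lt _ _ (by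
      simp only [Fin.lt_def, Fin.val_castSucc, Fin.val_succ] at *; omega),
      δ_comp_toMk₁_of_le _ _ (by
      simp only [Fin.le_def, Fin.val_castSucc, Fin.val_succ] at *; omega)]
    congr 2
  h_castSucc_comp_δ_succ_of_lt {n} i j hij := by
    apply ModuleCat.hom_ext
    apply LinearMap.ext
    intro x
    refine (H.pl_h (SimplexCategory.δ i.succ) j.castSucc x).trans
      (Eq.trans ?_ (H.h_pl (SimplexCategory.δ i) j x).symm)
    rw [δ_comp_σ_of_gt hij, δ_comp_toMk₁_of_le _ _ (by
      simp only [Fin.lt_def, Fin.le_def, Fin.val_castSucc, Fin.val_succ] at *; omega)]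
    congr 2
  h_comp_σ_castSucc_of_le {n} i j hij := by
    apply ModuleCat.hom_ext
    apply LinearMap.ext
    intro x
    refine (H.pl_h (SimplexCategory.σ i.castSucc) j x).trans
      (Eq.trans ?_ (H.h_pl (SimplexCategory.σ i) j.succ x).symm)
    rw [σ_comp_σ hij, σ_comp_toMk₁_of_lt _ _ (by
      simp only [Fin.lt_def, Fin.le_def, Fin.val_castSucc, Fin.val_succ] at *; omega)]
    congr 2
  h_comp_σ_succ_of_lt {n} i j hij := by
    apply ModuleCat.hom_ext
    apply LinearMap.ext
    intro x
    refine (H.pl_h (SimplexCategory.σ i.succ) j x).trans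
      (Eq.trans ?_ (H.h_pl (SimplexCategory.σ i) j.castSucc x).symm)
    rw [← σ_comp_σ hij, σ_comp_toMk₁_of_le _ _ (by
      simp only [Fin.le_def, Fin.val_castSucc, Fin.val_succ] at *; omega)]
    congr 2

include H in
lemma hm_eq (n : ℕ) : hm n f = hm n g :=
  congrArg ModuleCat.Hom.hom (H.toHomotopy.map_homology_eq n)

end Htpy

end SMod
end
end BorelO2

namespace BorelO2

noncomputable section

open Simplicial

namespace SMod

/-! ### Subobjects, quotients and discrete simplicial vector spaces -/

/-- A simplicial subspace. -/
structure SubMod (X : SMod.{u}) where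
  N : ∀ q, Submodule ℚ (X.obj (op q))
  stable : ∀ {p q : SimplexCategory} (θ : p ⟶ q) (x : X.obj (op q)), x ∈ N q → X.pl θ x ∈ N p

namespace SubMod

variable {X : SMod.{u}} (S : X.SubMod)

/-- A simplicial subspace as a simplicial vector space. -/
def sub : SMod.{u} :=
  SMod.mk (fun q => S.N q) (fun θ => (X.pl θ).restrict (S.stable θ))
    (fun _ x => Subtype.ext (X.pl_id x.1)) (fun θ η x => Subtype.ext (X.pl_comp θ η x.1))

/-- The quotient by a simplicial subspace. -/
def quot : SMod.{u} :=
  SMod.mk (fun q => X.obj (op q) ⧸ S.N q) (fun θ => Submodule.mapQ _ _ (X.pl θ) (S.stable θ))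
    (fun q x => by
      obtain ⟨x, rfl⟩ := Submodule.mkQ_surjective _ x
      exact congrArg (S.N q).mkQ (X.pl_id x))
    (fun {p _ _} θ η x => by
      obtain ⟨x, rfl⟩ := Submodule.mkQ_surjective _ x
      exact congrArg (S.N p).mkQ (X.pl_comp θ η x))

/-- The inclusion of a simplicial subspace. -/
def ι : S.sub ⟶ X := homMk (fun q => (S.N q).subtype) (fun _ _ => rfl)

/-- The projection to the quotient by a simplicial subspace. -/
def π : X ⟶ S.quot := homMk (fun q => (S.N q).mkQ) (fun _ _ => rfl)

lemma ses : Ses S.ι S.π where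
  inj q := (S.N q).injective_subtype
  surj q := (S.N q).mkQ_surjective
  exact q x := by
    change (S.N q).mkQ x = 0 ↔ _
    rw [Submodule.mkQ_apply, Submodule.Quotient.mk_eq_zero]
    exact ⟨fun h => ⟨⟨x, h⟩, rfl⟩, fun ⟨y, hy⟩ => hy ▸ y.2⟩

/-- The kernel of a map of simplicial vector spaces. -/
def ker {Y : SMod.{u}} (f : X ⟶ Y) : X.SubMod where
  N q := LinearMap.ker (ap f q)
  stable θ x hx := by
    rw [LinearMap.mem_ker] at *
    rw [ap_pl, hx, map_zero]

/-- The image of a map of simplicial vector spaces. -/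
def range {Y : SMod.{u}} (f : Y ⟶ X) : X.SubMod where
  N q := LinearMap.range (ap f q)
  stable θ x hx := by
    obtain ⟨y, rfl⟩ := hx
    exact ⟨_, ap_pl f θ y⟩

lemma ses_ker {Y : SMod.{u}} (f : X ⟶ Y) (hf : ∀ q, Function.Surjective (ap f q)) :
    Ses (ker f).ι f where
  inj q := ((ker f).N q).injective_subtype
  surj := hf
  exact _ x := ⟨fun h => ⟨⟨x, h⟩, rfl⟩, fun ⟨y, hy⟩ => hy ▸ y.2⟩

/-- The restriction of an endomorphism to an invariant simplicial subspace. -/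
def res {X Y : SMod.{u}} (S : X.SubMod) (T : Y.SubMod) (φ : X ⟶ Y)
    (h : ∀ q x, x ∈ S.N q → ap φ q x ∈ T.N q) : S.sub ⟶ T.sub :=
  homMk (fun q => (ap φ q).restrict (h q)) (fun θ x => Subtype.ext (ap_pl φ θ x.1))

end SubMod

/-- If every simplex of positive dimension is the degeneracy of its zeroth vertex, then the
homology in positive degrees vanishes. -/
lemma subsingleton_of_discrete (X : SMod.{u})
    (hX : ∀ q (x : X.obj (op q)), X.pl (cst q q 0) x = x) (n : ℕ) :
    Subsingleton ((Hn (n + 1)).obj X) := by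
  have hp : ∀ {p q : SimplexCategory} (θ η : p ⟶ q) (x : X.obj (op q)),
      X.pl θ x = X.pl η x := by
    intro p q θ η x
    rw [← hX q x, ← pl_comp, ← pl_comp, comp_cst, comp_cst]
  have hbd : ∀ n (x : X.obj (op ⦋n + 1⦌)),
      X.bd n x = (∑ i : Fin (n + 2), (-1 : ℚ) ^ (i : ℕ)) • X.pl (SimplexCategory.δ 0) x := by
    intro n x
    rw [bd, LinearMap.sum_apply, Finset.sum_smul]
    apply Finset.sum_congr rfl
    intro i _
    rw [LinearMap.smul_apply, hp _ (SimplexCategory.δ 0)]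
  -- All faces agree, so the boundary map is alternately zero and a bijection.
  have hodd : ∀ n, Even n → ∀ x : X.obj (op ⦋n + 1⦌), X.bd n x = 0 := by
    intro n hn x
    have : ∑ i : Fin (n + 2), (-1 : ℚ) ^ (i : ℕ) = 0 := by
      rw [Fin.sum_univ_eq_sum_range (fun i => (-1 : ℚ) ^ i), neg_one_geom_sum, if_pos]
      exact hn.add (by decide)
    rw [hbd, this, zero_smul]
  have heven : ∀ n, ¬ Even n → ∀ x : X.obj (op ⦋n + 1⦌),
      X.bd n x = X.pl (SimplexCategory.δ 0) x := by
    intro n hn x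
    have : ∑ i : Fin (n + 2), (-1 : ℚ) ^ (i : ℕ) = 1 := by
      rw [Fin.sum_univ_eq_sum_range (fun i => (-1 : ℚ) ^ i), neg_one_geom_sum, if_neg]
      intro h
      apply hn
      rw [Nat.even_add] at h
      exact h.2 (by decide)
    rw [hbd, this, one_smul]
  have : ∀ x, x = (0 : (Hn (n + 1)).obj X) := by
    intro x
    obtain ⟨⟨x, hx⟩, rfl⟩ := X.cls_surjective _ x
    rw [cls_eq_zero_iff]
    have hx' : X.bd n x = 0 := by
      simpa using hx
    by_cases hn : Even n
    · refine ⟨X.pl (SimplexCategory.σ 0) x, ?_⟩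
      rw [heven _ (by simpa [Nat.even_add_one] using hn), ← pl_comp, hp _ (𝟙 _), pl_id]
    · refine ⟨0, ?_⟩
      rw [heven n hn] at hx'
      change _ = x
      rw [map_zero, ← pl_id X x,
        hp (𝟙 _) (SimplexCategory.σ 0 ≫ SimplexCategory.δ 0) x, pl_comp, hx', map_zero]
  exact ⟨fun a b => (this a).trans (this b).symm⟩

lemma subsingleton_of_htpy {X : SMod.{u}} (H : Htpy (0 : X ⟶ X) (𝟙 X)) (n : ℕ) :
    Subsingleton ((Hn n).obj X) := by
  have : ∀ x : (Hn n).obj X, x = 0 := by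
    intro x
    rw [← hm_id X n x, ← H.hm_eq, hm_zero]
  exact ⟨fun a b => (this a).trans (this b).symm⟩

/-- The homology of the fibre `W` of a map `Y → X` with `Y` acyclic is the homology of `X` shifted
by one, provided that the image of `Y` contains the path component of zero. -/
lemma exists_loop_equiv {W X Y : SMod.{u}} {i : W ⟶ Y} {p : Y ⟶ X}
    (hi : ∀ q, Function.Injective (ap i q)) (hip : ∀ q, Function.Exact (ap i q) (ap p q))
    (hY : ∀ n, Subsingleton ((Hn n).obj Y))
    (hX : ∀ q (x : X.obj (op q)), x - X.pl (cst q q 0) x ∈ LinearMap.range (ap p q)) (n : ℕ) :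
    ∃ e : (Hn (n + 1)).obj X ≃ₗ[ℚ] (Hn n).obj W,
      ∀ (a : W ⟶ W) (b : Y ⟶ Y) (c : X ⟶ X), i ≫ b = a ≫ i → p ≫ c = b ≫ p →
        ∀ x, e (hm (n + 1) c x) = hm n a (e x) := by
  -- The image `R` of `p` has the homology of `X` in positive degrees, since `X / R` is discrete.
  let R := SubMod.range p
  let p' : Y ⟶ R.sub := homMk (fun q => (ap p q).rangeRestrict)
    (fun θ x => Subtype.ext (ap_pl p θ x))
  have hp' : p' ≫ R.ι = p := rfl
  have h1 : Ses i p' :=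
    { inj := hi
      surj := fun q => (ap p q).surjective_rangeRestrict
      exact := fun q y => by
        rw [← hip q y]
        exact ⟨fun h => congrArg Subtype.val h, fun h => Subtype.ext h⟩ }
  have hQ : ∀ n, Subsingleton ((Hn (n + 1)).obj R.quot) := by
    apply subsingleton_of_discrete
    intro q x
    obtain ⟨x, rfl⟩ := R.ses.surj q x
    rw [← ap_pl, ← sub_eq_zero, ← map_sub]
    exact (Submodule.Quotient.mk_eq_zero _).2 (by
      rw [← neg_sub]; exact neg_mem (hX q x))
  let e1 := LinearEquiv.ofBijective (hm (n + 1) R.ι)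
    ⟨R.ses.injective_hm_i _ (hQ _), R.ses.surjective_hm_i _ (hQ _)⟩
  let e2 := LinearEquiv.ofBijective (h1.δ n) (h1.δ_bijective n (hY _) (hY _))
  refine ⟨e1.symm.trans e2, ?_⟩
  intro a b c hab hbc x
  have hR : ∀ q x, x ∈ R.N q → ap c q x ∈ R.N q := by
    rintro q _ ⟨y, rfl⟩
    exact ⟨ap b q y, by rw [← ap_comp, ← ap_comp, hbc]⟩
  let c' := SubMod.res R R c hR
  have hc' : R.ι ≫ c = c' ≫ R.ι := rfl
  obtain ⟨y, rfl⟩ := e1.surjective x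
  have h2 : hm (n + 1) c (e1 y) = e1 (hm (n + 1) c' y) := by
    change hm (n + 1) c (hm (n + 1) R.ι y) = hm (n + 1) R.ι (hm (n + 1) c' y)
    rw [← hm_comp, ← hm_comp, hc']
  rw [h2]
  simp only [LinearEquiv.trans_apply, LinearEquiv.symm_apply_apply]
  refine h1.δ_naturality h1 a b c' hab ?_ n y
  apply hom_ext'
  intro q x
  exact Subtype.ext (congrArg (fun f => ap f q x) hbc)

/-! ### Homology concentrated in one degree -/

/-- The homology of `X` is one-dimensional and concentrated in degree `m`, and the endomorphism `φ`
acts on it by `(-1) ^ k`. -/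
structure Conc (X : SMod.{u}) (φ : X ⟶ X) (m k : ℕ) : Prop where
  vanish : ∀ n, n ≠ m → Subsingleton ((Hn n).obj X)
  gen : ∃ z : (Hn m).obj X, z ≠ 0 ∧ (∀ y, ∃ c : ℚ, y = c • z) ∧ hm m φ z = (-1 : ℚ) ^ k • z

/-- Transport of concentration along isomorphisms of homology, allowing a shift of degree. -/
lemma Conc.of_equiv {X Y : SMod.{u}} {φ : X ⟶ X} {ψ : Y ⟶ Y} {m m' k k' : ℕ}
    (h : Conc X φ m k) (hv : ∀ n, n ≠ m' → Subsingleton ((Hn n).obj Y))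
    (e : (Hn m).obj X ≃ₗ[ℚ] (Hn m').obj Y)
    (he : ∀ x, hm m' ψ (e x) = (-1 : ℚ) ^ k' • e (hm m φ x)) : Conc Y ψ m' (k + k') := by
  refine ⟨hv, ?_⟩
  obtain ⟨z, h0, h1, h2⟩ := h.gen
  refine ⟨e z, by simpa using h0, fun y => ?_, ?_⟩
  · obtain ⟨c, hc⟩ := h1 (e.symm y)
    exact ⟨c, by rw [← map_smul, ← hc, e.apply_symm_apply]⟩
  · rw [he, h2, map_smul, smul_smul, pow_add, mul_comm]

lemma Conc.map {X Y : SMod.{u}} {φ : X ⟶ X} {ψ : Y ⟶ Y} {m k : ℕ}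
    (h : Conc X φ m k) (f : X ⟶ Y) (hf : ∀ n, Function.Bijective (hm n f))
    (hc : φ ≫ f = f ≫ ψ) : Conc Y ψ m k := by
  refine h.of_equiv (k' := 0) (fun n hn => ?_) (LinearEquiv.ofBijective _ (hf m)) (fun x => ?_)
  · have := h.vanish n hn
    exact (LinearEquiv.ofBijective _ (hf n)).symm.toEquiv.subsingleton
  · simp only [LinearEquiv.ofBijective_apply, pow_zero, one_smul]
    rw [← hm_comp, ← hm_comp, hc]

lemma Conc.comap {X Y : SMod.{u}} {φ : X ⟶ X} {ψ : Y ⟶ Y} {m k : ℕ}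
    (h : Conc Y ψ m k) (f : X ⟶ Y) (hf : ∀ n, Function.Bijective (hm n f))
    (hc : φ ≫ f = f ≫ ψ) : Conc X φ m k := by
  refine h.of_equiv (k' := 0) (fun n hn => ?_) (LinearEquiv.ofBijective _ (hf m)).symm
    (fun x => ?_)
  · have := h.vanish n hn
    exact (LinearEquiv.ofBijective _ (hf n)).toEquiv.subsingleton
  · obtain ⟨x, rfl⟩ := (LinearEquiv.ofBijective _ (hf m)).surjective x
    rw [pow_zero, one_smul, LinearEquiv.symm_apply_apply, LinearEquiv.eq_symm_apply]
    simp only [LinearEquiv.ofBijective_apply]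
    rw [← hm_comp, ← hm_comp, hc]

end SMod
end
end BorelO2

namespace BorelO2

noncomputable section

open Simplicial SMod

namespace SimplicialRep

/-! ### Morphisms of simplicial representations and the Borel construction -/

lemma pl_ρ (A : SimplicialRep.{u}) {p q : SimplexCategory} (θ : p ⟶ q) (g : Sing O2 q)
    (a : A.obj.obj (op q)) : pl A.obj θ (A.ρ q g a) = A.ρ p (Sing.pull θ g) (pl A.obj θ a) :=
  A.map_act θ g a

/-- The action of an element of `O(2)` through constant singular simplices. -/
def act (A : SimplicialRep.{u}) (g : O2) : A.obj ⟶ A.obj :=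
  homMk (fun q => A.ρ q (ContinuousMap.const _ g)) (fun θ x => (A.pl_ρ θ (ContinuousMap.const _ g) x).symm)

/-- Equivariant morphisms of simplicial representations. -/
structure RHom (A B : SimplicialRep.{u}) where
  f : A.obj ⟶ B.obj
  equivariant : ∀ q (g : Sing O2 q) (a : A.obj.obj (op q)),
    ap f q (A.ρ q g a) = B.ρ q g (ap f q a)

lemma RHom.act_comm {A B : SimplicialRep.{u}} (f : RHom A B) (g : O2) :
    A.act g ≫ f.f = f.f ≫ B.act g :=
  SMod.hom_ext' fun q a => f.equivariant q _ a

/-- The subrepresentation on an invariant simplicial subspace. -/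
def subRep (A : SimplicialRep.{u}) (S : SubMod A.obj)
    (hS : ∀ q (g : Sing O2 q) x, x ∈ S.N q → A.ρ q g x ∈ S.N q) : SimplicialRep.{u} where
  obj := S.sub
  ρ q :=
    { toFun g := (A.ρ q g).restrict (hS q g)
      map_one' := by
        apply LinearMap.ext
        intro x
        apply Subtype.ext
        change A.ρ q 1 x.1 = x.1
        rw [map_one]
        rfl
      map_mul' g h := by
        apply LinearMap.ext
        intro x
        apply Subtype.ext
        change A.ρ q (g * h) x.1 = A.ρ q g (A.ρ q h x.1)
        rw [map_mul]
        rfl }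
  map_act θ g a := Subtype.ext (A.pl_ρ θ g a.1)

/-- The kernel of an equivariant morphism. -/
def kerRep {A B : SimplicialRep.{u}} (f : RHom A B) : SimplicialRep.{u} :=
  A.subRep (SubMod.ker f.f) (fun q g x hx => by
    change ap f.f q _ = 0
    rw [f.equivariant, show ap f.f q x = 0 from hx, map_zero])

/-- The inclusion of the kernel of an equivariant morphism. -/
def kerι {A B : SimplicialRep.{u}} (f : RHom A B) : RHom (kerRep f) A where
  f := (SubMod.ker f.f).ι
  equivariant _ _ _ := rfl

/-- The class of `e ⊗ a` in the Borel construction. -/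
def bmk (A : SimplicialRep.{u}) {q : SimplexCategory} (e : EO2 q) (a : A.obj.obj (op q)) :
    A.borel.obj (op q) :=
  Representation.Coinvariants.mk ((A.diagRep q).comp (SingSO2 q).subtype) (Finsupp.single e a)

/-- Linear maps out of the Borel construction are determined by the classes `e ⊗ a`. -/
lemma borelObj_ext {A : SimplicialRep.{u}} {q : SimplexCategory} {M : Type v} [AddCommGroup M]
    [Module ℚ M] {f f' : A.borel.obj (op q) →ₗ[ℚ] M} (h : ∀ e a, f (A.bmk e a) = f' (A.bmk e a)) :
    f = f' := by
  apply Representation.Coinvariants.hom_ext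
  apply Finsupp.lhom_ext
  exact h

lemma bmk_smul (A : SimplicialRep.{u}) {q : SimplexCategory} {k : Sing O2 q} (hk : k ∈ SingSO2 q)
    (e : EO2 q) (a : A.obj.obj (op q)) :
    A.bmk (fun i => k * e i) (A.ρ q k a) = A.bmk e a := by
  have : A.diagRep q k (Finsupp.single e a) = Finsupp.single (fun i => k * e i) (A.ρ q k a) :=
    A.diagRep_single k e a
  exact (Representation.Coinvariants.mk_eq_iff _).2
    (Representation.Coinvariants.mem_ker_of_eq (⟨k, hk⟩ : SingSO2 q) (Finsupp.single e a) _
      (by rw [← this]; rfl))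

lemma bmk_add (A : SimplicialRep.{u}) {q : SimplexCategory} (e : EO2 q) (a b : A.obj.obj (op q)) :
    A.bmk e (a + b) = A.bmk e a + A.bmk e b := by
  simp [bmk]
  rfl

lemma bmk_zero (A : SimplicialRep.{u}) {q : SimplexCategory} (e : EO2 q) :
    A.bmk e 0 = 0 := by
  simp [bmk]
  rfl

/-- Descent of an invariant family of maps to the Borel construction. -/
def borelLift (A : SimplicialRep.{u}) {q : SimplexCategory} {M : Type v} [AddCommGroup M]
    [Module ℚ M] (f : EO2 q → A.obj.obj (op q) →ₗ[ℚ] M)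
    (hf : ∀ k ∈ SingSO2 q, ∀ e a, f (fun i => k * e i) (A.ρ q k a) = f e a) :
    A.borel.obj (op q) →ₗ[ℚ] M :=
  Representation.Coinvariants.lift _ (Finsupp.lsum ℚ f) (by
    rintro ⟨k, hk⟩
    apply Finsupp.lhom_ext
    intro e a
    change (Finsupp.lsum ℚ f) (A.diagRep q k (Finsupp.single e a)) = _
    rw [diagRep_single]
    simpa using! hf k hk e a)

@[simp] lemma borelLift_bmk (A : SimplicialRep.{u}) {q : SimplexCategory} {M : Type v}
    [AddCommGroup M] [Module ℚ M] (f : EO2 q → A.obj.obj (op q) →ₗ[ℚ] M)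
    (hf : ∀ k ∈ SingSO2 q, ∀ e a, f (fun i => k * e i) (A.ρ q k a) = f e a) (e a) :
    A.borelLift f hf (A.bmk e a) = f e a := by
  change (Finsupp.lsum ℚ f) (Finsupp.single e a) = _
  simp

lemma pl_bmk (A : SimplicialRep.{u}) {p q : SimplexCategory} (θ : p ⟶ q) (e : EO2 q)
    (a : A.obj.obj (op q)) :
    pl A.borel θ (A.bmk e a) = A.bmk (EO2.pull θ e) (pl A.obj θ a) :=
  congrArg (Representation.Coinvariants.mk _) (A.diagMap_single θ e a)

lemma borelAct_bmk (A : SimplicialRep.{u}) (g : O2) {q : SimplexCategory} (e : EO2 q)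
    (a : A.obj.obj (op q)) :
    ap (A.borelAct g) q (A.bmk e a) =
      A.bmk (fun i => ContinuousMap.const _ g * e i) (A.ρ q (ContinuousMap.const _ g) a) :=
  congrArg (Representation.Coinvariants.mk _) (A.diagRep_single (ContinuousMap.const _ g) e a)

/-- `bmk` as a linear map in the second variable. -/
def bmkₗ (A : SimplicialRep.{u}) {q : SimplexCategory} (e : EO2 q) :
    A.obj.obj (op q) →ₗ[ℚ] A.borel.obj (op q) where
  toFun := A.bmk e
  map_add' := A.bmk_add e
  map_smul' c a := by
    simp [bmk, ← Finsupp.smul_single]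
    rfl

/-- The map of Borel constructions induced by an equivariant linear map in one degree. -/
def borelLin {A B : SimplicialRep.{u}} {q : SimplexCategory}
    (f : A.obj.obj (op q) →ₗ[ℚ] B.obj.obj (op q))
    (hf : ∀ g a, f (A.ρ q g a) = B.ρ q g (f a)) : A.borel.obj (op q) →ₗ[ℚ] B.borel.obj (op q) :=
  A.borelLift (fun e => B.bmkₗ e ∘ₗ f) (fun k hk e a => by
    change B.bmk _ (f _) = B.bmk _ _
    rw [hf, B.bmk_smul hk])

@[simp] lemma borelLin_bmk {A B : SimplicialRep.{u}} {q : SimplexCategory}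
    (f : A.obj.obj (op q) →ₗ[ℚ] B.obj.obj (op q))
    (hf : ∀ g a, f (A.ρ q g a) = B.ρ q g (f a)) (e a) :
    borelLin f hf (A.bmk e a) = B.bmk e (f a) := by
  rw [borelLin, borelLift_bmk]
  rfl

/-- To check an identity of linear maps on the Borel construction, it suffices to check it on
the classes `e ⊗ a`. -/
lemma borel_induction {A : SimplicialRep.{u}} {q : SimplexCategory} {M : Type v} [AddCommGroup M]
    [Module ℚ M] (f f' : A.borel.obj (op q) →ₗ[ℚ] M)
    (h : ∀ e a, f (A.bmk e a) = f' (A.bmk e a)) (x : A.borel.obj (op q)) : f x = f' x :=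
  LinearMap.congr_fun (borelObj_ext (A := A) (f := f) (f' := f') h) x

/-- The map of Borel constructions induced by an equivariant morphism. -/
def borelHom {A B : SimplicialRep.{u}} (f : RHom A B) : A.borel ⟶ B.borel :=
  homMk (fun q => borelLin (ap f.f q) (f.equivariant q)) (fun {p q} θ x => by
    refine borel_induction (borelLin (ap f.f p) (f.equivariant p) ∘ₗ pl A.borel θ)
      (pl B.borel θ ∘ₗ borelLin (ap f.f q) (f.equivariant q)) (fun e a => ?_) x
    simp only [LinearMap.comp_apply]
    rw [pl_bmk, borelLin_bmk]
    refine Eq.trans ?_ (congrArg (pl B.borel θ) (borelLin_bmk (ap f.f q) _ e a).symm)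
    rw [pl_bmk, ap_pl])

@[simp] lemma borelHom_bmk {A B : SimplicialRep.{u}} (f : RHom A B) {q : SimplexCategory} (e : EO2 q)
    (a : A.obj.obj (op q)) :
    ap (borelHom f) q (A.bmk e a) = B.bmk e (ap f.f q a) :=
  borelLin_bmk (ap f.f q) (f.equivariant q) e a

lemma borelHom_act {A B : SimplicialRep.{u}} (f : RHom A B) (g : O2) :
    borelHom f ≫ B.borelAct g = A.borelAct g ≫ borelHom f := by
  apply SMod.hom_ext'
  intro q x
  refine borel_induction (ap (borelHom f ≫ B.borelAct g) q) (ap (A.borelAct g ≫ borelHom f) q)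
    (fun e a => ?_) x
  rw [ap_comp, ap_comp, borelHom_bmk, borelAct_bmk]
  refine Eq.trans ?_ (congrArg (ap (borelHom f) q) (borelAct_bmk A g e a).symm)
  rw [borelHom_bmk, f.equivariant]

/-! ### Exactness of the Borel construction -/

/-- The element of the subgroup `Sing SO(2)` by which `g` differs from the chosen representative
of its coset. -/
def cosetPart {q : SimplexCategory} (g : Sing O2 q) : Sing O2 q :=
  g * (Quotient.out (Quotient.mk (QuotientGroup.rightRel (SingSO2 q)) g))⁻¹

lemma cosetPart_mem {q : SimplexCategory} (g : Sing O2 q) : cosetPart g ∈ SingSO2 q := by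
  have : (QuotientGroup.rightRel (SingSO2 q))
      (Quotient.out (Quotient.mk (QuotientGroup.rightRel (SingSO2 q)) g)) g :=
    Quotient.exact (Quotient.out_eq _)
  exact QuotientGroup.rightRel_apply.1 this

lemma cosetPart_mul {q : SimplexCategory} {k : Sing O2 q} (hk : k ∈ SingSO2 q) (g : Sing O2 q) :
    cosetPart (k * g) = k * cosetPart g := by
  have : Quotient.mk (QuotientGroup.rightRel (SingSO2 q)) (k * g) =
      Quotient.mk (QuotientGroup.rightRel (SingSO2 q)) g := by
    apply Quotient.sound
    rw [← Quotient.eq_iff_equiv, Quotient.eq]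
    apply QuotientGroup.rightRel_apply.2
    simpa using! inv_mem hk
  rw [cosetPart, cosetPart, this, mul_assoc]

/-- Normal forms of elements of the Borel construction. They exist since `Sing SO(2)` acts freely
on `E O(2)`. -/
def normalForm (A : SimplicialRep.{u}) (q : SimplexCategory) :
    A.borel.obj (op q) →ₗ[ℚ] (EO2 q →₀ A.obj.obj (op q)) :=
  A.borelLift (fun e => Finsupp.lsingle (fun i => (cosetPart (e 0))⁻¹ * e i) ∘ₗ
    A.ρ q (cosetPart (e 0))⁻¹) (fun k hk e a => by
      simp only [LinearMap.comp_apply]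
      rw [cosetPart_mul hk, mul_inv_rev]
      congr 1
      · congr 1
        funext i
        group
      · rw [← Module.End.mul_apply, ← map_mul]
        congr 2
        group)

lemma normalForm_bmk (A : SimplicialRep.{u}) {q : SimplexCategory} (e : EO2 q)
    (a : A.obj.obj (op q)) : A.normalForm q (A.bmk e a) =
      Finsupp.single (fun i => (cosetPart (e 0))⁻¹ * e i) (A.ρ q (cosetPart (e 0))⁻¹ a) := by
  rw [normalForm, borelLift_bmk]
  rfl

/-- The projection to the Borel construction. -/
def bproj (A : SimplicialRep.{u}) (q : SimplexCategory) :
    (EO2 q →₀ A.obj.obj (op q)) →ₗ[ℚ] A.borel.obj (op q) :=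
  Representation.Coinvariants.mk ((A.diagRep q).comp (SingSO2 q).subtype)

lemma bproj_normalForm (A : SimplicialRep.{u}) {q : SimplexCategory} (x : A.borel.obj (op q)) :
    A.bproj q (A.normalForm q x) = x := by
  refine LinearMap.congr_fun
    (borelObj_ext (f := A.bproj q ∘ₗ A.normalForm q) (f' := LinearMap.id) fun e a => ?_) x
  simp only [LinearMap.comp_apply, LinearMap.id_apply]
  rw [normalForm_bmk]
  exact A.bmk_smul (inv_mem (cosetPart_mem (e 0))) e a

lemma normalForm_borelHom {A B : SimplicialRep.{u}} (f : RHom A B) {q : SimplexCategory}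
    (x : A.borel.obj (op q)) : B.normalForm q (ap (borelHom f) q x) =
      Finsupp.mapRange.linearMap (ap f.f q) (A.normalForm q x) := by
  refine LinearMap.congr_fun
    (borelObj_ext (A := A) (f := B.normalForm q ∘ₗ ap (borelHom f) q)
      (f' := Finsupp.mapRange.linearMap (ap f.f q) ∘ₗ A.normalForm q) fun e a => ?_) x
  simp only [LinearMap.comp_apply]
  rw [borelHom_bmk, normalForm_bmk, normalForm_bmk, Finsupp.mapRange.linearMap_apply,
    Finsupp.mapRange_single, f.equivariant]

lemma borelHom_bproj {A B : SimplicialRep.{u}} (f : RHom A B) {q : SimplexCategory}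
    (x : EO2 q →₀ A.obj.obj (op q)) : ap (borelHom f) q (A.bproj q x) =
      B.bproj q (Finsupp.mapRange.linearMap (ap f.f q) x) := by
  refine LinearMap.congr_fun (f := ap (borelHom f) q ∘ₗ A.bproj q)
    (g := B.bproj q ∘ₗ Finsupp.mapRange.linearMap (ap f.f q)) ?_ x
  apply Finsupp.lhom_ext
  intro e a
  rw [LinearMap.comp_apply, LinearMap.comp_apply, Finsupp.mapRange.linearMap_apply,
    Finsupp.mapRange_single]
  exact borelHom_bmk f e a

/-- The Borel construction is exact. -/
lemma borel_ses {A B C : SimplicialRep.{u}} {f : RHom A B} {g : RHom B C} (h : Ses f.f g.f) :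
    Ses (borelHom f) (borelHom g) where
  inj q := by
    rw [injective_iff_map_eq_zero]
    intro x hx
    have h1 := normalForm_borelHom f x
    rw [hx, map_zero] at h1
    have h2 : A.normalForm q x = 0 := by
      ext e
      apply h.inj q
      rw [Finsupp.coe_zero, Pi.zero_apply, map_zero]
      exact (DFunLike.congr_fun h1 e).symm
    rw [← A.bproj_normalForm x, h2, map_zero]
  exact q y := by
    constructor
    · intro hy
      -- Lift the normal form of `y` to `A` coefficient by coefficient.
      have h1 := normalForm_borelHom g y
      rw [hy, map_zero] at h1
      have h2 : ∀ e, ∃ a, ap f.f q a = B.normalForm q y e := fun e =>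
        (h.exact q _).1 (DFunLike.congr_fun h1 e).symm
      choose s hs using h2
      classical
      refine ⟨A.bproj q (Finsupp.onFinset (B.normalForm q y).support
        (fun e => if B.normalForm q y e = 0 then 0 else s e) (fun e he => ?_)), ?_⟩
      · rw [Finsupp.mem_support_iff]
        intro h0
        exact he (if_pos h0)
      · rw [borelHom_bproj]
        refine Eq.trans (congrArg _ ?_) (B.bproj_normalForm y)
        ext e
        rw [Finsupp.mapRange.linearMap_apply, Finsupp.mapRange_apply, Finsupp.onFinset_apply]
        split_ifs with h0
        · rw [map_zero, h0]
        · exact hs e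
    · rintro ⟨x, rfl⟩
      refine borel_induction (ap (borelHom g) q ∘ₗ ap (borelHom f) q) 0 (fun e a => ?_) x
      simp only [LinearMap.comp_apply, LinearMap.zero_apply]
      rw [borelHom_bmk, borelHom_bmk, (h.exact q).apply_apply_eq_zero, bmk_zero]
  surj q y := by
    have h2 : Function.Surjective (Finsupp.mapRange.linearMap (α := EO2 q) (ap g.f q)) :=
      Finsupp.mapRange_surjective _ (map_zero _) (h.surj q)
    obtain ⟨x, hx⟩ := h2 (C.normalForm q y)
    exact ⟨B.bproj q x, by rw [borelHom_bproj, hx]; exact C.bproj_normalForm y⟩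

end SimplicialRep
end
end BorelO2

namespace BorelO2

noncomputable section

open Simplicial SMod

/-! ### Path objects -/

/-- The minimum of two simplices of `Δ¹`. -/
def mn {p : SimplexCategory} (α β : p ⟶ ⦋1⦌) : p ⟶ ⦋1⦌ :=
  SimplexCategory.Hom.mk
    { toFun i := min (α.toOrderHom i) (β.toOrderHom i)
      monotone' _ _ h := min_le_min (α.toOrderHom.monotone h) (β.toOrderHom.monotone h) }

lemma mn_c1 {p : SimplexCategory} (α : p ⟶ ⦋1⦌) : mn α (c1 p) = α := by
  ext i : 3
  exact min_eq_left (Fin.le_last _)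

lemma mn_c0 {p : SimplexCategory} (α : p ⟶ ⦋1⦌) : mn α (c0 p) = c0 p := by
  ext i : 3
  exact min_eq_right (Fin.zero_le _)

lemma c0_mn {p : SimplexCategory} (α : p ⟶ ⦋1⦌) : mn (c0 p) α = c0 p := by
  ext i : 3
  exact min_eq_left (Fin.zero_le _)

/-- The contraction of the simplex `q` to its zeroth vertex, as a map `Δ^q × Δ¹ → Δ^q`. -/
def ctr {p q : SimplexCategory} (s : p ⟶ q) (τ : p ⟶ ⦋1⦌) : p ⟶ q :=
  SimplexCategory.Hom.mk
    { toFun i := if τ.toOrderHom i = 0 then 0 else s.toOrderHom i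
      monotone' i j h := by
        dsimp only
        split_ifs with h1 h2 h2
        · exact le_rfl
        · exact Fin.zero_le _
        · exfalso
          have h3 := τ.toOrderHom.monotone h
          rw [h2] at h3
          exact h1 (le_antisymm h3 (Fin.zero_le _))
        · exact s.toOrderHom.monotone h }

lemma comp_ctr {p' p q : SimplexCategory} (t : p' ⟶ p) (s : p ⟶ q) (τ : p ⟶ ⦋1⦌) :
    t ≫ ctr s τ = ctr (t ≫ s) (t ≫ τ) := rfl

lemma ctr_c1 {p q : SimplexCategory} (s : p ⟶ q) : ctr s (c1 p) = s := by
  ext i : 3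
  change (if (1 : Fin 2) = 0 then 0 else s.toOrderHom i) = s.toOrderHom i
  rw [if_neg (by decide)]

lemma ctr_c0 {p q : SimplexCategory} (s : p ⟶ q) : ctr s (c0 p) = cst p q 0 := by
  ext i : 3
  change (if (0 : Fin 2) = 0 then 0 else s.toOrderHom i) = 0
  rw [if_pos rfl]

namespace SMod

/-- The `q`-simplices of the path object: maps `Δ^q × Δ¹ → X` that vanish on `Δ^q × {0}`. -/
def pathModule (X : SMod.{u}) (q : SimplexCategory) :
    Submodule ℚ (∀ p : SimplexCategory, (p ⟶ q) → (p ⟶ ⦋1⦌) → X.obj (op p)) where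
  carrier := {f | (∀ (p p' : SimplexCategory) (t : p' ⟶ p) (s : p ⟶ q) (τ : p ⟶ ⦋1⦌),
    X.pl t (f p s τ) = f p' (t ≫ s) (t ≫ τ)) ∧ ∀ p s, f p s (c0 p) = 0}
  add_mem' hf hg := ⟨fun p p' t s τ => by simp [hf.1 p p' t s τ, hg.1 p p' t s τ],
    fun p s => by simp [hf.2 p s, hg.2 p s]⟩
  zero_mem' := ⟨fun p p' t s τ => by simp, fun p s => rfl⟩
  smul_mem' c f hf := ⟨fun p p' t s τ => by simp [hf.1 p p' t s τ],
    fun p s => by simp [hf.2 p s]⟩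

/-- The path object of a simplicial vector space. -/
def path (X : SMod.{u}) : SMod.{u} :=
  SMod.mk (fun q => X.pathModule q)
    (fun {p q} θ =>
      { toFun f := ⟨fun r s τ => f.1 r (s ≫ θ) τ,
          fun r r' t s τ => f.2.1 r r' t (s ≫ θ) τ, fun r s => f.2.2 r (s ≫ θ)⟩
        map_add' _ _ := rfl
        map_smul' _ _ := rfl })
    (fun _ f => Subtype.ext (by
      funext r s τ
      exact congrArg (fun s => f.1 r s τ) (Category.comp_id s)))
    (fun θ η f => Subtype.ext (by
      funext r s τ
      exact congrArg (fun s => f.1 r s τ) (Category.assoc s θ η).symm))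

/-- The endpoint of a path. -/
def pathEv (X : SMod.{u}) : X.path ⟶ X :=
  homMk (fun q =>
    { toFun f := f.1 q (𝟙 q) (c1 q)
      map_add' _ _ := rfl
      map_smul' _ _ := rfl })
    (fun θ f => (f.2.1 _ _ θ (𝟙 _) (c1 _)).symm)

/-- The contraction of paths. -/
def pathContr (X : SMod.{u}) (q : SimplexCategory) (θ : q ⟶ ⦋1⦌) :
    X.path.obj (op q) →ₗ[ℚ] X.path.obj (op q) :=
  show X.pathModule q →ₗ[ℚ] X.pathModule q from
  { toFun f := ⟨fun p s τ => f.1 p s (mn τ (s ≫ θ)),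
      fun r r' t s τ => f.2.1 r r' t s (mn τ (s ≫ θ)),
      fun r s => (congrArg (f.1 r s) (c0_mn _)).trans (f.2.2 r s)⟩
    map_add' _ _ := rfl
    map_smul' _ _ := rfl }

lemma pl_pathContr (X : SMod.{u}) {p q : SimplexCategory} (η : p ⟶ q) (θ : q ⟶ ⦋1⦌) (f) :
    X.path.pl η (X.pathContr q θ f) = X.pathContr p (η ≫ θ) (X.path.pl η f) := rfl

lemma pathContr_c1 (X : SMod.{u}) (q : SimplexCategory) (f) : X.pathContr q (c1 q) f = f := by
  apply Subtype.ext
  funext p s τ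
  exact congrArg (f.1 p s) (mn_c1 τ)

lemma pathContr_c0 (X : SMod.{u}) (q : SimplexCategory) (f) : X.pathContr q (c0 q) f = 0 := by
  apply Subtype.ext
  funext p s τ
  exact (congrArg (f.1 p s) (mn_c0 τ)).trans (f.2.2 p s)

/-- Path objects are contractible. -/
def pathHtpy (X : SMod.{u}) : Htpy (0 : X.path ⟶ X.path) (𝟙 X.path) where
  K := X.pathContr
  nat := X.pl_pathContr
  zero := X.pathContr_c0
  one := X.pathContr_c1

lemma subsingleton_path (X : SMod.{u}) (n : ℕ) : Subsingleton ((Hn n).obj X.path) :=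
  subsingleton_of_htpy X.pathHtpy n

/-- The path that contracts a simplex to its zeroth vertex shows that every simplex differs from
a constant one by the end point of a path. -/
lemma sub_cst_mem_range (X : SMod.{u}) (q : SimplexCategory) (x : X.obj (op q)) :
    x - X.pl (cst q q 0) x ∈ LinearMap.range (ap X.pathEv q) := by
  refine ⟨(⟨fun p s τ => X.pl (ctr s τ) x - X.pl (cst p q 0) x, ?_, ?_⟩ : X.pathModule q), ?_⟩
  · intro p p' t s τ
    rw [map_sub, ← pl_comp, ← pl_comp, comp_ctr, comp_cst]
  · intro p s
    dsimp only
    rw [ctr_c0, sub_self]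
  · change X.pl (ctr (𝟙 q) (c1 q)) x - _ = _
    rw [ctr_c1, pl_id]

/-- If `H_0` vanishes, then every simplex is the end point of a path. -/
lemma pathEv_surjective (X : SMod.{u}) (h0 : Subsingleton ((Hn 0).obj X)) (q : SimplexCategory) :
    Function.Surjective (ap X.pathEv q) := by
  intro x
  suffices h : X.pl (cst q q 0) x ∈ LinearMap.range (ap X.pathEv q) by
    have := add_mem (X.sub_cst_mem_range q x) h
    rwa [sub_add_cancel] at this
  -- The zeroth vertex of `x` bounds an edge `y`; following `y` gives a path to that vertex,
  -- which starts at zero after subtracting its constant initial value.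
  let v : ⦋0⦌ ⟶ q := cst ⦋0⦌ q 0
  let w : q ⟶ ⦋0⦌ := cst q ⦋0⦌ 0
  have hv : cst q q 0 = w ≫ v := rfl
  rw [hv, pl_comp, ← SMod.ap_id X q (X.pl w _)]
  obtain ⟨y, hy⟩ := (X.cls_eq_zero_iff 0 ⟨X.pl v x, by simp⟩).1 (Subsingleton.elim _ _)
  change X.bd 0 y = X.pl v x at hy
  have hy' : X.pl (SimplexCategory.δ 0) y - X.pl (SimplexCategory.δ 1) y = X.pl v x := by
    rw [← hy, bd, LinearMap.sum_apply, Fin.sum_univ_two]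
    simp [sub_eq_add_neg]
  have h1 : ∀ {p : SimplexCategory}, (c1 p) = cst p ⦋0⦌ 0 ≫ SimplexCategory.δ (0 : Fin 2) := by
    intro p
    ext i : 3
    rfl
  have h2 : ∀ {p : SimplexCategory}, (c0 p) = cst p ⦋0⦌ 0 ≫ SimplexCategory.δ (1 : Fin 2) := by
    intro p
    ext i : 3
    rfl
  refine ⟨(⟨fun p s τ => X.pl τ y - X.pl (c0 p) y, ?_, ?_⟩ : X.pathModule q), ?_⟩
  · intro p p' t s τ
    rw [map_sub, ← pl_comp, ← pl_comp]
    rfl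
  · intro p s
    exact sub_self _
  · change X.pl (c1 q) y - X.pl (c0 q) y = X.pl w (X.pl v x)
    rw [h1, h2, pl_comp, pl_comp, ← map_sub, hy']

end SMod

namespace SimplicialRep

/-- The action on paths. -/
def pathAct (A : SimplicialRep.{u}) (q : SimplexCategory) (g : Sing O2 q) :
    pathModule A.obj q →ₗ[ℚ] pathModule A.obj q where
  toFun f := ⟨fun p s τ => A.ρ p (Sing.pull s g) (f.1 p s τ),
    fun p p' t s τ => by
      dsimp only
      rw [pl_ρ, f.2.1 p p' t s τ, pull_comp],
    fun p s => by
      dsimp only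
      rw [f.2.2 p s, map_zero]⟩
  map_add' f f' := by
    apply Subtype.ext
    funext p s τ
    exact map_add _ _ _
  map_smul' c f := by
    apply Subtype.ext
    funext p s τ
    exact map_smul _ _ _

/-- The path object of a simplicial representation. -/
def pathRep (A : SimplicialRep.{u}) : SimplicialRep.{u} where
  obj := SMod.path A.obj
  ρ q :=
    { toFun g := A.pathAct q g
      map_one' := by
        apply LinearMap.ext
        intro f
        apply Subtype.ext
        funext p s τ
        change A.ρ p 1 (f.1 p s τ) = f.1 p s τ
        rw [map_one, Module.End.one_apply]
      map_mul' g h := by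
        apply LinearMap.ext
        intro f
        apply Subtype.ext
        funext p s τ
        change A.ρ p (Sing.pull s g * Sing.pull s h) (f.1 p s τ) =
          A.ρ p (Sing.pull s g) (A.ρ p (Sing.pull s h) (f.1 p s τ))
        rw [map_mul, Module.End.mul_apply] }
  map_act {p q} θ g f := by
    apply Subtype.ext
    funext r s τ
    change A.ρ r (Sing.pull (s ≫ θ) g) (f.1 r (s ≫ θ) τ) =
      A.ρ r (Sing.pull s (Sing.pull θ g)) (f.1 r (s ≫ θ) τ)
    rw [pull_comp]

/-- The endpoint map of the path object. -/
def pathEvR (A : SimplicialRep.{u}) : RHom A.pathRep A where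
  f := SMod.pathEv A.obj
  equivariant q g f := by
    change A.ρ q (Sing.pull (𝟙 q) g) (f.1 q (𝟙 q) (c1 q)) = A.ρ q g (f.1 q (𝟙 q) (c1 q))
    rw [BorelO2.pull_id]

/-- The loop object of a simplicial representation. -/
def loop (A : SimplicialRep.{u}) : SimplicialRep.{u} := kerRep A.pathEvR

/-- Loops as paths. -/
def loopι (A : SimplicialRep.{u}) : RHom A.loop A.pathRep := kerι A.pathEvR

lemma loop_inj (A : SimplicialRep.{u}) (q : SimplexCategory) :
    Function.Injective (ap A.loopι.f q) :=
  ((SubMod.ker A.pathEvR.f).N q).injective_subtype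

lemma loop_exact (A : SimplicialRep.{u}) (q : SimplexCategory) :
    Function.Exact (ap A.loopι.f q) (ap A.pathEvR.f q) :=
  fun x => ⟨fun h => ⟨⟨x, h⟩, rfl⟩, fun ⟨y, hy⟩ => hy ▸ y.2⟩

lemma loop_ses (A : SimplicialRep.{u}) (h0 : Subsingleton ((Hn 0).obj A.obj)) :
    Ses A.loopι.f A.pathEvR.f :=
  ⟨A.loop_inj, A.loop_exact, pathEv_surjective A.obj h0⟩

/-- The homology of loops. -/
lemma exists_loop_homology_equiv (A : SimplicialRep.{u}) (n : ℕ) :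
    ∃ e : (Hn (n + 1)).obj A.obj ≃ₗ[ℚ] (Hn n).obj A.loop.obj,
      ∀ g x, e (hm (n + 1) (A.act g) x) = hm n (A.loop.act g) (e x) := by
  obtain ⟨e, he⟩ := exists_loop_equiv A.loop_inj A.loop_exact (subsingleton_path A.obj)
    (sub_cst_mem_range A.obj) n
  exact ⟨e, fun g => he _ _ _ (A.loopι.act_comm g).symm (A.pathEvR.act_comm g).symm⟩

/-- An equivariant contraction induces a contraction of the Borel construction. -/
def borelHtpy {A : SimplicialRep.{u}} (H : Htpy (0 : A.obj ⟶ A.obj) (𝟙 A.obj))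
    (hH : ∀ q θ g a, H.K q θ (A.ρ q g a) = A.ρ q g (H.K q θ a)) :
    Htpy (0 : A.borel ⟶ A.borel) (𝟙 A.borel) where
  K q θ := borelLin (H.K q θ) (hH q θ)
  nat {p q} η θ x := by
    refine borel_induction (pl A.borel η ∘ₗ borelLin (H.K q θ) (hH q θ))
      (borelLin (H.K p (η ≫ θ)) (hH p (η ≫ θ)) ∘ₗ pl A.borel η) (fun e a => ?_) x
    rw [LinearMap.comp_apply, LinearMap.comp_apply, borelLin_bmk, pl_bmk, pl_bmk, borelLin_bmk,
      H.nat]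
  zero q x := by
    refine borel_induction (borelLin (H.K q (c0 q)) (hH q _)) 0 (fun e a => ?_) x
    rw [borelLin_bmk, LinearMap.zero_apply, H.zero]
    exact bmk_zero _ _
  one q x := by
    refine borel_induction (borelLin (H.K q (c1 q)) (hH q _)) LinearMap.id (fun e a => ?_) x
    rw [borelLin_bmk, LinearMap.id_apply, H.one, SMod.ap_id]

/-- The Borel construction of a path object is contractible, because the contraction of paths is
equivariant. -/
lemma subsingleton_borel_path (A : SimplicialRep.{u}) (n : ℕ) :
    Subsingleton ((Hn n).obj A.pathRep.borel) :=
  subsingleton_of_htpy (borelHtpy (A := A.pathRep) (pathHtpy A.obj) fun _ _ _ _ => rfl) n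

lemma subsingleton_borel_zero (A : SimplicialRep.{u}) (h0 : Subsingleton ((Hn 0).obj A.obj)) :
    Subsingleton ((Hn 0).obj A.borel) := by
  have : ∀ x : (Hn 0).obj A.borel, x = 0 := by
    intro x
    obtain ⟨⟨x, hx⟩, rfl⟩ := cls_surjective A.borel 0 x
    have hrange : ∀ x, x ∈ LinearMap.range (bd A.borel 0) := by
      intro x
      rw [← Submodule.Quotient.mk_eq_zero]
      refine borel_induction (A := A) (LinearMap.range (bd A.borel 0)).mkQ 0 (fun e a => ?_) x
      rw [LinearMap.zero_apply, Submodule.mkQ_apply, Submodule.Quotient.mk_eq_zero]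
      obtain ⟨b, hb⟩ := (cls_eq_zero_iff A.obj 0 ⟨a, by simp⟩).1 (Subsingleton.elim _ _)
      change bd A.obj 0 b = a at hb
      -- Both faces of the degenerate edge of `E O(2)` at `e` are `e`.
      refine ⟨A.bmk (fun _ => Sing.pull (SimplexCategory.σ 0) (e 0)) b, ?_⟩
      have key : ∀ i : Fin 2, EO2.pull (SimplexCategory.δ i)
          (fun _ : Fin 2 => Sing.pull (SimplexCategory.σ (0 : Fin 1)) (e 0)) = e := by
        intro i
        funext j
        change Sing.pull (SimplexCategory.δ i) (Sing.pull (SimplexCategory.σ (0 : Fin 1)) (e 0)) = _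
        rw [← BorelO2.pull_comp, show j = 0 from Subsingleton.elim (α := Fin 1) j 0,
          Subsingleton.elim (SimplexCategory.δ i ≫ SimplexCategory.σ (0 : Fin 1)) (𝟙 _),
          BorelO2.pull_id]
      rw [bd, LinearMap.sum_apply, ← hb, bd, LinearMap.sum_apply]
      have h1 : ∀ y : A.obj.obj (op ⦋0⦌), A.bmk e y = A.bmkₗ e y := fun _ => rfl
      rw [h1, map_sum]
      apply Finset.sum_congr rfl
      intro i _
      rw [LinearMap.smul_apply, LinearMap.smul_apply, map_smul, pl_bmk]
      refine congrArg _ ?_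
      exact congrArg (fun e' => A.bmk e' _) (key i)
    obtain ⟨y, hy⟩ := hrange x
    exact (cls_eq_zero_iff A.borel 0 ⟨x, hx⟩).2 ⟨y, hy⟩
  exact ⟨fun a b => (this a).trans (this b).symm⟩

/-- Looping shifts Borel homology. -/
lemma exists_borel_loop_equiv (A : SimplicialRep.{u}) (h0 : Subsingleton ((Hn 0).obj A.obj))
    (n : ℕ) :
    ∃ e : (Hn (n + 1)).obj A.borel ≃ₗ[ℚ] (Hn n).obj A.loop.borel,
      ∀ g x, e (hm (n + 1) (A.borelAct g) x) = hm n (A.loop.borelAct g) (e x) := by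
  have h := borel_ses (A.loop_ses h0)
  exact ⟨LinearEquiv.ofBijective _ (h.δ_bijective n (A.subsingleton_borel_path _)
    (A.subsingleton_borel_path _)), fun g x => h.δ_naturality h _ _ _
      (borelHom_act A.loopι g) (borelHom_act A.pathEvR g) n x⟩

/-- The Borel construction preserves acyclicity. -/
lemma subsingleton_borel (n : ℕ) : ∀ A : SimplicialRep.{u},
    (∀ n, Subsingleton ((Hn n).obj A.obj)) → Subsingleton ((Hn n).obj A.borel) := by
  induction n with
  | zero => exact fun A h => A.subsingleton_borel_zero (h 0)
  | succ n ih =>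
    intro A h
    obtain ⟨e, -⟩ := A.exists_borel_loop_equiv (h 0) n
    have : Subsingleton ((Hn n).obj A.loop.borel) := ih _ fun m => by
      obtain ⟨e, -⟩ := A.exists_loop_homology_equiv m
      have := h (m + 1)
      exact e.symm.toEquiv.subsingleton
    exact e.toEquiv.subsingleton

end SimplicialRep
end
end BorelO2

namespace BorelO2

noncomputable section

open Simplicial SMod

/-! ### Signs, rotations and the reflection in `O(2)` -/

/-- The sign of an element of `O(2)`. -/
def sgn (g : O2) : ℚ := signChar (QuotientGroup.mk g)

lemma sgn_eq_sign (g : O2) : sgn g = (SignType.sign (det g) : ℚ) := rfl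

lemma sgn_one : sgn 1 = 1 := map_one signChar

lemma sgn_mul (g h : O2) : sgn (g * h) = sgn g * sgn h := map_mul signChar (QuotientGroup.mk g) (QuotientGroup.mk h)

lemma det_mul_self (g : O2) : det g * det g = 1 := by
  have h := (Matrix.mem_orthogonalGroup_iff (Fin 2) ℝ).1 g.2
  have h2 := congrArg Matrix.det h
  rwa [Matrix.det_mul, Matrix.det_transpose, Matrix.det_one] at h2

lemma det_eq_one_or (g : O2) : det g = 1 ∨ det g = -1 := mul_self_eq_one_iff.1 (det_mul_self g)

lemma sgn_eq_one_or (g : O2) : sgn g = 1 ∨ sgn g = -1 := by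
  rw [sgn_eq_sign]
  rcases det_eq_one_or g with h | h <;> rw [h]
  · left; simp
  · right; simp

lemma sgn_mul_self (g : O2) : sgn g * sgn g = 1 := by
  rcases sgn_eq_one_or g with h | h <;> rw [h] <;> norm_num

lemma sgn_of_mem {g : O2} (hg : g ∈ SO2) : sgn g = 1 := by
  rw [sgn_eq_sign, show det g = 1 from hg]
  simp

/-- The reflection of the plane in the first coordinate axis. -/
def refl : O2 :=
  ⟨!![1, 0; 0, -1], by
    rw [Matrix.mem_orthogonalGroup_iff]
    ext i j
    fin_cases i <;> fin_cases j <;> simp [Matrix.mul_apply, Fin.sum_univ_two]⟩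

lemma det_refl : det refl = -1 := by
  change Matrix.det !![(1 : ℝ), 0; 0, -1] = -1
  simp [Matrix.det_fin_two_of]

lemma sgn_refl : sgn refl = -1 := by
  rw [sgn_eq_sign, det_refl]
  simp

lemma refl_mul_self : refl * refl = 1 := by
  apply Subtype.ext
  change !![(1 : ℝ), 0; 0, -1] * !![(1 : ℝ), 0; 0, -1] = 1
  ext i j
  fin_cases i <;> fin_cases j <;> simp [Matrix.mul_apply, Fin.sum_univ_two]

lemma mem_or_refl_mul_mem (g : O2) : g ∈ SO2 ∨ refl * g ∈ SO2 := by
  rcases det_eq_one_or g with h | h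
  · exact Or.inl h
  · right
    change det (refl * g) = 1
    rw [map_mul, det_refl, h]
    norm_num

/-- The rotation of the plane by the angle `θ`. -/
def rot (θ : ℝ) : O2 :=
  ⟨!![Real.cos θ, -Real.sin θ; Real.sin θ, Real.cos θ], by
    rw [Matrix.mem_orthogonalGroup_iff]
    have := Real.sin_sq_add_cos_sq θ
    ext i j
    fin_cases i <;> fin_cases j <;> simp [Matrix.mul_apply, Fin.sum_univ_two] <;> nlinarith⟩

lemma rot_zero : rot 0 = 1 := by
  apply Subtype.ext
  change !![Real.cos 0, -Real.sin 0; Real.sin 0, Real.cos 0] = 1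
  ext i j
  fin_cases i <;> fin_cases j <;> simp

lemma rot_mem (θ : ℝ) : rot θ ∈ SO2 := by
  change Matrix.det !![Real.cos θ, -Real.sin θ; Real.sin θ, Real.cos θ] = 1
  rw [Matrix.det_fin_two_of]
  nlinarith [Real.sin_sq_add_cos_sq θ]

lemma continuous_rot : Continuous rot := by
  refine Continuous.subtype_mk (continuous_matrix fun i j => ?_) _
  fin_cases i <;> fin_cases j <;> simp <;> fun_prop

lemma exists_rot_eq {g : O2} (hg : g ∈ SO2) : ∃ θ, g = rot θ := by
  have h := (Matrix.mem_orthogonalGroup_iff (Fin 2) ℝ).1 g.2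
  have hd : Matrix.det g.1 = 1 := hg
  rw [Matrix.det_fin_two] at hd
  have h00 := congrFun (congrFun h 0) 0
  have h01 := congrFun (congrFun h 0) 1
  have h11 := congrFun (congrFun h 1) 1
  simp [Matrix.mul_apply, Fin.sum_univ_two] at h00 h01 h11
  -- The second column is the first one, rotated by a right angle.
  have e1 : g.1 1 1 = g.1 0 0 := by
    linear_combination (-g.1 1 1) * h00 + g.1 0 1 * h01 + g.1 0 0 * hd
  have e2 : g.1 0 1 = - g.1 1 0 := by
    linear_combination (-g.1 0 1) * hd + g.1 0 0 * h01 - g.1 1 0 * h00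
  have hn : g.1 0 0 ^ 2 + g.1 1 0 ^ 2 = 1 := by
    rw [e2] at h00; nlinarith
  have hz : ‖(⟨g.1 0 0, g.1 1 0⟩ : ℂ)‖ = 1 := by
    rw [Complex.norm_def, Complex.normSq_apply]
    simp only
    rw [← sq, ← sq, hn, Real.sqrt_one]
  have hz0 : (⟨g.1 0 0, g.1 1 0⟩ : ℂ) ≠ 0 := by
    intro h0
    rw [h0, norm_zero] at hz
    norm_num at hz
  refine ⟨Complex.arg ⟨g.1 0 0, g.1 1 0⟩, ?_⟩
  have hc := Complex.cos_arg hz0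
  have hs := Complex.sin_arg (⟨g.1 0 0, g.1 1 0⟩ : ℂ)
  rw [hz, div_one] at hc hs
  apply Subtype.ext
  ext i j
  fin_cases i <;> fin_cases j <;> simp [rot, hc, hs, e1, e2]

/-- A vertex of the standard simplex. -/
abbrev vtx (q : SimplexCategory) : Simplex q := stdSimplex.vertex (S := ℝ) (0 : Fin (q.len + 1))

lemma sgn_const {q : SimplexCategory} (g : Sing O2 q) (s t : Simplex q) : sgn (g s) = sgn (g t) := by
  suffices h : ∀ s t, det (g s) = 1 → det (g t) = -1 → False by
    rw [sgn_eq_sign, sgn_eq_sign]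
    rcases det_eq_one_or (g s) with hs | hs <;> rcases det_eq_one_or (g t) with ht | ht
    · rw [hs, ht]
    · exact (h s t hs ht).elim
    · exact (h t s ht hs).elim
    · rw [hs, ht]
  intro s t hs ht
  have : (0 : ℝ) ∈ Set.range fun t => det (g t) :=
    mem_range_of_exists_le_of_exists_ge (continuous_det.comp g.continuous)
      ⟨t, by rw [ht]; norm_num⟩ ⟨s, by rw [hs]; norm_num⟩
  obtain ⟨t, ht⟩ := this
  have := det_mul_self (g t)
  simp only at ht
  rw [ht] at this
  norm_num at this

/-- The straight path of rotations from the identity to `rot α`. -/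
def rotPath (α : ℝ) : Sing O2 ⦋1⦌ :=
  ⟨fun t => rot (α * t.1 1), continuous_rot.comp (continuous_const.mul
    ((continuous_apply _).comp continuous_subtype_val))⟩

lemma simplex_map_coe_zero {q : SimplexCategory} (θ : ⦋0⦌ ⟶ q) (t : Simplex ⦋0⦌) :
    Simplex.map θ t = stdSimplex.vertex (S := ℝ) (θ.toOrderHom 0) := by
  have : t = stdSimplex.vertex (S := ℝ) (0 : Fin 1) :=
    Subsingleton.elim (α := stdSimplex ℝ (Fin 1)) _ _
  rw [this]
  exact stdSimplex.map_vertex _ _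

lemma pull_to_zero {X : Type u} [TopologicalSpace X] {q : SimplexCategory} (θ : ⦋0⦌ ⟶ q)
    (x : Sing X q) : Sing.pull θ x =
      ContinuousMap.const _ (x (stdSimplex.vertex (S := ℝ) (θ.toOrderHom 0))) := by
  ext t
  exact congrArg x (simplex_map_coe_zero θ t)

lemma pull_rotPath_one (α : ℝ) :
    Sing.pull (SimplexCategory.δ (1 : Fin 2)) (rotPath α) = 1 := by
  rw [pull_to_zero]
  ext t : 1
  change rot (α * (Pi.single (0 : Fin 2) (1 : ℝ) : Fin 2 → ℝ) 1) = 1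
  simp [rot_zero]

lemma pull_rotPath_zero (α : ℝ) :
    Sing.pull (SimplexCategory.δ (0 : Fin 2)) (rotPath α) = ContinuousMap.const _ (rot α) := by
  rw [pull_to_zero]
  ext t : 1
  change rot (α * (Pi.single (1 : Fin 2) (1 : ℝ) : Fin 2 → ℝ) 1) = rot α
  simp

namespace SMod

/-- The homology class of a vertex. -/
def cls0 (X : SMod.{u}) : X.obj (op ⦋0⦌) →ₗ[ℚ] (Hn 0).obj X where
  toFun x := X.cls 0 ⟨x, by simp⟩
  map_add' x y := (X.cls 0).map_add ⟨x, by simp⟩ ⟨y, by simp⟩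
  map_smul' c x := (X.cls 0).map_smul c ⟨x, by simp⟩

lemma cls0_surjective (X : SMod.{u}) : Function.Surjective X.cls0 := by
  intro z
  obtain ⟨⟨x, hx⟩, rfl⟩ := X.cls_surjective 0 z
  exact ⟨x, rfl⟩

lemma bd_zero_apply (X : SMod.{u}) (y) : X.bd 0 y =
    X.pl (SimplexCategory.δ (0 : Fin 2)) y - X.pl (SimplexCategory.δ (1 : Fin 2)) y := by
  rw [bd, LinearMap.sum_apply, Fin.sum_univ_two]
  simp [sub_eq_add_neg]

lemma cls0_eq_zero_iff (X : SMod.{u}) (x) : X.cls0 x = 0 ↔ ∃ y, X.bd 0 y = x :=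
  X.cls_eq_zero_iff 0 ⟨x, by simp⟩

lemma cls0_pl_δ (X : SMod.{u}) (y) : X.cls0 (X.pl (SimplexCategory.δ (0 : Fin 2)) y) =
    X.cls0 (X.pl (SimplexCategory.δ (1 : Fin 2)) y) := by
  rw [← sub_eq_zero, ← map_sub, cls0_eq_zero_iff]
  exact ⟨y, X.bd_zero_apply y⟩

lemma hm_cls0 {X Y : SMod.{u}} (f : X ⟶ Y) (x) : hm 0 f (X.cls0 x) = Y.cls0 (ap f ⦋0⦌ x) :=
  hm_cls f 0 _

/-- All vertices of a simplex have the same class in `H_0`. -/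
lemma cls0_vertex (X : SMod.{u}) {n : ℕ} (x : X.obj (op ⦋n⦌)) (i j : Fin (n + 1)) :
    X.cls0 (X.pl (cst ⦋0⦌ ⦋n⦌ i) x) = X.cls0 (X.pl (cst ⦋0⦌ ⦋n⦌ j) x) := by
  wlog h : i ≤ j generalizing i j
  · exact (this j i (le_of_not_ge h)).symm
  have h0 : cst ⦋0⦌ ⦋n⦌ j = SimplexCategory.δ (0 : Fin 2) ≫ SimplexCategory.mkOfLe i j h := by
    ext k : 3
    obtain rfl : k = 0 := Subsingleton.elim (α := Fin 1) k 0
    rfl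
  have h1 : cst ⦋0⦌ ⦋n⦌ i = SimplexCategory.δ (1 : Fin 2) ≫ SimplexCategory.mkOfLe i j h := by
    ext k : 3
    obtain rfl : k = 0 := Subsingleton.elim (α := Fin 1) k 0
    rfl
  rw [h0, h1, pl_comp, pl_comp, cls0_pl_δ]

lemma hm_smul_of {X Y : SMod.{u}} {f f' : X ⟶ Y} {c : ℚ} (h : ∀ q x, ap f q x = c • ap f' q x)
    (n : ℕ) (x) : hm n f x = c • hm n f' x := by
  obtain ⟨x, rfl⟩ := X.cls_surjective n x
  rw [hm_cls, hm_cls, ← map_smul]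
  congr 1
  exact Subtype.ext (h _ _)

end SMod

namespace SimplicialRep

lemma act_mul (A : SimplicialRep.{u}) (g h : O2) : A.act (g * h) = A.act h ≫ A.act g := by
  apply SMod.hom_ext'
  intro q x
  change A.ρ q (ContinuousMap.const _ g * ContinuousMap.const _ h) x = _
  rw [map_mul]
  rfl

/-- The connected group `SO(2)` acts trivially on `H_0`. -/
lemma hm_act_zero_of_mem (A : SimplicialRep.{u}) {g : O2} (hg : g ∈ SO2) (x) :
    hm 0 (A.act g) x = x := by
  obtain ⟨α, rfl⟩ := exists_rot_eq hg
  obtain ⟨x, rfl⟩ := cls0_surjective A.obj x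
  have h := cls0_pl_δ A.obj (A.ρ ⦋1⦌ (rotPath α) (pl A.obj (SimplexCategory.σ (0 : Fin 1)) x))
  rw [pl_ρ, pl_ρ, pull_rotPath_zero, pull_rotPath_one, map_one, Module.End.one_apply,
    ← pl_comp, ← pl_comp] at h
  rw [hm_cls0]
  have hs : ∀ i : Fin 2, SimplexCategory.δ i ≫ SimplexCategory.σ (0 : Fin 1) = 𝟙 _ :=
    fun i => Subsingleton.elim _ _
  rw [hs, hs] at h
  rw [pl_id] at h
  exact h

lemma hm_act_zero (A : SimplicialRep.{u}) {k : ℕ} (h : Conc A.obj (A.act refl) 0 k) (g : O2) (x) :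
    hm 0 (A.act g) x = sgn g ^ k • x := by
  obtain ⟨z, hz0, hz, hr⟩ := h.gen
  obtain ⟨c, rfl⟩ := hz x
  rcases mem_or_refl_mul_mem g with hg | hg
  · rw [hm_act_zero_of_mem A hg, sgn_of_mem hg, one_pow, one_smul]
  · have h1 : g = refl * (refl * g) := by rw [← mul_assoc, refl_mul_self, one_mul]
    have h2 : sgn g = -1 := by
      rw [h1, sgn_mul, sgn_of_mem hg, sgn_refl]
      norm_num
    rw [h2, h1, act_mul, hm_comp, hm_act_zero_of_mem A hg, map_smul, hr, smul_comm]

/-! ### Constant simplicial representations -/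

/-- The constant simplicial vector space `ℚ`, with `Sing O(2)` acting through the `k`-th power of
the sign. -/
def constRep (k : ℕ) : SimplicialRep.{u} where
  obj := SMod.mk (fun _ => ULift.{u} ℚ) (fun _ => LinearMap.id) (fun _ _ => rfl)
    (fun _ _ _ => rfl)
  ρ q :=
    { toFun g := (sgn (g (vtx q)) ^ k) • LinearMap.id (R := ℚ) (M := ULift.{u} ℚ)
      map_one' := by
        change (sgn 1 ^ k) • LinearMap.id (R := ℚ) (M := ULift.{u} ℚ) = LinearMap.id
        rw [sgn_one, one_pow, one_smul]
      map_mul' g h := by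
        change (sgn (g (vtx q) * h (vtx q)) ^ k) • LinearMap.id (R := ℚ) (M := ULift.{u} ℚ) = _
        rw [sgn_mul, mul_pow, mul_smul]
        rfl }
  map_act {p q} θ g a := by
    change sgn (g (vtx q)) ^ k • a = sgn (g (Simplex.map θ (vtx p))) ^ k • a
    rw [sgn_const g]

lemma constRep_ρ (k : ℕ) {q : SimplexCategory} (g : Sing O2 q)
    (a : ULift.{u} ℚ) :
    @Eq (ULift.{u} ℚ) ((constRep k).ρ q g a) (sgn (g (vtx q)) ^ k • a) := rfl

lemma subsingleton_constRep (k n : ℕ) : Subsingleton ((Hn (n + 1)).obj (constRep.{u} k).obj) :=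
  subsingleton_of_discrete _ (fun _ _ => rfl) n

lemma constRep_cls0_injective (k : ℕ) : Function.Injective (cls0 (constRep.{u} k).obj) := by
  rw [injective_iff_map_eq_zero]
  intro x hx
  obtain ⟨y, rfl⟩ := (cls0_eq_zero_iff _ x).1 hx
  rw [bd_zero_apply]
  exact sub_self (G := ULift.{u} ℚ) y

/-- A simplicial representation whose homology is one-dimensional and concentrated in degree zero
maps to a constant one by a homology isomorphism. -/
lemma exists_hom_constRep (A : SimplicialRep.{u}) {k : ℕ} (h : Conc A.obj (A.act refl) 0 k) :
    ∃ f : RHom A (constRep.{u} k), ∀ n, Function.Bijective (hm n (borelHom f)) := by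
  obtain ⟨z, hz0, hz, hr⟩ := h.gen
  let e : ℚ ≃ₗ[ℚ] (Hn 0).obj A.obj := LinearEquiv.ofBijective
    (LinearMap.toSpanSingleton ℚ _ z)
    ⟨by
      rw [injective_iff_map_eq_zero]
      intro c hc
      exact (smul_eq_zero.1 hc).resolve_right hz0, fun y => (hz y).imp fun c hc => hc.symm⟩
  -- Send a simplex to the homology class of its zeroth vertex.
  let lam : (Hn 0).obj A.obj →ₗ[ℚ] ULift.{u} ℚ := (e.symm.trans ULift.moduleEquiv.symm).toLinearMap
  have hlam : Function.Bijective lam := (e.symm.trans ULift.moduleEquiv.symm).bijective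
  let φ : A.obj ⟶ (constRep.{u} k).obj := homMk
    (fun q => lam ∘ₗ cls0 A.obj ∘ₗ pl A.obj (cst ⦋0⦌ q 0)) (fun {p q} θ x => by
      change lam (cls0 A.obj (pl A.obj (cst ⦋0⦌ p 0) (pl A.obj θ x))) =
        lam (cls0 A.obj (pl A.obj (cst ⦋0⦌ q 0) x))
      rw [← pl_comp]
      exact congrArg lam (cls0_vertex A.obj (n := q.len) x (θ.toOrderHom 0) 0))
  have hφ : ∀ q x, ap φ q x = lam (cls0 A.obj (pl A.obj (cst ⦋0⦌ q 0) x)) := fun _ _ => rfl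
  let f : RHom A (constRep.{u} k) :=
    { f := φ
      equivariant := fun q g a => by
        rw [hφ, hφ, pl_ρ, pull_to_zero]
        refine Eq.trans ?_ (constRep_ρ k g _).symm
        have h1 := hm_act_zero A h (g (vtx q)) (cls0 A.obj (pl A.obj (cst ⦋0⦌ q 0) a))
        rw [hm_cls0] at h1
        rw [← map_smul, ← h1]
        rfl }
  have hsurj : ∀ q, Function.Surjective (ap f.f q) := by
    intro q c
    obtain ⟨y, hy⟩ := hlam.2 c
    obtain ⟨x, rfl⟩ := cls0_surjective A.obj y
    refine ⟨pl A.obj (cst q ⦋0⦌ 0) x, ?_⟩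
    rw [← hy]
    change lam (cls0 A.obj (pl A.obj (cst ⦋0⦌ q 0) (pl A.obj (cst q ⦋0⦌ 0) x))) = _
    rw [← pl_comp, Subsingleton.elim (cst ⦋0⦌ q 0 ≫ cst q ⦋0⦌ 0) (𝟙 _), pl_id]
  -- The kernel is acyclic, hence so is its Borel construction.
  have hses : Ses (kerι f).f f.f := SubMod.ses_ker f.f hsurj
  have hker : ∀ n, Subsingleton ((Hn n).obj (kerRep f).obj) := by
    intro n
    apply hses.subsingleton_left n
    · intro x
      have := subsingleton_constRep.{u} k n
      exact ⟨0, Subsingleton.elim _ _⟩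
    · cases n with
      | zero =>
        rw [injective_iff_map_eq_zero]
        intro x hx
        obtain ⟨x, rfl⟩ := cls0_surjective A.obj x
        rw [hm_cls0] at hx
        have h1 := constRep_cls0_injective k (hx.trans (map_zero _).symm)
        change lam (cls0 A.obj (pl A.obj (cst ⦋0⦌ ⦋0⦌ 0) x)) = 0 at h1
        rw [Subsingleton.elim (cst ⦋0⦌ ⦋0⦌ 0) (𝟙 _), pl_id] at h1
        exact hlam.1 (h1.trans (map_zero _).symm)
      | succ n =>
        have := h.vanish (n + 1) (by omega)
        exact Function.injective_of_subsingleton _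
  exact ⟨f, fun n => (borel_ses hses).bijective_hm_p (fun n => subsingleton_borel n _ hker) n⟩

lemma constRep_bmk_smul (k l : ℕ) {q : SimplexCategory} {s : Sing O2 q} (hs : s ∈ SingSO2 q)
    (e : EO2 q) (a : ULift.{u} ℚ) :
    (constRep.{u} l).bmk (fun i => s * e i) ((constRep.{u} k).ρ q s a) =
      (constRep.{u} l).bmk e a := by
  have h1 : ∀ (j : ℕ) (b : ULift.{u} ℚ), @Eq (ULift.{u} ℚ) ((constRep.{u} j).ρ q s b) b :=
    fun j b => by
      refine (constRep_ρ j s b).trans ?_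
      rw [sgn_of_mem (hs _), one_pow, one_smul]
  refine (congrArg (fun b : ULift.{u} ℚ => (constRep.{u} l).bmk _ b)
    ((h1 k a).trans (h1 l a).symm)).trans ?_
  exact (constRep.{u} l).bmk_smul hs e a

/-- The component in one degree of the identification `twist`. -/
def twistLin (k l : ℕ) (q : SimplexCategory) :
    (constRep.{u} k).borel.obj (op q) →ₗ[ℚ] (constRep.{u} l).borel.obj (op q) :=
  (constRep.{u} k).borelLift (fun e => (constRep.{u} l).bmkₗ e)
    (fun _ hs e a => constRep_bmk_smul k l hs e a)

lemma twistLin_bmk (k l : ℕ) {q : SimplexCategory} (e : EO2 q) (a : ULift.{u} ℚ) :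
    twistLin.{u} k l q ((constRep.{u} k).bmk e a) = (constRep.{u} l).bmk e a :=
  (constRep.{u} k).borelLift_bmk _ _ e a

/-- The Borel constructions of the constant representations agree as simplicial vector spaces,
because elements of `Sing SO(2)` have sign one. -/
def twist (k l : ℕ) : (constRep.{u} k).borel ⟶ (constRep.{u} l).borel :=
  homMk (twistLin k l) (fun {p q} θ x => by
    refine borel_induction (LinearMap.comp (twistLin k l p) (pl (constRep.{u} k).borel θ))
      (LinearMap.comp (pl (constRep.{u} l).borel θ) (twistLin k l q)) (fun e a => ?_) x
    rw [LinearMap.comp_apply, LinearMap.comp_apply, pl_bmk]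
    refine (twistLin_bmk k l _ _).trans ?_
    refine Eq.trans ?_ (congrArg (pl (constRep.{u} l).borel θ) (twistLin_bmk k l e a)).symm
    exact ((constRep.{u} l).pl_bmk θ e a).symm)

lemma twist_bmk (k l : ℕ) {q : SimplexCategory} (e : EO2 q) (a : ULift.{u} ℚ) :
    ap (twist.{u} k l) q ((constRep.{u} k).bmk e a) = (constRep.{u} l).bmk e a :=
  twistLin_bmk k l e a

lemma twist_twist (k l : ℕ) (q : SimplexCategory) (x : (constRep.{u} k).borel.obj (op q)) :
    ap (twist.{u} l k) q (ap (twist.{u} k l) q x) = x := by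
  refine borel_induction (ap (twist.{u} l k) q ∘ₗ ap (twist.{u} k l) q) LinearMap.id
    (fun e a => ?_) x
  rw [LinearMap.comp_apply]
  exact (congrArg (ap (twist.{u} l k) q) (twist_bmk k l e a)).trans (twist_bmk l k e a)

lemma hm_twist_act (k n : ℕ) (g : O2) (x) :
    hm n (twist.{u} k 0) (hm n ((constRep.{u} k).borelAct g) x) =
      sgn g ^ k • hm n ((constRep.{u} 0).borelAct g) (hm n (twist.{u} k 0) x) := by
  rw [← hm_comp, ← hm_comp]
  refine hm_smul_of (fun q x => ?_) n x
  refine borel_induction (ap ((constRep.{u} k).borelAct g ≫ twist.{u} k 0) q)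
    (sgn g ^ k • ap (twist.{u} k 0 ≫ (constRep.{u} 0).borelAct g) q) (fun e a => ?_) x
  rw [LinearMap.smul_apply, ap_comp, ap_comp]
  refine (congrArg (ap (twist.{u} k 0) q) (borelAct_bmk _ g e a)).trans ?_
  refine Eq.trans ?_ (congrArg (fun y => sgn g ^ k • ap ((constRep.{u} 0).borelAct g) q y)
    (twist_bmk k 0 e a).symm)
  refine Eq.trans ?_ (congrArg (fun y => sgn g ^ k • y)
    (borelAct_bmk (constRep.{u} 0) g e a).symm)
  refine (twist_bmk k 0 _ (sgn g ^ k • a)).trans ?_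
  refine Eq.trans ?_ (congrArg (fun b => sgn g ^ k • (constRep.{u} 0).bmk _ b)
    (show a = (constRep.{u} 0).ρ q (ContinuousMap.const _ g) a from ?_))
  · exact map_smul ((constRep.{u} 0).bmkₗ _) _ _
  · refine Eq.symm ((constRep_ρ 0 (ContinuousMap.const _ g) a).trans ?_)
    rw [pow_zero]
    exact one_smul ℚ (show ULift.{u} ℚ from a)

/-! ### Borel homology of simplicial representations with concentrated homology -/

/-- The Borel homology of `A` in degree `n` is isomorphic to that of `B` in degree `m` tensored
with the `k`-th power of the sign representation. -/
def Tw (k : ℕ) (A : SimplicialRep.{u}) (n : ℕ) (B : SimplicialRep.{u}) (m : ℕ) : Prop :=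
  ∃ e : (Hn n).obj A.borel ≃ₗ[ℚ] (Hn m).obj B.borel,
    ∀ g x, e (hm n (A.borelAct g) x) = sgn g ^ k • hm m (B.borelAct g) (e x)

lemma Tw.trans {k l : ℕ} {A B C : SimplicialRep.{u}} {n m p : ℕ} (h : Tw k A n B m)
    (h' : Tw l B m C p) : Tw (k + l) A n C p := by
  obtain ⟨e, he⟩ := h
  obtain ⟨e', he'⟩ := h'
  refine ⟨e.trans e', fun g x => ?_⟩
  rw [LinearEquiv.trans_apply, he, map_smul, he', smul_smul, pow_add]
  rfl

lemma Tw.symm {k : ℕ} {A B : SimplicialRep.{u}} {n m : ℕ} (h : Tw k A n B m) :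
    Tw k B m A n := by
  obtain ⟨e, he⟩ := h
  refine ⟨e.symm, fun g x => ?_⟩
  obtain ⟨x, rfl⟩ := e.surjective x
  rw [e.symm_apply_apply, LinearEquiv.symm_apply_eq, map_smul, he, smul_smul, ← mul_pow,
    sgn_mul_self, one_pow, one_smul]

lemma Tw.subsingleton {k : ℕ} {A B : SimplicialRep.{u}} {n m : ℕ} (h : Tw k A n B m)
    (hB : Subsingleton ((Hn m).obj B.borel)) : Subsingleton ((Hn n).obj A.borel) :=
  h.choose.toEquiv.subsingleton

lemma tw_constRep (A : SimplicialRep.{u}) {k : ℕ} (h : Conc A.obj (A.act refl) 0 k) (n : ℕ) :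
    Tw k A n (constRep.{u} 0) n := by
  obtain ⟨f, hf⟩ := A.exists_hom_constRep h
  have h1 : Tw 0 A n (constRep.{u} k) n := by
    refine ⟨LinearEquiv.ofBijective _ (hf n), fun g x => ?_⟩
    rw [pow_zero, one_smul, LinearEquiv.ofBijective_apply, LinearEquiv.ofBijective_apply,
      ← hm_comp, ← hm_comp]
    exact congrArg (fun φ => hm n φ x) (borelHom_act f g).symm
  have h2 : Tw k (constRep.{u} k) n (constRep.{u} 0) n :=
    ⟨LinearEquiv.ofBijective (hm n (twist.{u} k 0)) (hm_bijective_of_bijective _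
      (fun q => Function.bijective_iff_has_inverse.2
        ⟨ap (twist.{u} 0 k) q, twist_twist k 0 q, twist_twist 0 k q⟩) n),
      fun g x => hm_twist_act k n g x⟩
  have := h1.trans h2
  rwa [zero_add] at this

lemma conc_loop (A : SimplicialRep.{u}) {m k : ℕ} (h : Conc A.obj (A.act refl) (m + 1) k) :
    Conc A.loop.obj (A.loop.act refl) m k := by
  obtain ⟨e, he⟩ := A.exists_loop_homology_equiv m
  refine h.of_equiv (k' := 0) (fun n hn => ?_) e (fun x => ?_)
  · obtain ⟨e, -⟩ := A.exists_loop_homology_equiv n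
    have := h.vanish (n + 1) (by omega)
    exact e.symm.toEquiv.subsingleton
  · rw [he, pow_zero, one_smul]

/-- If the homology of `A` is one-dimensional and concentrated in degree `m`, then the Borel
homology of `A` vanishes below `m`. -/
lemma subsingleton_borel_of_lt {m : ℕ} : ∀ {A : SimplicialRep.{u}} {k : ℕ},
    Conc A.obj (A.act refl) m k → ∀ n < m, Subsingleton ((Hn n).obj A.borel) := by
  induction m with
  | zero => intro _ _ _ n hn; omega
  | succ m ih =>
    intro A k h n hn
    cases n with
    | zero => exact A.subsingleton_borel_zero (h.vanish 0 (by omega))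
    | succ n =>
      obtain ⟨e, -⟩ := A.exists_borel_loop_equiv (h.vanish 0 (by omega)) n
      have := ih (A.conc_loop h) n (by omega)
      exact e.toEquiv.subsingleton

/-- If the homology of `A` is one-dimensional and concentrated in degree `m`, then the Borel
homology of `A` is a twisted form of that of the trivial representation, shifted by `m`. -/
lemma tw_of_conc {m : ℕ} : ∀ {A : SimplicialRep.{u}} {k : ℕ},
    Conc A.obj (A.act refl) m k → ∀ n, Tw k A (n + m) (constRep.{u} 0) n := by
  induction m with
  | zero => exact fun {A k} h n => A.tw_constRep h n
  | succ m ih =>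
    intro A k h n
    obtain ⟨e, he⟩ := A.exists_borel_loop_equiv (h.vanish 0 (by omega)) (n + m)
    have h1 : Tw 0 A (n + m + 1) A.loop (n + m) :=
      ⟨e, fun g x => by rw [he, pow_zero, one_smul]⟩
    have := h1.trans (ih (A.conc_loop h) n)
    rwa [zero_add] at this

end SimplicialRep
end
end BorelO2

namespace BorelO2

noncomputable section

open Simplicial SMod

namespace SMod

/-! ### Consequences of the Dold–Kan correspondence -/

open AlgebraicTopology AlgebraicTopology.DoldKan in
lemma exists_hom_of_chainMap {X Y : SMod.{u}} (τ : cx X ⟶ cx Y) :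
    ∃ f : X ⟶ Y, PInfty ≫ (alternatingFaceMapComplex _).map f = PInfty ≫ τ ≫ PInfty := by
  have hfull : (N₁ : SMod.{u} ⥤ _).Full := by
    have : (N₂ : Idempotents.Karoubi SMod.{u} ⥤ _).IsEquivalence :=
      (Preadditive.DoldKan.equivalence (C := ModuleCat.{u} ℚ)).isEquivalence_functor
    exact Functor.Full.of_iso (toKaroubiCompN₂IsoN₁ (C := ModuleCat.{u} ℚ))
  let φ : N₁.obj X ⟶ N₁.obj Y :=
    { f := PInfty ≫ τ ≫ PInfty
      comm := by
        change PInfty ≫ (PInfty ≫ τ ≫ PInfty) ≫ PInfty = _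
        simp only [Category.assoc, PInfty_idem, PInfty_idem_assoc] }
  obtain ⟨f, hf⟩ := hfull.map_surjective φ
  exact ⟨f, congrArg Idempotents.Karoubi.Hom.f hf⟩

open AlgebraicTopology AlgebraicTopology.DoldKan in
lemma eq_of_PInfty_comp {X Y : SMod.{u}} {f g : X ⟶ Y}
    (h : PInfty ≫ (alternatingFaceMapComplex _).map f =
      PInfty ≫ (alternatingFaceMapComplex _).map g) : f = g := by
  have hff : (N₁ : SMod.{u} ⥤ _).Faithful := by
    have : (N₂ : Idempotents.Karoubi SMod.{u} ⥤ _).IsEquivalence :=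
      (Preadditive.DoldKan.equivalence (C := ModuleCat.{u} ℚ)).isEquivalence_functor
    exact Functor.Faithful.of_iso (toKaroubiCompN₂IsoN₁ (C := ModuleCat.{u} ℚ))
  apply hff.map_injective
  apply Idempotents.Karoubi.Hom.ext
  exact h

lemma homologyMap_cls {X Y : SMod.{u}} (F : cx X ⟶ cx Y) (n : ℕ) (x : X.cyc n) (y : Y.cyc n)
    (h : (F.f n).hom x.1 = y.1) :
    (HomologicalComplex.homologyMap F n).hom (X.cls n x) = Y.cls n y := by
  have h1 := congrArg (fun f => f.hom ((X.toCyc n).hom x))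
    (HomologicalComplex.homologyπ_naturality F n)
  have h2 : (HomologicalComplex.cyclesMap F n).hom ((X.toCyc n).hom x) = (Y.toCyc n).hom y := by
    apply Y.iCycles_injective n
    have h3 := congrArg (fun f => f.hom ((X.toCyc n).hom x))
      (HomologicalComplex.cyclesMap_i F n)
    refine h3.trans ((congrArg (F.f n).hom (X.iCycles_toCyc n x)).trans (h.trans ?_))
    exact (Y.iCycles_toCyc n y).symm
  exact h1.trans (congrArg ((cx Y).homologyπ n).hom h2)

/-- Every homology class of `Y` is the image of a given non-zero class of `X` under some map of
simplicial vector spaces. -/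
lemma exists_hom_of_class {X Y : SMod.{u}} {d : ℕ} (z : (Hn d).obj X) (hz : z ≠ 0)
    (w : (Hn d).obj Y) : ∃ f : X ⟶ Y, hm d f z = w := by
  obtain ⟨z, rfl⟩ := X.cls_surjective d z
  obtain ⟨w, rfl⟩ := Y.cls_surjective d w
  have hzr : z.1 ∉ LinearMap.range (X.bd d) := fun ⟨y, hy⟩ =>
    hz ((X.cls_eq_zero_iff d z).2 ⟨y, hy⟩)
  -- A functional on `d`-chains that is zero on boundaries but not on the cycle `z` gives a chain
  -- map concentrated in degree `d`, which the Dold–Kan correspondence realizes by a simplicial map.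
  obtain ⟨l, hl0, hl⟩ := Submodule.exists_le_ker_of_notMem hzr
  have hl' : ∀ y, l (X.bd d y) = 0 := fun y => hl ⟨y, rfl⟩
  let A : ModuleCat.{u} ℚ := (cx Y).X d
  let φ : (cx X).X d ⟶ A := ModuleCat.ofHom (((l z.1)⁻¹ • l).smulRight w.1)
  let τ : cx X ⟶ cx Y :=
    { f := fun n => if h : n = d then eqToHom (by rw [h]) ≫ φ ≫ eqToHom (by rw [h]) else 0
      comm' := by
        intro i j hij
        obtain rfl : j + 1 = i := hij
        by_cases h1 : j = d
        · subst h1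
          rw [dif_pos rfl, dif_neg (by omega), Limits.zero_comp]
          simp only [eqToHom_refl, Category.id_comp, Category.comp_id]
          apply ModuleCat.hom_ext
          apply LinearMap.ext
          intro y
          have h2 := congrArg (fun f => f y) (X.cx_d j)
          change 0 = ((l z.1)⁻¹ • l (((cx X).d (j + 1) j).hom y)) • w.1
          rw [show ((cx X).d (j + 1) j).hom y = X.bd j y from h2, hl', smul_zero, zero_smul]
        · rw [dif_neg h1, Limits.comp_zero]
          by_cases h2 : j + 1 = d
          · subst h2
            rw [dif_pos rfl]
            simp only [eqToHom_refl, Category.id_comp, Category.comp_id]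
            apply ModuleCat.hom_ext
            apply LinearMap.ext
            intro y
            have h3 := w.2
            rw [LinearMap.mem_ker, bd'_succ, ← Y.cx_d] at h3
            change ((cx Y).d (j + 1) j).hom (((l z.1)⁻¹ • l y) • w.1) = 0
            rw [map_smul]
            exact (congrArg _ h3).trans (smul_zero _)
          · rw [dif_neg h2, Limits.zero_comp] }
  obtain ⟨f, hf⟩ := exists_hom_of_chainMap τ
  refine ⟨f, ?_⟩
  -- The projection to normalized chains is the identity on homology.
  have hP : ∀ Z : SMod.{u}, HomologicalComplex.homologyMap
      (AlgebraicTopology.DoldKan.PInfty : cx Z ⟶ cx Z) d = 𝟙 _ := by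
    intro Z
    rw [(AlgebraicTopology.DoldKan.homotopyPInftyToId Z).homologyMap_eq,
      HomologicalComplex.homologyMap_id]
  have h1 := congrArg (fun g => HomologicalComplex.homologyMap g d) hf
  simp only [HomologicalComplex.homologyMap_comp] at h1
  rw [hP, hP] at h1
  have h3 := (Category.id_comp _).symm.trans
    (h1.trans ((Category.id_comp _).trans (Category.comp_id _)))
  refine (congrArg (fun g => g.hom (X.cls d z)) h3).trans (homologyMap_cls τ d z w ?_)
  have h2 : τ.f d = φ := by
    change (if h : d = d then eqToHom _ ≫ φ ≫ eqToHom _ else 0) = _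
    rw [dif_pos rfl]
    simp
  rw [h2]
  change ((l z.1)⁻¹ • l z.1) • w.1 = w.1
  rw [smul_eq_mul, inv_mul_cancel₀ hl0, one_smul]

lemma exists_generalized_inverse {V V' : Type*} [AddCommGroup V] [Module ℚ V] [AddCommGroup V']
    [Module ℚ V'] (d : V →ₗ[ℚ] V') : ∃ h : V' →ₗ[ℚ] V, ∀ x, d (h (d x)) = d x := by
  obtain ⟨s, hs⟩ := d.rangeRestrict.exists_rightInverse_of_surjective
    (LinearMap.range_eq_top.2 d.surjective_rangeRestrict)
  obtain ⟨h, hh⟩ := LinearMap.exists_extend s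
  refine ⟨h, fun x => ?_⟩
  have h1 : h (d x) = s ⟨d x, x, rfl⟩ := LinearMap.congr_fun hh ⟨d x, x, rfl⟩
  rw [h1]
  exact congrArg Subtype.val (LinearMap.congr_fun hs ⟨d x, x, rfl⟩)

/-- The projection of `X_n` onto cycles attached to generalized inverses of the boundary maps. -/
def cycProj (X : SMod.{u}) (h : ∀ n, X.obj (op ⦋n⦌) →ₗ[ℚ] X.obj (op ⦋n + 1⦌)) :
    ∀ n, X.obj (op ⦋n⦌) →ₗ[ℚ] X.obj (op ⦋n⦌) := fun n => match n with
  | 0 => LinearMap.id - X.bd 0 ∘ₗ h 0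
  | n + 1 => LinearMap.id - X.bd (n + 1) ∘ₗ h (n + 1) - h n ∘ₗ X.bd n

/-- Over a field, a map that vanishes on homology is null-homotopic. -/
lemma exists_nullHomotopy {X Y : SMod.{u}} (f : X ⟶ Y) (hf : ∀ n x, hm n f x = 0) :
    ∃ S : ∀ n, X.obj (op ⦋n⦌) →ₗ[ℚ] Y.obj (op ⦋n + 1⦌),
      (∀ x, ap f ⦋0⦌ x = Y.bd 0 (S 0 x)) ∧
      ∀ n x, ap f ⦋n + 1⦌ x = Y.bd (n + 1) (S (n + 1) x) + S n (X.bd n x) := by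
  -- With generalized inverses `h` and `k` of the boundary maps, `S = f h + k f c` works, where `c`
  -- is the projection onto cycles `1 - h ∂`.
  choose h hh using fun n => exists_generalized_inverse (X.bd n)
  choose k hk using fun n => exists_generalized_inverse (Y.bd n)
  have e1 : ∀ n x, X.bd' n (X.cycProj h n x) = 0 := by
    rintro (_ | n) x
    · simp
    · simp only [cycProj, bd'_succ, LinearMap.sub_apply, LinearMap.comp_apply, LinearMap.id_apply,
        map_sub]
      rw [bd_bd, hh]
      simp
  have e2 : ∀ n x, X.cycProj h n (X.bd n x) = 0 := by
    rintro (_ | n) x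
    · simp only [cycProj, LinearMap.sub_apply, LinearMap.comp_apply, LinearMap.id_apply]
      rw [hh, sub_self]
    · simp only [cycProj, LinearMap.sub_apply, LinearMap.comp_apply, LinearMap.id_apply]
      rw [hh, bd_bd, map_zero]
      simp
  have e3 : ∀ n x, Y.bd n (k n (ap f ⦋n⦌ (X.cycProj h n x))) = ap f ⦋n⦌ (X.cycProj h n x) := by
    intro n x
    have h1 := hf n (X.cls n ⟨_, e1 n x⟩)
    rw [hm_cls, cls_eq_zero_iff] at h1
    obtain ⟨y, hy⟩ := h1
    change _ = ap f ⦋n⦌ (X.cycProj h n x) at hy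
    rw [← hy, hk]
  refine ⟨fun n => ap f ⦋n + 1⦌ ∘ₗ h n + k n ∘ₗ ap f ⦋n⦌ ∘ₗ X.cycProj h n, fun x => ?_,
    fun n x => ?_⟩
  · simp only [LinearMap.add_apply, LinearMap.comp_apply, map_add]
    rw [e3, ← ap_bd, ← map_add]
    congr 1
    simp [cycProj]
  · simp only [LinearMap.add_apply, LinearMap.comp_apply, map_add]
    rw [e3, ← ap_bd, e2, map_zero, map_zero, add_zero, ← map_add, ← map_add]
    congr 1
    simp only [cycProj, LinearMap.sub_apply, LinearMap.comp_apply, LinearMap.id_apply]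
    abel

/-- The projection onto the normalized chains. -/
def nrm (Y : SMod.{u}) (n : ℕ) : Y.obj (op ⦋n⦌) →ₗ[ℚ] Y.obj (op ⦋n⦌) :=
  ((AlgebraicTopology.DoldKan.PInfty : cx Y ⟶ cx Y).f n).hom

lemma nrm_bd (Y : SMod.{u}) (n : ℕ) (y : Y.obj (op ⦋n + 1⦌)) :
    Y.nrm n (Y.bd n y) = Y.bd n (Y.nrm (n + 1) y) := by
  rw [← cx_d]
  exact congrArg (fun g => g.hom y)
    ((AlgebraicTopology.DoldKan.PInfty : cx Y ⟶ cx Y).comm (n + 1) n).symm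

lemma pl_δ_last_nrm (Y : SMod.{u}) (n : ℕ) (y : Y.obj (op ⦋n + 1⦌)) :
    Y.pl (SimplexCategory.δ (Fin.last (n + 1))) (Y.nrm (n + 1) y) = 0 := by
  have h := AlgebraicTopology.DoldKan.HigherFacesVanish.of_P (X := Y) (n + 1) n (Fin.last n)
    (by simp)
  exact congrArg (fun g => g.hom y) h

/-- A normalized simplex of positive dimension is the end point of a path, which contracts it
along `ctr`. -/
def normPath (Y : SMod.{u}) (n : ℕ) : Y.obj (op ⦋n + 1⦌) →ₗ[ℚ] Y.path.obj (op ⦋n + 1⦌) :=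
  show _ →ₗ[ℚ] Y.pathModule ⦋n + 1⦌ from
  { toFun y := ⟨fun p s τ => Y.pl (ctr s τ) (Y.nrm (n + 1) y), fun p p' t s τ => by
        rw [← pl_comp]; rfl, fun p s => by
        dsimp only
        rw [ctr_c0]
        have : cst p ⦋n + 1⦌ 0 = cst p ⦋n⦌ 0 ≫ SimplexCategory.δ (Fin.last (n + 1)) := by
          ext i : 3
          simp only [SimplexCategory.δ]
          exact (Fin.succAbove_last_apply (0 : Fin (n + 1))).symm
        rw [this, pl_comp, pl_δ_last_nrm, map_zero]⟩
    map_add' y y' := by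
      apply Subtype.ext
      funext p s τ
      change Y.pl _ (Y.nrm _ (y + y')) = Y.pl _ (Y.nrm _ y) + Y.pl _ (Y.nrm _ y')
      rw [map_add, map_add]
    map_smul' c y := by
      apply Subtype.ext
      funext p s τ
      change Y.pl _ (Y.nrm _ (c • y)) = c • Y.pl _ (Y.nrm _ y)
      rw [map_smul, map_smul] }

lemma pathEv_normPath (Y : SMod.{u}) (n : ℕ) (y : Y.obj (op ⦋n + 1⦌)) :
    ap Y.pathEv ⦋n + 1⦌ (Y.normPath n y) = Y.nrm (n + 1) y := by
  change Y.pl (ctr (𝟙 _) (c1 _)) (Y.nrm (n + 1) y) = _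
  rw [ctr_c1, pl_id]

/-- The components of the chain map that lifts a null-homotopic map to paths. -/
def liftPath {X Y : SMod.{u}} (S : ∀ n, X.obj (op ⦋n⦌) →ₗ[ℚ] Y.obj (op ⦋n + 1⦌)) :
    ∀ n, X.obj (op ⦋n⦌) →ₗ[ℚ] Y.path.obj (op ⦋n⦌) := fun n => match n with
  | 0 => Y.path.bd 0 ∘ₗ Y.normPath 0 ∘ₗ S 0
  | n + 1 => Y.path.bd (n + 1) ∘ₗ Y.normPath (n + 1) ∘ₗ S (n + 1) +
      Y.normPath n ∘ₗ S n ∘ₗ X.bd n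

lemma bd_liftPath {X Y : SMod.{u}} (S : ∀ n, X.obj (op ⦋n⦌) →ₗ[ℚ] Y.obj (op ⦋n + 1⦌)) (n : ℕ)
    (x : X.obj (op ⦋n + 1⦌)) :
    Y.path.bd n (liftPath S (n + 1) x) = liftPath S n (X.bd n x) := by
  cases n with
  | zero =>
    simp only [liftPath, LinearMap.add_apply, LinearMap.comp_apply, map_add]
    rw [bd_bd, zero_add]
  | succ n =>
    simp only [liftPath, LinearMap.add_apply, LinearMap.comp_apply, map_add]
    rw [bd_bd, bd_bd, zero_add, map_zero, map_zero, add_zero]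

/-- A map that vanishes on homology lifts to the path object. -/
lemma exists_lift_path {X Y : SMod.{u}} (f : X ⟶ Y) (hf : ∀ n x, hm n f x = 0) :
    ∃ g : X ⟶ Y.path, g ≫ Y.pathEv = f := by
  obtain ⟨S, h0, hS⟩ := exists_nullHomotopy f hf
  -- The null-homotopy gives a chain map to paths that lifts `f` up to the projection to normalized
  -- chains, which is enough because simplicial maps are determined on normalized chains.
  let σ : cx X ⟶ cx Y.path :=
    { f := fun n => ModuleCat.ofHom (liftPath S n)
      comm' := by
        intro i j hij
        obtain rfl : j + 1 = i := hij
        apply ModuleCat.hom_ext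
        apply LinearMap.ext
        intro x
        change ((cx Y.path).d (j + 1) j).hom (liftPath S (j + 1) x) =
          liftPath S j (((cx X).d (j + 1) j).hom x)
        rw [cx_d, cx_d]
        exact bd_liftPath S j x }
  obtain ⟨g, hg⟩ := exists_hom_of_chainMap σ
  refine ⟨g, eq_of_PInfty_comp ?_⟩
  have hσ : σ ≫ (AlgebraicTopology.alternatingFaceMapComplex _).map Y.pathEv =
      (AlgebraicTopology.alternatingFaceMapComplex _).map f ≫
        AlgebraicTopology.DoldKan.PInfty := by
    apply HomologicalComplex.hom_ext
    intro n
    apply ModuleCat.hom_ext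
    apply LinearMap.ext
    intro x
    change ap Y.pathEv ⦋n⦌ (liftPath S n x) = Y.nrm n (ap f ⦋n⦌ x)
    cases n with
    | zero =>
      simp only [liftPath, LinearMap.comp_apply]
      rw [ap_bd, pathEv_normPath, h0, nrm_bd]
    | succ n =>
      simp only [liftPath, LinearMap.add_apply, LinearMap.comp_apply, map_add]
      rw [ap_bd, pathEv_normPath, pathEv_normPath, hS, map_add, nrm_bd]
  rw [Functor.map_comp, reassoc_of% hg]
  have h1 : ∀ {Z Z' : SMod.{u}} (k : Z ⟶ Z'),
      AlgebraicTopology.DoldKan.PInfty ≫ (AlgebraicTopology.alternatingFaceMapComplex _).map k =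
        (AlgebraicTopology.alternatingFaceMapComplex _).map k ≫
          AlgebraicTopology.DoldKan.PInfty := by
    intro Z Z' k
    apply HomologicalComplex.hom_ext
    intro n
    exact (AlgebraicTopology.DoldKan.PInfty_f_naturality n k).symm
  rw [h1 Y.pathEv, reassoc_of% hσ, AlgebraicTopology.DoldKan.PInfty_idem, ← h1,
    AlgebraicTopology.DoldKan.PInfty_idem_assoc]

end SMod
end
end BorelO2

namespace BorelO2

noncomputable section

open Simplicial SMod

namespace SimplicialRep

/-! ### The homology of function objects -/

lemma hom_ext {A B : SimplicialRep.{u}} {q : SimplexCategory} {f g : (hom A B).obj.obj (op q)}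
    (h : ∀ p s a, f.1 p s a = g.1 p s a) : f = g := by
  apply Subtype.ext
  funext p s
  apply LinearMap.ext
  exact h p s

/-- Composition with an equivariant morphism. -/
def homPost (A : SimplicialRep.{u}) {B B' : SimplicialRep.{u}} (f : RHom B B') :
    (hom A B).obj ⟶ (hom A B').obj :=
  homMk (fun q => show homModule A B q →ₗ[ℚ] homModule A B' q from
    { toFun F := ⟨fun p s => ap f.f p ∘ₗ F.1 p s, fun p p' t s a => by
        refine (ap_pl f.f t _).symm.trans ?_
        exact congrArg _ (F.2 p p' t s a)⟩
      map_add' F G := Subtype.ext (by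
        funext p s
        exact LinearMap.comp_add _ _ _)
      map_smul' c F := Subtype.ext (by
        funext p s
        exact LinearMap.comp_smul _ _ _) })
    (fun _ _ => rfl)

lemma homPost_act (A : SimplicialRep.{u}) {B B' : SimplicialRep.{u}} (f : RHom B B') (g : O2) :
    homPost A f ≫ (hom A B').act g = (hom A B).act g ≫ homPost A f := by
  apply SMod.hom_ext'
  intro q F
  apply hom_ext
  intro p s a
  exact (f.equivariant p _ _).symm

/-- The contraction of maps into a path object. -/
def homPathHtpy (A B : SimplicialRep.{u}) :
    Htpy (0 : (hom A B.pathRep).obj ⟶ (hom A B.pathRep).obj) (𝟙 _) where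
  K q θ := show homModule A B.pathRep q →ₗ[ℚ] homModule A B.pathRep q from
    { toFun F := ⟨fun p s => pathContr B.obj p (s ≫ θ) ∘ₗ F.1 p s, fun p p' t s a => by
        refine (pl_pathContr B.obj t (s ≫ θ) _).trans ?_
        exact congrArg _ (F.2 p p' t s a)⟩
      map_add' F G := Subtype.ext (by
        funext p s
        exact LinearMap.comp_add _ _ _)
      map_smul' c F := Subtype.ext (by
        funext p s
        apply LinearMap.ext
        intro a
        exact map_smul (pathContr B.obj p (s ≫ θ)) c _) }
  nat η θ F := by
    apply hom_ext
    intro p s a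
    rfl
  zero q F := by
    apply hom_ext
    intro p s a
    exact pathContr_c0 B.obj p _
  one q F := by
    apply hom_ext
    intro p s a
    exact pathContr_c1 B.obj p _

/-- Contracting the parameter simplex shows that every map differs from a constant one by the end
point of a path. -/
lemma homPost_sub_cst_mem_range (A B : SimplicialRep.{u}) (q : SimplexCategory)
    (F : (hom A B).obj.obj (op q)) : F - pl (hom A B).obj (cst q q 0) F ∈
      LinearMap.range (ap (homPost A B.pathEvR) q) := by
  have hF : ∀ {p p' : SimplexCategory} (t : p' ⟶ p) (s : p ⟶ q) (a : A.obj.obj (op p)),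
      pl B.obj t (F.1 p s a) = F.1 p' (t ≫ s) (pl A.obj t a) := fun t s a => F.2 _ _ t s a
  -- Let the parameter move along the contraction `ctr` of the simplex to its zeroth vertex.
  let G : homModule A B.pathRep q := ⟨fun p s =>
    show A.obj.obj (op p) →ₗ[ℚ] pathModule B.obj p from
    { toFun a := ⟨fun p' s' τ => F.1 p' (ctr (s' ≫ s) τ) (pl A.obj s' a) -
          F.1 p' (cst p' q 0) (pl A.obj s' a), fun r r' t s' τ => by
          rw [map_sub, hF, hF, ← pl_comp]
          change F.1 r' (ctr (t ≫ s' ≫ s) (t ≫ τ)) _ - _ =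
            F.1 r' (ctr ((t ≫ s') ≫ s) (t ≫ τ)) _ - _
          rw [Category.assoc]
          rfl, fun r s' => by
          dsimp only
          rw [ctr_c0, sub_self]⟩
      map_add' a b := by
        apply Subtype.ext
        funext p' s' τ
        change F.1 p' _ (pl A.obj s' (a + b)) - F.1 p' _ (pl A.obj s' (a + b)) =
          (F.1 p' _ (pl A.obj s' a) - F.1 p' _ (pl A.obj s' a)) +
          (F.1 p' _ (pl A.obj s' b) - F.1 p' _ (pl A.obj s' b))
        simp only [map_add]
        abel
      map_smul' c a := by
        apply Subtype.ext
        funext p' s' τ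
        change F.1 p' _ (pl A.obj s' (c • a)) - F.1 p' _ (pl A.obj s' (c • a)) =
          c • (F.1 p' _ (pl A.obj s' a) - F.1 p' _ (pl A.obj s' a))
        simp only [map_smul, smul_sub] }, fun p p' t s a => by
      apply Subtype.ext
      funext r s' τ
      change F.1 r (ctr ((s' ≫ t) ≫ s) τ) (pl A.obj (s' ≫ t) a) -
          F.1 r (cst r q 0) (pl A.obj (s' ≫ t) a) =
        F.1 r (ctr (s' ≫ t ≫ s) τ) (pl A.obj s' (pl A.obj t a)) -
          F.1 r (cst r q 0) (pl A.obj s' (pl A.obj t a))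
      rw [pl_comp, Category.assoc]⟩
  refine ⟨G, hom_ext fun p s a => ?_⟩
  change F.1 p (ctr (𝟙 p ≫ s) (c1 p)) (pl A.obj (𝟙 p) a) -
    F.1 p (cst p q 0) (pl A.obj (𝟙 p) a) = F.1 p s a - F.1 p (s ≫ cst q q 0) a
  rw [ctr_c1, pl_id, Category.id_comp, comp_cst]

/-- Looping the target shifts the homology of the function object. -/
lemma exists_hom_loop_equiv (A B : SimplicialRep.{u}) (n : ℕ) :
    ∃ e : (Hn (n + 1)).obj (hom A B).obj ≃ₗ[ℚ] (Hn n).obj (hom A B.loop).obj,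
      ∀ g x, e (hm (n + 1) ((hom A B).act g) x) = hm n ((hom A B.loop).act g) (e x) := by
  obtain ⟨e, he⟩ := exists_loop_equiv (i := homPost A B.loopι) (p := homPost A B.pathEvR)
    (fun q F G h => hom_ext fun p s a => B.loop_inj p
      (LinearMap.congr_fun (congrFun (congrFun (congrArg Subtype.val h) p) s) a))
    (fun q F => by
      constructor
      · intro h
        have h1 : ∀ p s a, ap B.pathEvR.f p (F.1 p s a) = 0 := fun p s a =>
          LinearMap.congr_fun (congrFun (congrFun (congrArg Subtype.val h) p) s) a
        let G : homModule A B.loop q := ⟨fun p s => LinearMap.codRestrict _ (F.1 p s) (h1 p s),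
          fun p p' t s a => Subtype.ext (F.2 p p' t s a)⟩
        exact ⟨G, hom_ext fun p s a => rfl⟩
      · rintro ⟨G, rfl⟩
        exact hom_ext fun p s a => (B.loop_exact p).apply_apply_eq_zero _)
    (subsingleton_of_htpy (homPathHtpy A B)) (homPost_sub_cst_mem_range A B) n
  exact ⟨e, fun g => he _ _ _ (homPost_act A B.loopι g) (homPost_act A B.pathEvR g)⟩

/-- The simplicial map given by a vertex of the function object. -/
def toMap {A B : SimplicialRep.{u}} (F : (hom A B).obj.obj (op ⦋0⦌)) : A.obj ⟶ B.obj :=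
  homMk (fun q => F.1 q (cst q ⦋0⦌ 0)) (fun θ a => (F.2 _ _ θ (cst _ ⦋0⦌ 0) a).symm)

/-- A simplicial map as a vertex of the function object. -/
def ofMap {A B : SimplicialRep.{u}} (f : A.obj ⟶ B.obj) : (hom A B).obj.obj (op ⦋0⦌) :=
  show homModule A B ⦋0⦌ from ⟨fun p _ => ap f p, fun _ _ t _ a => (ap_pl f t a).symm⟩

lemma to_zero_eq_cst {p : SimplexCategory} (s : p ⟶ ⦋0⦌) : s = cst p ⦋0⦌ 0 := by
  ext i : 3
  exact Subsingleton.elim (α := Fin 1) _ _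

lemma toMap_act {A B : SimplicialRep.{u}} (g : O2) (F : (hom A B).obj.obj (op ⦋0⦌)) :
    toMap (ap ((hom A B).act g) ⦋0⦌ F) = A.act g⁻¹ ≫ toMap F ≫ B.act g := by
  apply SMod.hom_ext'
  intro q a
  rfl

/-- An edge of the function object is a homotopy. -/
def edgeHtpy {A B : SimplicialRep.{u}} (y : (hom A B).obj.obj (op ⦋1⦌)) :
    Htpy (toMap (pl (hom A B).obj (SimplexCategory.δ (1 : Fin 2)) y))
      (toMap (pl (hom A B).obj (SimplexCategory.δ (0 : Fin 2)) y)) where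
  K q θ := y.1 q θ
  nat η θ x := y.2 _ _ η θ x
  zero q x := by
    change y.1 q (c0 q) x = y.1 q (cst q ⦋0⦌ 0 ≫ SimplexCategory.δ (1 : Fin 2)) x
    congr 2
  one q x := by
    change y.1 q (c1 q) x = y.1 q (cst q ⦋0⦌ 0 ≫ SimplexCategory.δ (0 : Fin 2)) x
    congr 2

/-- Evaluation of vertices of the function object on a homology class. -/
def evalAt (A B : SimplicialRep.{u}) {d : ℕ} (z : (Hn d).obj A.obj) :
    (hom A B).obj.obj (op ⦋0⦌) →ₗ[ℚ] (Hn d).obj B.obj where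
  toFun F := hm d (toMap F) z
  map_add' F G := by
    obtain ⟨z, rfl⟩ := cls_surjective A.obj d z
    rw [hm_cls, hm_cls, hm_cls, ← map_add]
    congr 1
  map_smul' c F := by
    obtain ⟨z, rfl⟩ := cls_surjective A.obj d z
    rw [hm_cls, hm_cls, RingHom.id_apply, ← map_smul]
    congr 1

lemma evalAt_bd (A B : SimplicialRep.{u}) {d : ℕ} (z : (Hn d).obj A.obj) (y) :
    evalAt A B z (bd (hom A B).obj 0 y) = 0 := by
  rw [bd_zero_apply, map_sub, sub_eq_zero]
  exact congrArg (fun f => f z) ((edgeHtpy y).hm_eq d).symm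

/-- A map that vanishes on homology is a boundary in the function object, since it lifts to
paths. -/
lemma exists_bd_eq {A B : SimplicialRep.{u}} (F : (hom A B).obj.obj (op ⦋0⦌))
    (h : ∀ n x, hm n (toMap F) x = 0) : ∃ y, bd (hom A B).obj 0 y = F := by
  obtain ⟨g, hg⟩ := exists_lift_path (toMap F) h
  let G : ∀ q, A.obj.obj (op q) →ₗ[ℚ] pathModule B.obj q := fun q => ap g q
  have hG : ∀ {p q : SimplexCategory} (t : p ⟶ q) (a : A.obj.obj (op q)) (τ : p ⟶ ⦋1⦌),
      (G p (pl A.obj t a)).1 p (𝟙 p) τ = (G q a).1 p t τ := by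
    intro p q t a τ
    have h1 := ap_pl g t a
    have h2 := congrArg (fun w : pathModule B.obj p => w.1 p (𝟙 p) τ) h1
    refine h2.trans ?_
    change (G q a).1 p (𝟙 p ≫ t) τ = _
    rw [Category.id_comp]
  -- A map to paths is an edge from zero.
  let y : homModule A B ⦋1⦌ := ⟨fun p τ =>
    { toFun a := (G p a).1 p (𝟙 p) τ
      map_add' a b := congrArg (fun w : pathModule B.obj p => w.1 p (𝟙 p) τ) (map_add (G p) a b)
      map_smul' c a := congrArg (fun w : pathModule B.obj p => w.1 p (𝟙 p) τ)
        (map_smul (G p) c a) }, fun p p' t τ a => by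
      refine ((G p a).2.1 p p' t (𝟙 p) τ).trans ?_
      rw [Category.comp_id]
      exact (hG t a (t ≫ τ)).symm⟩
  refine ⟨y, (bd_zero_apply (hom A B).obj y).trans ?_⟩
  refine hom_ext fun p s a => ?_
  change (G p a).1 p (𝟙 p) (s ≫ SimplexCategory.δ (0 : Fin 2)) -
    (G p a).1 p (𝟙 p) (s ≫ SimplexCategory.δ (1 : Fin 2)) = _
  have h0 : s ≫ SimplexCategory.δ (0 : Fin 2) = c1 p := by
    rw [to_zero_eq_cst s]
    ext i : 3
    rfl
  have h1 : s ≫ SimplexCategory.δ (1 : Fin 2) = c0 p := by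
    rw [to_zero_eq_cst s]
    ext i : 3
    rfl
  rw [h0, h1, (G p a).2.2, sub_zero, to_zero_eq_cst s]
  exact congrArg (fun f => ap f p a) hg

/-- The degree zero homology of the function object. -/
lemma exists_hom_equiv_zero {A : SimplicialRep.{u}} {d k : ℕ}
    (h : Conc A.obj (A.act refl) d k) (B : SimplicialRep.{u}) :
    ∃ e : (Hn 0).obj (hom A B).obj ≃ₗ[ℚ] (Hn d).obj B.obj,
      ∀ x, e (hm 0 ((hom A B).act refl) x) = (-1 : ℚ) ^ k • hm d (B.act refl) (e x) := by
  obtain ⟨z, hz0, hz, hr⟩ := h.gen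
  -- Evaluation at the generator `z` has the boundaries as its kernel and is surjective.
  have hker : LinearMap.ker (cls0 (hom A B).obj) = LinearMap.ker (evalAt A B z) := by
    ext F
    rw [LinearMap.mem_ker, LinearMap.mem_ker, cls0_eq_zero_iff]
    constructor
    · rintro ⟨y, rfl⟩
      exact evalAt_bd A B z y
    · intro hF
      refine exists_bd_eq F fun n x => ?_
      by_cases hn : n = d
      · subst hn
        obtain ⟨c, rfl⟩ := hz x
        rw [map_smul]
        exact (congrArg (c • ·) hF).trans (smul_zero c)
      · have := h.vanish n hn
        rw [Subsingleton.elim x 0, map_zero]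
  have hsurj : Function.Surjective (evalAt A B z) := by
    intro w
    obtain ⟨f, hf⟩ := exists_hom_of_class z hz0 w
    exact ⟨ofMap f, hf⟩
  let e1 := (cls0 (hom A B).obj).quotKerEquivOfSurjective (cls0_surjective _)
  let e2 := (evalAt A B z).quotKerEquivOfSurjective hsurj
  let e := e1.symm.trans ((Submodule.quotEquivOfEq _ _ hker).trans e2)
  have he : ∀ F, e (cls0 _ F) = evalAt A B z F := by
    intro F
    have : e1.symm (cls0 _ F) = Submodule.Quotient.mk F := by
      rw [LinearEquiv.symm_apply_eq]
      rfl
    change e2 (Submodule.quotEquivOfEq _ _ hker (e1.symm (cls0 _ F))) = _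
    rw [this]
    rfl
  refine ⟨e, fun x => ?_⟩
  obtain ⟨F, rfl⟩ := cls0_surjective _ x
  rw [hm_cls0, he, he]
  change hm d (toMap (ap ((hom A B).act refl) ⦋0⦌ F)) z = _ • hm d _ (hm d (toMap F) z)
  rw [toMap_act, hm_comp, hm_comp, inv_eq_of_mul_eq_one_right refl_mul_self, hr, map_smul,
    map_smul]

/-- The homology of the function object out of an object with homology concentrated in one
degree. -/
lemma exists_hom_equiv {A : SimplicialRep.{u}} {d k : ℕ}
    (h : Conc A.obj (A.act refl) d k) (n : ℕ) : ∀ B : SimplicialRep.{u},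
    ∃ e : (Hn n).obj (hom A B).obj ≃ₗ[ℚ] (Hn (d + n)).obj B.obj,
      ∀ x, e (hm n ((hom A B).act refl) x) = (-1 : ℚ) ^ k • hm (d + n) (B.act refl) (e x) := by
  induction n with
  | zero => exact exists_hom_equiv_zero h
  | succ n ih =>
    intro B
    obtain ⟨e1, h1⟩ := exists_hom_loop_equiv A B n
    obtain ⟨e2, h2⟩ := ih B.loop
    obtain ⟨e3, h3⟩ := B.exists_loop_homology_equiv (d + n)
    refine ⟨e1.trans (e2.trans e3.symm), fun x => ?_⟩
    simp only [LinearEquiv.trans_apply]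
    rw [h1, h2, map_smul]
    congr 1
    refine (LinearEquiv.symm_apply_eq _).2 ((h3 _ _).trans ?_).symm
    rw [LinearEquiv.apply_symm_apply]

/-- A function object between objects with one-dimensional homology has one-dimensional homology:
the degrees subtract, and the exponents of the sign add. -/
lemma conc_hom {A B : SimplicialRep.{u}} {d k m l : ℕ} (hA : Conc A.obj (A.act refl) d k)
    (hB : Conc B.obj (B.act refl) (d + m) l) :
    Conc (hom A B).obj ((hom A B).act refl) m (l + k) := by
  obtain ⟨e, he⟩ := exists_hom_equiv hA m B
  refine hB.of_equiv (fun n hn => ?_) e.symm (fun x => ?_)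
  · obtain ⟨e, -⟩ := exists_hom_equiv hA n B
    have := hB.vanish (d + n) (by omega)
    exact e.toEquiv.subsingleton
  · obtain ⟨x, rfl⟩ := e.surjective x
    rw [LinearEquiv.symm_apply_apply, ← map_smul, LinearEquiv.eq_symm_apply, he]

end SimplicialRep
end
end BorelO2

namespace BorelO2

noncomputable section

open Simplicial SMod

/-! ### Subspaces and quotients of simplicial vector spaces -/

namespace SMod

/-- The map of quotients induced by a map that preserves simplicial subspaces. -/
def SubMod.mapQ {X Y : SMod.{u}} (S : X.SubMod) (T : Y.SubMod) (φ : X ⟶ Y)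
    (h : ∀ q x, x ∈ S.N q → ap φ q x ∈ T.N q) : S.quot ⟶ T.quot :=
  homMk (fun q => Submodule.mapQ _ _ (ap φ q) (h q)) (fun {p q} θ x => by
    obtain ⟨x, rfl⟩ := S.ses.surj q x
    exact congrArg (T.N p).mkQ (ap_pl φ θ x))

lemma SubMod.mapQ_π {X Y : SMod.{u}} (S : X.SubMod) (T : Y.SubMod) (φ : X ⟶ Y)
    (h : ∀ q x, x ∈ S.N q → ap φ q x ∈ T.N q) (q : SimplexCategory) (x : X.obj (op q)) :
    ap (S.mapQ T φ h) q (ap S.π q x) = ap T.π q (ap φ q x) := rfl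

lemma SubMod.π_eq_zero_iff {X : SMod.{u}} (S : X.SubMod) {q : SimplexCategory}
    {x : X.obj (op q)} : ap S.π q x = 0 ↔ x ∈ S.N q :=
  Submodule.Quotient.mk_eq_zero (S.N q)

lemma SubMod.quot_hom_ext {X Z : SMod.{u}} (S : X.SubMod) {f g : S.quot ⟶ Z}
    (h : ∀ q x, ap f q (ap S.π q x) = ap g q (ap S.π q x)) : f = g :=
  hom_ext' fun q y => by
    obtain ⟨x, rfl⟩ := S.ses.surj q y
    exact h q x

/-- A homotopy that preserves simplicial subspaces induces one on quotients. -/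
def Htpy.quot {X Y : SMod.{u}} {f g : X ⟶ Y} (H : Htpy f g) (S : X.SubMod) (T : Y.SubMod)
    (hK : ∀ q θ x, x ∈ S.N q → H.K q θ x ∈ T.N q) {f' g' : S.quot ⟶ T.quot}
    (hf : ∀ q x, ap f' q (ap S.π q x) = ap T.π q (ap f q x))
    (hg : ∀ q x, ap g' q (ap S.π q x) = ap T.π q (ap g q x)) : Htpy f' g' where
  K q θ := Submodule.mapQ _ _ (H.K q θ) (hK q θ)
  nat {p q} η θ x := by
    obtain ⟨x, rfl⟩ := S.ses.surj q x
    exact congrArg (T.N p).mkQ (H.nat η θ x)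
  zero q x := by
    obtain ⟨x, rfl⟩ := S.ses.surj q x
    rw [hf, ← H.zero]
    rfl
  one q x := by
    obtain ⟨x, rfl⟩ := S.ses.surj q x
    rw [hg, ← H.one]
    rfl

/-- The product of two simplicial vector spaces. -/
def prod (X Y : SMod.{u}) : SMod.{u} :=
  SMod.mk (fun q => X.obj (op q) × Y.obj (op q)) (fun θ => (X.pl θ).prodMap (Y.pl θ))
    (fun _ x => Prod.ext (X.pl_id x.1) (Y.pl_id x.2))
    (fun θ η x => Prod.ext (X.pl_comp θ η x.1) (Y.pl_comp θ η x.2))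

/-- Products of contractible simplicial vector spaces are contractible. -/
def Htpy.prod {X Y : SMod.{u}} (H : Htpy (0 : X ⟶ X) (𝟙 X)) (H' : Htpy (0 : Y ⟶ Y) (𝟙 Y)) :
    Htpy (0 : X.prod Y ⟶ X.prod Y) (𝟙 _) where
  K q θ := (H.K q θ).prodMap (H'.K q θ)
  nat η θ x := Prod.ext (H.nat η θ x.1) (H'.nat η θ x.2)
  zero q x := Prod.ext (H.zero q x.1) (H'.zero q x.2)
  one q x := Prod.ext (H.one q x.1) (H'.one q x.2)

/-- The map `X → Y × Y'` with given components. -/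
def prodLift {X Y Y' : SMod.{u}} (f : X ⟶ Y) (g : X ⟶ Y') : X ⟶ Y.prod Y' :=
  homMk (fun q => (ap f q).prod (ap g q)) (fun θ x => Prod.ext (ap_pl f θ x) (ap_pl g θ x))

/-- The difference of two maps, as a map on the product. -/
def prodSub {X Y Y' : SMod.{u}} (f : Y ⟶ X) (g : Y' ⟶ X) : Y.prod Y' ⟶ X :=
  homMk (fun q => (ap f q).comp (LinearMap.fst ℚ _ _) - (ap g q).comp (LinearMap.snd ℚ _ _))
    (fun {p q} θ x => by
      change ap f p (Y.pl θ x.1) - ap g p (Y'.pl θ x.2) = X.pl θ (ap f q x.1 - ap g q x.2)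
      rw [map_sub, ap_pl, ap_pl])

/-- The Mayer–Vietoris sequence `X/(S ∩ T) → X/S × X/T → X/(S + T)`. Here `S ∩ T` and `S + T` enter
as arbitrary simplicial subspaces with the right components. -/
lemma ses_mayerVietoris {X : SMod.{u}} {S T I J : X.SubMod} (hI : ∀ q, I.N q = S.N q ⊓ T.N q)
    (hJ : ∀ q, J.N q = S.N q ⊔ T.N q) :
    Ses (prodLift (I.mapQ S (𝟙 X) fun q _ h => ((hI q).le h).1)
        (I.mapQ T (𝟙 X) fun q _ h => ((hI q).le h).2))
      (prodSub (S.mapQ J (𝟙 X) fun q _ h => (hJ q).ge (Submodule.mem_sup_left h))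
        (T.mapQ J (𝟙 X) fun q _ h => (hJ q).ge (Submodule.mem_sup_right h))) where
  inj q := by
    rw [injective_iff_map_eq_zero]
    intro x hx
    obtain ⟨x, rfl⟩ := I.ses.surj q x
    have h1 : ap S.π q x = 0 := congrArg Prod.fst hx
    have h2 : ap T.π q x = 0 := congrArg Prod.snd hx
    rw [SubMod.π_eq_zero_iff] at *
    rw [hI]
    exact ⟨h1, h2⟩
  exact q := by
    rintro ⟨x, y⟩
    obtain ⟨x, rfl⟩ := S.ses.surj q x
    obtain ⟨y, rfl⟩ := T.ses.surj q y
    constructor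
    · intro h
      have h1 : ap J.π q (x - y) = 0 := by
        rw [map_sub]
        exact h
      rw [SubMod.π_eq_zero_iff, hJ] at h1
      obtain ⟨s, hs, t, ht, hst⟩ := Submodule.mem_sup.1 h1
      -- `x - y = s + t`, so that `x - s = y + t` represents both classes.
      refine ⟨ap I.π q (x - s), Prod.ext ?_ ?_⟩
      · change ap S.π q (x - s) = ap S.π q x
        rw [map_sub, S.π_eq_zero_iff.2 hs, sub_zero]
      · change ap T.π q (x - s) = ap T.π q y
        rw [← sub_eq_zero, ← map_sub, SubMod.π_eq_zero_iff]
        have : x - s - y = t := by rw [← add_sub_cancel_left s t, hst]; abel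
        rwa [this]
    · rintro ⟨z, hz⟩
      obtain ⟨z, rfl⟩ := I.ses.surj q z
      rw [← hz]
      exact sub_self (ap J.π q z)
  surj q z := by
    obtain ⟨z, rfl⟩ := J.ses.surj q z
    refine ⟨(ap S.π q z, 0), ?_⟩
    change ap J.π q z - ap J.π q 0 = _
    rw [map_zero, sub_zero]

/-- If every relative cycle of `(T, S)` is a relative boundary, then `X/S → X/T` is an isomorphism
on homology. -/
lemma bijective_hm_mapQ {X : SMod.{u}} {S T : X.SubMod} (hST : ∀ q, S.N q ≤ T.N q)
    (h : ∀ n x, x ∈ T.N ⦋n⦌ → X.bd' n x ∈ S.N ⦋n - 1⦌ →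
      ∃ y ∈ T.N ⦋n + 1⦌, x - X.bd n y ∈ S.N ⦋n⦌) (n : ℕ) :
    Function.Bijective (hm n (S.mapQ T (𝟙 X) fun q _ hx => hST q hx)) := by
  let f := S.mapQ T (𝟙 X) fun q _ hx => hST q hx
  have hses : Ses (SubMod.ker f).ι f := SubMod.ses_ker f fun q y => by
    obtain ⟨x, rfl⟩ := T.ses.surj q y
    exact ⟨ap S.π q x, rfl⟩
  -- It suffices that the kernel `T/S` is acyclic.
  refine hses.bijective_hm_p (fun n => ?_) n
  have : ∀ z : (Hn n).obj (SubMod.ker f).sub, z = 0 := by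
    intro z
    obtain ⟨⟨z, hz⟩, rfl⟩ := cls_surjective _ n z
    rw [cls_eq_zero_iff]
    obtain ⟨x, hx⟩ := S.ses.surj _ z.1
    have hxT : x ∈ T.N ⦋n⦌ := by
      rw [← SubMod.π_eq_zero_iff]
      have h1 : ap f _ z.1 = 0 := z.2
      rw [← hx] at h1
      exact h1
    have hxS : X.bd' n x ∈ S.N ⦋n - 1⦌ := by
      rw [← SubMod.π_eq_zero_iff, ap_bd', hx]
      have h1 := ap_bd' (SubMod.ker f).ι n z
      have hz' : (SubMod.ker f).sub.bd' n z = 0 := hz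
      rw [hz', map_zero] at h1
      exact h1.symm
    obtain ⟨y, hy, hyS⟩ := h n x hxT hxS
    have hyk : ap f _ (ap S.π _ y) = 0 := T.π_eq_zero_iff.2 hy
    let w : (SubMod.ker f).sub.obj (op ⦋n + 1⦌) := ⟨ap S.π _ y, hyk⟩
    refine ⟨w, ?_⟩
    apply (SubMod.ker f).ses.inj
    rw [ap_bd]
    change S.quot.bd n (ap S.π _ y) = z.1
    rw [← ap_bd, ← hx, eq_comm, ← sub_eq_zero, ← map_sub, SubMod.π_eq_zero_iff]
    exact hyS
  exact ⟨fun a b => (this a).trans (this b).symm⟩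

/-- If the identity is homotopic to a map whose values are degeneracies of vertices, then the
homology in positive degrees vanishes. -/
lemma subsingleton_of_htpy_discrete {X : SMod.{u}} {f : X ⟶ X} (H : Htpy f (𝟙 X))
    (hf : ∀ q x, X.pl (cst q q 0) (ap f q x) = ap f q x) (n : ℕ) :
    Subsingleton ((Hn (n + 1)).obj X) := by
  let R := SubMod.range f
  let f' : X ⟶ R.sub := homMk (fun q => (ap f q).rangeRestrict)
    (fun θ x => Subtype.ext (ap_pl f θ x))
  have hff : f' ≫ R.ι = f := rfl
  have hR : Subsingleton ((Hn (n + 1)).obj R.sub) := by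
    apply subsingleton_of_discrete
    rintro q ⟨_, y, rfl⟩
    exact Subtype.ext (hf q y)
  have : ∀ x : (Hn (n + 1)).obj X, x = 0 := by
    intro x
    rw [← hm_id X (n + 1) x, ← H.hm_eq, ← hff, hm_comp, Subsingleton.elim (hm (n + 1) f' x) 0,
      map_zero]
  exact ⟨fun a b => (this a).trans (this b).symm⟩

end SMod

/-! ### Chains on simplicial sets -/

/-- A simplicial set, in terms of its operators. -/
structure SimpSet where
  T : SimplexCategory → Type u
  pull : ∀ {p q : SimplexCategory}, (p ⟶ q) → T q → T p
  pull_id : ∀ {q : SimplexCategory} (x : T q), pull (𝟙 q) x = x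
  pull_comp : ∀ {p q r : SimplexCategory} (θ : p ⟶ q) (η : q ⟶ r) (x : T r),
    pull (θ ≫ η) x = pull θ (pull η x)

namespace SimpSet

/-- The rational chains on a simplicial set. -/
def chains (X : SimpSet.{u}) : SMod.{u} :=
  SMod.mk (fun q => X.T q →₀ ℚ) (fun θ => Finsupp.lmapDomain ℚ ℚ (X.pull θ))
    (fun q x => by
      refine LinearMap.congr_fun (f := Finsupp.lmapDomain ℚ ℚ (X.pull (𝟙 q)))
        (g := LinearMap.id) ?_ x
      ext y : 2
      simp [X.pull_id])
    (fun {p q r} θ η x => by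
      refine LinearMap.congr_fun (f := Finsupp.lmapDomain ℚ ℚ (X.pull (θ ≫ η)))
        (g := Finsupp.lmapDomain ℚ ℚ (X.pull θ) ∘ₗ Finsupp.lmapDomain ℚ ℚ (X.pull η)) ?_ x
      ext y : 2
      simp [X.pull_comp])

/-- A simplex as a chain. -/
def sg (X : SimpSet.{u}) {q : SimplexCategory} (x : X.T q) : X.chains.obj (op q) :=
  Finsupp.single x (1 : ℚ)

/-- The linear extension of a function on simplices. -/
def lift (X : SimpSet.{u}) {q : SimplexCategory} {M : Type v} [AddCommGroup M] [Module ℚ M]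
    (f : X.T q → M) : X.chains.obj (op q) →ₗ[ℚ] M :=
  show (X.T q →₀ ℚ) →ₗ[ℚ] M from Finsupp.lsum ℚ fun x => LinearMap.toSpanSingleton ℚ M (f x)

@[simp] lemma lift_sg (X : SimpSet.{u}) {q : SimplexCategory} {M : Type v} [AddCommGroup M]
    [Module ℚ M] (f : X.T q → M) (x : X.T q) : X.lift f (X.sg x) = f x := by
  change (Finsupp.lsum ℚ fun x => LinearMap.toSpanSingleton ℚ M (f x)) (Finsupp.single x 1) = _
  simp

lemma induction {X : SimpSet.{u}} {q : SimplexCategory} {M : Type v} [AddCommGroup M]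
    [Module ℚ M] (f g : X.chains.obj (op q) →ₗ[ℚ] M) (h : ∀ x, f (X.sg x) = g (X.sg x))
    (x : X.chains.obj (op q)) : f x = g x := by
  have : (show (X.T q →₀ ℚ) →ₗ[ℚ] M from f) = g := by
    apply Finsupp.lhom_ext'
    intro x
    apply LinearMap.ext_ring
    exact h x
  exact LinearMap.congr_fun this x

lemma pl_sg (X : SimpSet.{u}) {p q : SimplexCategory} (θ : p ⟶ q) (x : X.T q) :
    pl X.chains θ (X.sg x) = X.sg (X.pull θ x) :=
  Finsupp.mapDomain_single

/-- The map of chains induced by a map of simplicial sets. -/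
def map {X Y : SimpSet.{u}} (f : ∀ q, X.T q → Y.T q)
    (h : ∀ {p q : SimplexCategory} (θ : p ⟶ q) (x : X.T q), f p (X.pull θ x) = Y.pull θ (f q x)) :
    X.chains ⟶ Y.chains :=
  homMk (fun q => X.lift fun x => Y.sg (f q x)) (fun {p q} θ x => by
    refine induction ((X.lift fun x => Y.sg (f p x)) ∘ₗ pl X.chains θ)
      (pl Y.chains θ ∘ₗ (X.lift fun x => Y.sg (f q x))) (fun x => ?_) x
    rw [LinearMap.comp_apply, LinearMap.comp_apply, pl_sg, lift_sg, lift_sg, pl_sg, h])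

@[simp] lemma ap_map_sg {X Y : SimpSet.{u}} (f : ∀ q, X.T q → Y.T q)
    (h : ∀ {p q : SimplexCategory} (θ : p ⟶ q) (x : X.T q), f p (X.pull θ x) = Y.pull θ (f q x))
    (q : SimplexCategory) (x : X.T q) : ap (map f h) q (X.sg x) = Y.sg (f q x) :=
  X.lift_sg _ x

/-- A homotopy of maps of simplicial sets induces one of chains. -/
def htpy {X Y : SimpSet.{u}} (K : ∀ q, (q ⟶ ⦋1⦌) → X.T q → Y.T q)
    (hK : ∀ {p q : SimplexCategory} (η : p ⟶ q) (θ : q ⟶ ⦋1⦌) (x : X.T q),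
      Y.pull η (K q θ x) = K p (η ≫ θ) (X.pull η x))
    {f g : X.chains ⟶ Y.chains} (hf : ∀ q x, ap f q (X.sg x) = Y.sg (K q (c0 q) x))
    (hg : ∀ q x, ap g q (X.sg x) = Y.sg (K q (c1 q) x)) : Htpy f g where
  K q θ := X.lift fun x => Y.sg (K q θ x)
  nat {p q} η θ x := by
    refine induction (pl Y.chains η ∘ₗ (X.lift fun x => Y.sg (K q θ x)))
      ((X.lift fun x => Y.sg (K p (η ≫ θ) x)) ∘ₗ pl X.chains η) (fun x => ?_) x
    rw [LinearMap.comp_apply, LinearMap.comp_apply, pl_sg, lift_sg, lift_sg, pl_sg, hK]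
  zero q x := by
    refine induction _ _ (fun x => ?_) x
    rw [lift_sg, hf]
  one q x := by
    refine induction _ _ (fun x => ?_) x
    rw [lift_sg, hg]

/-- A simplicial subset. -/
structure Sub (X : SimpSet.{u}) where
  P : ∀ q, Set (X.T q)
  stable : ∀ {p q : SimplexCategory} (θ : p ⟶ q) (x : X.T q), x ∈ P q → X.pull θ x ∈ P p

/-- The chains that are supported on a simplicial subset. -/
def Sub.chains {X : SimpSet.{u}} (P : X.Sub) : X.chains.SubMod where
  N q := show Submodule ℚ (X.T q →₀ ℚ) from Finsupp.supported ℚ ℚ (P.P q)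
  stable {p q} θ x hx := by
    have h1 : (show X.T q →₀ ℚ from x) ∈ Submodule.span ℚ ((fun i => Finsupp.single i 1) '' P.P q) := by
      rw [← Finsupp.supported_eq_span_single]
      exact hx
    suffices h : Submodule.span ℚ ((fun i => Finsupp.single i (1 : ℚ)) '' P.P q) ≤
        (Finsupp.supported ℚ ℚ (P.P p)).comap (Finsupp.lmapDomain ℚ ℚ (X.pull θ)) from h h1
    rw [Submodule.span_le]
    rintro _ ⟨y, hy, rfl⟩
    simp only [SetLike.mem_coe, Submodule.mem_comap, Finsupp.lmapDomain_apply,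
      Finsupp.mapDomain_single]
    exact Finsupp.single_mem_supported ℚ _ (P.stable θ y hy)

lemma sg_mem {X : SimpSet.{u}} (P : X.Sub) {q : SimplexCategory} {x : X.T q} (hx : x ∈ P.P q) :
    X.sg x ∈ P.chains.N q := Finsupp.single_mem_supported ℚ _ hx

/-- To check that a linear map carries the chains on a simplicial subset into a subspace, it
suffices to consider simplices. -/
lemma mem_of_forall_sg {X : SimpSet.{u}} (P : X.Sub) {q : SimplexCategory} {M : Type v}
    [AddCommGroup M] [Module ℚ M] (f : X.chains.obj (op q) →ₗ[ℚ] M) (N : Submodule ℚ M)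
    (h : ∀ x ∈ P.P q, f (X.sg x) ∈ N) {x : X.chains.obj (op q)} (hx : x ∈ P.chains.N q) :
    f x ∈ N := by
  have h1 : (show X.T q →₀ ℚ from x) ∈ Submodule.span ℚ ((fun i => Finsupp.single i 1) '' P.P q) := by
    rw [← Finsupp.supported_eq_span_single]
    exact hx
  suffices h : Submodule.span ℚ ((fun i => Finsupp.single i (1 : ℚ)) '' P.P q) ≤
      N.comap (show (X.T q →₀ ℚ) →ₗ[ℚ] M from f) from h h1
  rw [Submodule.span_le]
  rintro _ ⟨y, hy, rfl⟩
  exact h y hy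

/-- The reduced chains relative to a simplicial subset. -/
abbrev Sub.rel {X : SimpSet.{u}} (P : X.Sub) : SMod.{u} := P.chains.quot

/-- The map of relative chains induced by a map of simplicial sets. -/
def relMap {X Y : SimpSet.{u}} (P : X.Sub) (Q : Y.Sub) (f : ∀ q, X.T q → Y.T q)
    (h : ∀ {p q : SimplexCategory} (θ : p ⟶ q) (x : X.T q), f p (X.pull θ x) = Y.pull θ (f q x))
    (hf : ∀ q x, x ∈ P.P q → f q x ∈ Q.P q) : P.rel ⟶ Q.rel :=
  P.chains.mapQ Q.chains (map f h) (fun q _ hx => mem_of_forall_sg P _ _ (fun x hx => by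
    rw [ap_map_sg]
    exact sg_mem Q (hf q x hx)) hx)

lemma relMap_sg {X Y : SimpSet.{u}} (P : X.Sub) (Q : Y.Sub) (f : ∀ q, X.T q → Y.T q)
    (h : ∀ {p q : SimplexCategory} (θ : p ⟶ q) (x : X.T q), f p (X.pull θ x) = Y.pull θ (f q x))
    (hf : ∀ q x, x ∈ P.P q → f q x ∈ Q.P q) (q : SimplexCategory) (x : X.T q) :
    ap (relMap P Q f h hf) q (ap P.chains.π q (X.sg x)) = ap Q.chains.π q (Y.sg (f q x)) := by
  rw [relMap, SubMod.mapQ_π, ap_map_sg]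

lemma rel_hom_ext {X : SimpSet.{u}} {P : X.Sub} {Z : SMod.{u}} {f g : P.rel ⟶ Z}
    (h : ∀ q x, ap f q (ap P.chains.π q (X.sg x)) = ap g q (ap P.chains.π q (X.sg x))) : f = g :=
  P.chains.quot_hom_ext fun q x =>
    induction (ap f q ∘ₗ ap P.chains.π q) (ap g q ∘ₗ ap P.chains.π q) (h q) x

/-- A homotopy of maps of simplicial sets that preserves simplicial subsets induces a homotopy of
relative chains. -/
def relHtpy {X Y : SimpSet.{u}} {P : X.Sub} {Q : Y.Sub} (K : ∀ q, (q ⟶ ⦋1⦌) → X.T q → Y.T q)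
    (hK : ∀ {p q : SimplexCategory} (η : p ⟶ q) (θ : q ⟶ ⦋1⦌) (x : X.T q),
      Y.pull η (K q θ x) = K p (η ≫ θ) (X.pull η x))
    (hP : ∀ q θ x, x ∈ P.P q → K q θ x ∈ Q.P q) {f g : P.rel ⟶ Q.rel}
    (hf : ∀ q x, ap f q (ap P.chains.π q (X.sg x)) = ap Q.chains.π q (Y.sg (K q (c0 q) x)))
    (hg : ∀ q x, ap g q (ap P.chains.π q (X.sg x)) = ap Q.chains.π q (Y.sg (K q (c1 q) x))) :
    Htpy f g :=
  have hc : ∀ {p q : SimplexCategory} (η : p ⟶ q) (i : Fin 2) (x : X.T q),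
      K p (cst p ⦋1⦌ i) (X.pull η x) = Y.pull η (K q (cst q ⦋1⦌ i) x) := fun {_ q} η i x =>
    (hK η (cst q ⦋1⦌ i) x).symm
  Htpy.quot (htpy K hK (f := map (fun q => K q (c0 q)) fun η x => hc η 0 x)
      (g := map (fun q => K q (c1 q)) fun η x => hc η 1 x)
      (fun q x => ap_map_sg _ _ q x) (fun q x => ap_map_sg _ _ q x)) P.chains Q.chains
    (fun q θ x hx => mem_of_forall_sg P _ _ (fun x hx => by
      change X.lift _ (X.sg x) ∈ _
      rw [lift_sg]
      exact sg_mem Q (hP q θ x hx)) hx)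
    (fun q x => induction (ap f q ∘ₗ ap P.chains.π q)
      (ap Q.chains.π q ∘ₗ ap (map (fun q => K q (c0 q)) fun η x => hc η 0 x) q) (fun x => by
        rw [LinearMap.comp_apply, LinearMap.comp_apply, ap_map_sg]
        exact hf q x) x)
    (fun q x => induction (ap g q ∘ₗ ap P.chains.π q)
      (ap Q.chains.π q ∘ₗ ap (map (fun q => K q (c1 q)) fun η x => hc η 1 x) q) (fun x => by
        rw [LinearMap.comp_apply, LinearMap.comp_apply, ap_map_sg]
        exact hg q x) x)

/-- The exact sequence of an injective map `j : Z → X` of simplicial sets, relative to `Q`. The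
simplicial subspace `J` is the sum of the chains on `Q` and on the image of `j`. -/
lemma ses_of_injective {Z X : SimpSet.{u}} (j : ∀ q, Z.T q → X.T q)
    (h : ∀ {p q : SimplexCategory} (θ : p ⟶ q) (x : Z.T q), j p (Z.pull θ x) = X.pull θ (j q x))
    (hj : ∀ q, Function.Injective (j q)) (P : Z.Sub) (Q : X.Sub)
    (hPQ : ∀ q x, x ∈ P.P q ↔ j q x ∈ Q.P q) (J : X.chains.SubMod) (R : X.Sub)
    (hR : ∀ q, R.P q = Set.range (j q)) (hJ : ∀ q, J.N q = Q.chains.N q ⊔ R.chains.N q) :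
    Ses (relMap P Q j h fun q x hx => (hPQ q x).1 hx)
      (Q.chains.mapQ J (𝟙 _) fun q _ hx => (hJ q).ge (Submodule.mem_sup_left hx)) where
  inj q := by
    rw [injective_iff_map_eq_zero]
    intro z hz
    obtain ⟨z, rfl⟩ := P.chains.ses.surj q z
    rw [relMap, SubMod.mapQ_π, SubMod.π_eq_zero_iff] at hz
    rw [SubMod.π_eq_zero_iff]
    have h1 : ap (map j h) q z = Finsupp.mapDomain (j q) (show Z.T q →₀ ℚ from z) :=
      induction (ap (map j h) q) (show Z.chains.obj (op q) →ₗ[ℚ] X.chains.obj (op q) from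
        Finsupp.lmapDomain ℚ ℚ (j q)) (fun x => (ap_map_sg j h q x).trans
          (Finsupp.mapDomain_single (f := j q) (a := x) (b := (1 : ℚ))).symm) z
    classical
    have h2 : Finsupp.mapDomain (j q) (show Z.T q →₀ ℚ from z) ∈
        Finsupp.supported ℚ ℚ (Q.P q) := h1 ▸ hz
    change (show Z.T q →₀ ℚ from z) ∈ Finsupp.supported ℚ ℚ (P.P q)
    rw [Finsupp.mem_supported] at h2 ⊢
    rw [Finsupp.mapDomain_support_of_injective (hj q)] at h2
    intro x hx
    exact (hPQ q x).2 (h2 (Finset.mem_coe.2 (Finset.mem_image_of_mem _ hx)))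
  exact q := by
    intro y
    obtain ⟨y, rfl⟩ := Q.chains.ses.surj q y
    rw [SubMod.mapQ_π]
    change ap J.π q y = 0 ↔ _
    rw [SubMod.π_eq_zero_iff, hJ]
    constructor
    · intro hy
      obtain ⟨s, hs, t, ht, rfl⟩ := Submodule.mem_sup.1 hy
      have h1 : t ∈ LinearMap.range (ap (map j h) q) := by
        refine mem_of_forall_sg R LinearMap.id _ (fun x hx => ?_) ht
        rw [hR] at hx
        obtain ⟨x, rfl⟩ := hx
        exact ⟨Z.sg x, ap_map_sg j h q x⟩
      obtain ⟨z, rfl⟩ := h1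
      refine ⟨ap P.chains.π q z, ?_⟩
      rw [relMap, SubMod.mapQ_π, map_add, Q.chains.π_eq_zero_iff.2 hs, zero_add]
    · rintro ⟨z, hz⟩
      obtain ⟨z, rfl⟩ := P.chains.ses.surj q z
      rw [relMap, SubMod.mapQ_π, ← sub_eq_zero, ← map_sub, SubMod.π_eq_zero_iff] at hz
      have h1 : ap (map j h) q z ∈ R.chains.N q := by
        let E : Z.Sub := ⟨fun _ => Set.univ, fun _ _ _ => trivial⟩
        refine mem_of_forall_sg E (ap (map j h) q) _ (fun x _ => ?_)
          ((Finsupp.mem_supported ℚ _).2 (Set.subset_univ _))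
        rw [ap_map_sg]
        exact sg_mem R (by rw [hR]; exact ⟨x, rfl⟩)
      rw [← sub_sub_cancel (ap (map j h) q z) y]
      exact sub_mem (Submodule.mem_sup_right h1) (Submodule.mem_sup_left hz)
  surj q z := by
    obtain ⟨z, rfl⟩ := J.ses.surj q z
    exact ⟨ap Q.chains.π q z, rfl⟩

/-! ### Singular simplices -/

/-- The singular simplicial set of a topological space. -/
abbrev sing (X : Type u) [TopologicalSpace X] : SimpSet.{u} where
  T q := Sing X q
  pull θ := Sing.pull θ
  pull_id := BorelO2.pull_id
  pull_comp := BorelO2.pull_comp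

/-- The simplices with image in a given set. -/
def within {X : Type u} [TopologicalSpace X] (U : Set X) : (sing X).Sub where
  P q := Set.ofPred fun σ : Sing X q => ∀ t, σ t ∈ U
  stable _ _ hx _ := hx _

end SimpSet
end
end BorelO2

namespace BorelO2

noncomputable section

open Simplicial SMod SimpSet

/-! ### Affine simplices -/

/-- The affine combination of the points `v i` with the coefficients `s`. -/
def aff {p r : SimplexCategory} (v : Fin (p.len + 1) → Simplex r) (s : Simplex p) : Simplex r :=
  ⟨∑ i, s.1 i • (v i).1, (convex_stdSimplex ℝ _).sum_mem (fun i _ => s.2.1 i) s.2.2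
    (fun i _ => (v i).2)⟩

lemma aff_coe {p r : SimplexCategory} (v : Fin (p.len + 1) → Simplex r) (s : Simplex p)
    (k : Fin (r.len + 1)) : (aff v s).1 k = ∑ i, s.1 i * (v i).1 k := by
  simp [aff, Finset.sum_apply]

lemma continuous_aff {p r : SimplexCategory} (v : Fin (p.len + 1) → Simplex r) :
    Continuous (aff v) := by
  refine Continuous.subtype_mk (continuous_finsetSum _ fun i _ => ?_) _
  exact ((continuous_apply i).comp continuous_subtype_val).smul continuous_const

lemma aff_aff {p r t : SimplexCategory} (u : Fin (r.len + 1) → Simplex t)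
    (v : Fin (p.len + 1) → Simplex r) (s : Simplex p) :
    aff u (aff v s) = aff (fun i => aff u (v i)) s := by
  apply Subtype.ext
  funext k
  simp only [aff_coe, Finset.sum_mul, Finset.mul_sum]
  rw [Finset.sum_comm]
  simp only [mul_assoc]

/-- The vertices of the simplex `r`. -/
def verts (r : SimplexCategory) (i : Fin (r.len + 1)) : Simplex r :=
  stdSimplex.vertex (S := ℝ) i

lemma aff_vertex {p r : SimplexCategory} (v : Fin (p.len + 1) → Simplex r)
    (i : Fin (p.len + 1)) : aff v (verts p i) = v i := by
  apply Subtype.ext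
  funext k
  rw [aff_coe, Finset.sum_eq_single i]
  · simp [verts]
  · intro j _ hj
    simp [verts, hj]
  · simp

lemma aff_verts {r : SimplexCategory} (s : Simplex r) : aff (verts r) s = s := by
  apply Subtype.ext
  funext k
  rw [aff_coe, Finset.sum_eq_single k]
  · simp [verts]
  · intro j _ hj
    simp [verts, hj.symm]
  · simp

lemma simplexMap_eq_aff {p q : SimplexCategory} (θ : p ⟶ q) (s : Simplex p) :
    Simplex.map θ s = aff (fun i => verts q (θ.toOrderHom i)) s := by
  apply Subtype.ext
  funext k
  rw [aff_coe]
  change (stdSimplex.map θ.toOrderHom s).1 k = _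
  change FunOnFinite.linearMap ℝ ℝ θ.toOrderHom s.1 k = _
  rw [FunOnFinite.linearMap_apply_apply]
  simp only [verts]
  rw [Finset.sum_filter]
  apply Finset.sum_congr rfl
  intro i _
  by_cases h : θ.toOrderHom i = k
  · simp [h]
  · rw [if_neg h]
    simp [Ne.symm h]

lemma aff_map {p q r : SimplexCategory} (v : Fin (q.len + 1) → Simplex r) (θ : p ⟶ q)
    (s : Simplex p) : aff v (Simplex.map θ s) = aff (fun i => v (θ.toOrderHom i)) s := by
  rw [simplexMap_eq_aff, aff_aff]
  simp only [aff_vertex]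

/-- The barycenter of a tuple of points. -/
def bary {p r : SimplexCategory} (v : Fin (p.len + 1) → Simplex r) : Simplex r :=
  aff v stdSimplex.barycenter

lemma aff_bary {p r t : SimplexCategory} (u : Fin (r.len + 1) → Simplex t)
    (v : Fin (p.len + 1) → Simplex r) : aff u (bary v) = bary fun i => aff u (v i) :=
  aff_aff u v _

/-- Tuples of points of the simplex `r`, considered as affine simplices in it. -/
abbrev tup (r : SimplexCategory) : SimpSet.{0} where
  T p := Fin (p.len + 1) → Simplex r
  pull θ v i := v (θ.toOrderHom i)
  pull_id _ := rfl
  pull_comp _ _ _ := rfl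

/-- The chains on affine simplices. -/
abbrev AffChains (r : SimplexCategory) (n : ℕ) := (tup r).chains.obj (op ⦋n⦌)

namespace SimpSet

lemma forall_mem {X : SimpSet.{u}} {q : SimplexCategory} {M : Type v} [AddCommGroup M] [Module ℚ M]
    (f : X.chains.obj (op q) →ₗ[ℚ] M) (N : Submodule ℚ M) (h : ∀ x, f (X.sg x) ∈ N)
    (x : X.chains.obj (op q)) : f x ∈ N := by
  rw [← Submodule.Quotient.mk_eq_zero]
  refine induction (N.mkQ ∘ₗ f) 0 (fun x => ?_) x
  exact (Submodule.Quotient.mk_eq_zero N).2 (h x)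

lemma bd_sg (X : SimpSet.{u}) (n : ℕ) (x : X.T ⦋n + 1⦌) : X.chains.bd n (X.sg x) =
    ∑ i : Fin (n + 2), (-1 : ℚ) ^ (i : ℕ) • X.sg (X.pull (SimplexCategory.δ i) x) := by
  rw [bd, LinearMap.sum_apply]
  apply Finset.sum_congr rfl
  intro i _
  rw [LinearMap.smul_apply, pl_sg]

end SimpSet

/-- The image of affine chains under a singular simplex. -/
def pushSing {X : Type u} [TopologicalSpace X] {r : SimplexCategory} (σ : Sing X r)
    (q : SimplexCategory) : (tup r).chains.obj (op q) →ₗ[ℚ] (sing X).chains.obj (op q) :=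
  (tup r).lift fun v => (sing X).sg (q := q) (σ.comp ⟨aff v, continuous_aff v⟩)

lemma pushSing_sg {X : Type u} [TopologicalSpace X] {r q : SimplexCategory} (σ : Sing X r)
    (v : (tup r).T q) : pushSing σ q ((tup r).sg v) =
      (sing X).sg (q := q) (σ.comp ⟨aff v, continuous_aff v⟩) := lift_sg _ _ _

lemma pushSing_pl {X : Type u} [TopologicalSpace X] {r p q : SimplexCategory} (σ : Sing X r)
    (θ : p ⟶ q) (x : (tup r).chains.obj (op q)) :
    pushSing σ p (pl (tup r).chains θ x) = pl (sing X).chains θ (pushSing σ q x) := by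
  refine induction (pushSing σ p ∘ₗ pl (tup r).chains θ) (pl (sing X).chains θ ∘ₗ pushSing σ q)
    (fun v => ?_) x
  rw [LinearMap.comp_apply, LinearMap.comp_apply, pl_sg, pushSing_sg, pushSing_sg, pl_sg]
  congr 1
  ext s
  exact congrArg σ (aff_map v θ s).symm

lemma pushSing_bd {X : Type u} [TopologicalSpace X] {r : SimplexCategory} (σ : Sing X r) (n : ℕ)
    (x : AffChains r (n + 1)) :
    pushSing σ ⦋n⦌ (bd (tup r).chains n x) = bd (sing X).chains n (pushSing σ ⦋n + 1⦌ x) := by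
  simp only [bd, LinearMap.sum_apply, map_sum, LinearMap.smul_apply, map_smul, pushSing_pl]

lemma pushSing_verts {X : Type u} [TopologicalSpace X] {r : SimplexCategory} (σ : Sing X r) :
    pushSing σ r ((tup r).sg (q := r) (verts r)) = (sing X).sg (q := r) σ := by
  rw [pushSing_sg]
  congr 1
  ext s
  exact congrArg σ (aff_verts s)

/-- The map of affine chains induced by an affine map. -/
def pushAff {r t : SimplexCategory} (u : Fin (r.len + 1) → Simplex t) :
    (tup r).chains ⟶ (tup t).chains :=
  SimpSet.map (fun _ v i => aff u (v i)) (fun _ _ => rfl)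

lemma pushAff_sg {r t : SimplexCategory} (u : Fin (r.len + 1) → Simplex t) (q : SimplexCategory)
    (v : (tup r).T q) :
    ap (pushAff u) q ((tup r).sg v) = (tup t).sg (q := q) fun i => aff u (v i) :=
  ap_map_sg (X := tup r) (Y := tup t) (fun _ v i => aff u (v i)) (fun _ _ => rfl) q v

lemma pushAff_verts {r t : SimplexCategory} (u : Fin (r.len + 1) → Simplex t) :
    ap (pushAff u) r ((tup r).sg (q := r) (verts r)) = (tup t).sg (q := r) u := by
  rw [pushAff_sg]
  simp only [aff_vertex]

lemma pushSing_comp_aff {X : Type u} [TopologicalSpace X] {r t : SimplexCategory} (σ : Sing X t)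
    (u : Fin (r.len + 1) → Simplex t) (q : SimplexCategory) (x : (tup r).chains.obj (op q)) :
    pushSing (r := r) (σ.comp ⟨aff u, continuous_aff u⟩) q x =
      pushSing σ q (ap (pushAff u) q x) := by
  refine induction (pushSing (r := r) (σ.comp ⟨aff u, continuous_aff u⟩) q)
    (pushSing σ q ∘ₗ ap (pushAff u) q) (fun v => ?_) x
  rw [LinearMap.comp_apply, pushAff_sg, pushSing_sg, pushSing_sg]
  congr 1
  ext s
  exact congrArg σ (aff_aff u v s)

/-! ### Barycentric subdivision -/

/-- The join of a point with an affine simplex. -/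
def tupCons {r : SimplexCategory} {n : ℕ} (b : Simplex r) (v : (tup r).T ⦋n⦌) :
    (tup r).T ⦋n + 1⦌ := Fin.cons (α := fun _ => Simplex r) b (show Fin (n + 1) → Simplex r from v)

lemma pull_zero_tupCons {r : SimplexCategory} {n : ℕ} (b : Simplex r) (v : (tup r).T ⦋n⦌) :
    (tup r).pull (SimplexCategory.δ (0 : Fin (n + 2))) (tupCons b v) = v := rfl

lemma pull_succ_tupCons {r : SimplexCategory} {n : ℕ} (b : Simplex r) (v : (tup r).T ⦋n + 1⦌)
    (i : Fin (n + 2)) : (tup r).pull (SimplexCategory.δ i.succ) (tupCons b v) =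
      tupCons b ((tup r).pull (SimplexCategory.δ i) v) := by
  funext j
  change Fin.cons (α := fun _ => Simplex r) b v (Fin.succAbove i.succ j) = _
  refine Fin.cases ?_ (fun j => ?_) j
  · rw [Fin.succ_succAbove_zero]
    rfl
  · rw [Fin.succ_succAbove_succ]
    rfl

/-- The cone on affine chains. -/
def cone {r : SimplexCategory} (b : Simplex r) (n : ℕ) : AffChains r n →ₗ[ℚ] AffChains r (n + 1) :=
  (tup r).lift fun v => (tup r).sg (tupCons b v)

lemma cone_sg {r : SimplexCategory} (b : Simplex r) (n : ℕ) (v : (tup r).T ⦋n⦌) :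
    cone b n ((tup r).sg v) = (tup r).sg (tupCons b v) := lift_sg _ _ _

lemma bd_cone {r : SimplexCategory} (b : Simplex r) (n : ℕ) (x : AffChains r (n + 1)) :
    bd (tup r).chains (n + 1) (cone b (n + 1) x) = x - cone b n (bd (tup r).chains n x) := by
  refine induction (bd (tup r).chains (n + 1) ∘ₗ cone b (n + 1))
    (LinearMap.id - cone b n ∘ₗ bd (tup r).chains n) (fun v => ?_) x
  rw [LinearMap.sub_apply, LinearMap.comp_apply, LinearMap.comp_apply, LinearMap.id_apply,
    cone_sg, bd_sg, bd_sg, map_sum, Fin.sum_univ_succ, sub_eq_add_neg, ← Finset.sum_neg_distrib]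
  congr 1
  · rw [Fin.val_zero, pow_zero, one_smul, pull_zero_tupCons]
  · apply Finset.sum_congr rfl
    intro i _
    rw [map_smul, Fin.val_succ, pow_succ, mul_neg_one, neg_smul, pull_succ_tupCons, cone_sg]

/-- The homotopy from barycentric subdivision to the identity on affine chains. -/
def sdHtpy (r : SimplexCategory) (n : ℕ) : AffChains r n →ₗ[ℚ] AffChains r (n + 1) :=
  match n with
  | 0 => 0
  | n + 1 => (tup r).lift fun v => cone (bary (p := ⦋n + 1⦌) v) (n + 1)
      ((tup r).sg v - sdHtpy r n (bd (tup r).chains n ((tup r).sg v)))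

/-- Barycentric subdivision of affine chains. -/
def sd (r : SimplexCategory) (n : ℕ) : AffChains r n →ₗ[ℚ] AffChains r n :=
  match n with
  | 0 => LinearMap.id
  | n + 1 => (tup r).lift fun v => cone (bary (p := ⦋n + 1⦌) v) n
      (sd r n (bd (tup r).chains n ((tup r).sg v)))

lemma sdHtpy_sg (r : SimplexCategory) (n : ℕ) (v : (tup r).T ⦋n + 1⦌) :
    sdHtpy r (n + 1) ((tup r).sg v) = cone (bary (p := ⦋n + 1⦌) v) (n + 1)
      ((tup r).sg v - sdHtpy r n (bd (tup r).chains n ((tup r).sg v))) := lift_sg _ _ _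

lemma sd_sg (r : SimplexCategory) (n : ℕ) (v : (tup r).T ⦋n + 1⦌) :
    sd r (n + 1) ((tup r).sg v) = cone (bary (p := ⦋n + 1⦌) v) n
      (sd r n (bd (tup r).chains n ((tup r).sg v))) := lift_sg _ _ _

lemma bd_sdHtpy (r : SimplexCategory) (n : ℕ) (x : AffChains r (n + 1)) :
    bd (tup r).chains (n + 1) (sdHtpy r (n + 1) x) + sdHtpy r n (bd (tup r).chains n x) =
      x - sd r (n + 1) x := by
  -- The homotopy `T` on `v` is the cone on `v - T ∂v`, whose boundary is the subdivision of `∂v` by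
  -- the identity in the previous degree.
  have step : ∀ n, (∀ x : AffChains r (n + 1), bd (tup r).chains n (sdHtpy r n
      (bd (tup r).chains n x)) = bd (tup r).chains n x - sd r n (bd (tup r).chains n x)) →
      ∀ x : AffChains r (n + 1), bd (tup r).chains (n + 1) (sdHtpy r (n + 1) x) +
        sdHtpy r n (bd (tup r).chains n x) = x - sd r (n + 1) x := by
    intro n h x
    refine induction (bd (tup r).chains (n + 1) ∘ₗ sdHtpy r (n + 1) +
      sdHtpy r n ∘ₗ bd (tup r).chains n) (LinearMap.id - sd r (n + 1)) (fun v => ?_) x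
    rw [LinearMap.sub_apply, LinearMap.add_apply, LinearMap.comp_apply, LinearMap.comp_apply,
      LinearMap.id_apply, sdHtpy_sg, sd_sg, bd_cone, map_sub (bd (tup r).chains n), h,
      sub_sub_cancel]
    abel
  have main : ∀ n, ∀ x : AffChains r (n + 1), bd (tup r).chains n (sdHtpy r n
      (bd (tup r).chains n x)) = bd (tup r).chains n x - sd r n (bd (tup r).chains n x) := by
    intro n
    induction n with
    | zero =>
      intro x
      simp [sdHtpy, sd]
    | succ n ih =>
      intro x
      have h1 := step n ih (bd (tup r).chains (n + 1) x)
      rwa [bd_bd, map_zero, add_zero] at h1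
  exact step n (main n) x

lemma pushAff_cone {r t : SimplexCategory} (u : Fin (r.len + 1) → Simplex t) (b : Simplex r)
    (n : ℕ) (x : AffChains r n) :
    ap (pushAff u) ⦋n + 1⦌ (cone b n x) = cone (aff u b) n (ap (pushAff u) ⦋n⦌ x) := by
  refine induction (ap (pushAff u) ⦋n + 1⦌ ∘ₗ cone b n) (cone (aff u b) n ∘ₗ ap (pushAff u) ⦋n⦌)
    (fun v => ?_) x
  rw [LinearMap.comp_apply, LinearMap.comp_apply, pushAff_sg, cone_sg, cone_sg, pushAff_sg]
  congr 1
  funext i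
  refine Fin.cases ?_ (fun i => ?_) i <;> rfl

lemma pushAff_sdHtpy {r t : SimplexCategory} (u : Fin (r.len + 1) → Simplex t) (n : ℕ) :
    ∀ x : AffChains r n,
      ap (pushAff u) ⦋n + 1⦌ (sdHtpy r n x) = sdHtpy t n (ap (pushAff u) ⦋n⦌ x) := by
  induction n with
  | zero => intro x; simp [sdHtpy]
  | succ n ih =>
    intro x
    refine induction (ap (pushAff u) ⦋n + 1 + 1⦌ ∘ₗ sdHtpy r (n + 1))
      (sdHtpy t (n + 1) ∘ₗ ap (pushAff u) ⦋n + 1⦌) (fun v => ?_) x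
    rw [LinearMap.comp_apply, LinearMap.comp_apply, sdHtpy_sg, pushAff_cone, map_sub, ih, ap_bd,
      pushAff_sg, sdHtpy_sg, aff_bary]

lemma pushAff_sd {r t : SimplexCategory} (u : Fin (r.len + 1) → Simplex t) (n : ℕ) :
    ∀ x : AffChains r n, ap (pushAff u) ⦋n⦌ (sd r n x) = sd t n (ap (pushAff u) ⦋n⦌ x) := by
  induction n with
  | zero => intro x; simp [sd]
  | succ n ih =>
    intro x
    refine induction (ap (pushAff u) ⦋n + 1⦌ ∘ₗ sd r (n + 1))
      (sd t (n + 1) ∘ₗ ap (pushAff u) ⦋n + 1⦌) (fun v => ?_) x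
    rw [LinearMap.comp_apply, LinearMap.comp_apply, sd_sg, pushAff_cone, ih, ap_bd,
      pushAff_sg, sd_sg, aff_bary]

section singular

variable (X : Type u) [TopologicalSpace X]

/-- The homotopy from barycentric subdivision to the identity on singular chains. -/
def singSdHtpy (n : ℕ) :
    (sing X).chains.obj (op ⦋n⦌) →ₗ[ℚ] (sing X).chains.obj (op ⦋n + 1⦌) :=
  (sing X).lift fun σ => pushSing σ ⦋n + 1⦌ (sdHtpy ⦋n⦌ n ((tup ⦋n⦌).sg (q := ⦋n⦌) (verts ⦋n⦌)))

/-- Barycentric subdivision of singular chains. -/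
def singSd (n : ℕ) : (sing X).chains.obj (op ⦋n⦌) →ₗ[ℚ] (sing X).chains.obj (op ⦋n⦌) :=
  (sing X).lift fun σ => pushSing σ ⦋n⦌ (sd ⦋n⦌ n ((tup ⦋n⦌).sg (q := ⦋n⦌) (verts ⦋n⦌)))

variable {X}

lemma singSdHtpy_pushSing {r : SimplexCategory} (σ : Sing X r) (n : ℕ) (x : AffChains r n) :
    singSdHtpy X n (pushSing σ ⦋n⦌ x) = pushSing σ ⦋n + 1⦌ (sdHtpy r n x) := by
  refine induction (singSdHtpy X n ∘ₗ pushSing σ ⦋n⦌) (pushSing σ ⦋n + 1⦌ ∘ₗ sdHtpy r n)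
    (fun v => ?_) x
  rw [LinearMap.comp_apply, LinearMap.comp_apply, pushSing_sg, singSdHtpy, lift_sg,
    pushSing_comp_aff, pushAff_sdHtpy, pushAff_verts]

lemma singSd_pushSing {r : SimplexCategory} (σ : Sing X r) (n : ℕ) (x : AffChains r n) :
    singSd X n (pushSing σ ⦋n⦌ x) = pushSing σ ⦋n⦌ (sd r n x) := by
  refine induction (singSd X n ∘ₗ pushSing σ ⦋n⦌) (pushSing σ ⦋n⦌ ∘ₗ sd r n) (fun v => ?_) x
  rw [LinearMap.comp_apply, LinearMap.comp_apply, pushSing_sg, singSd, lift_sg,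
    pushSing_comp_aff, pushAff_sd, pushAff_verts]

lemma singSd_pow_pushSing {r : SimplexCategory} (σ : Sing X r) (n k : ℕ) (x : AffChains r n) :
    (singSd X n ^ k) (pushSing σ ⦋n⦌ x) = pushSing σ ⦋n⦌ ((sd r n ^ k) x) := by
  induction k with
  | zero => simp
  | succ k ih =>
    rw [pow_succ', pow_succ', Module.End.mul_apply, Module.End.mul_apply, ih, singSd_pushSing]

lemma singSd_zero (x : (sing X).chains.obj (op ⦋0⦌)) : singSd X 0 x = x := by
  refine induction (singSd X 0) LinearMap.id (fun σ => ?_) x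
  rw [← pushSing_verts, singSd_pushSing]
  rfl

lemma bd_singSdHtpy (n : ℕ) (x : (sing X).chains.obj (op ⦋n + 1⦌)) :
    bd (sing X).chains (n + 1) (singSdHtpy X (n + 1) x) +
      singSdHtpy X n (bd (sing X).chains n x) = x - singSd X (n + 1) x := by
  refine induction (bd (sing X).chains (n + 1) ∘ₗ singSdHtpy X (n + 1) +
    singSdHtpy X n ∘ₗ bd (sing X).chains n) (LinearMap.id - singSd X (n + 1)) (fun σ => ?_) x
  rw [LinearMap.sub_apply, LinearMap.add_apply, LinearMap.comp_apply, LinearMap.comp_apply,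
    LinearMap.id_apply, ← pushSing_verts, singSdHtpy_pushSing, singSd_pushSing, ← pushSing_bd,
    ← pushSing_bd, singSdHtpy_pushSing, ← map_add, ← map_sub, bd_sdHtpy]

lemma singSd_bd (n : ℕ) (x : (sing X).chains.obj (op ⦋n + 1⦌)) :
    singSd X n (bd (sing X).chains n x) = bd (sing X).chains n (singSd X (n + 1) x) := by
  have h2 := congrArg (bd (sing X).chains n) (bd_singSdHtpy n x)
  rw [map_add, bd_bd, zero_add, map_sub] at h2
  cases n with
  | zero =>
    rw [singSd_zero]
    have h3 : singSdHtpy X 0 (bd (sing X).chains 0 x) = 0 := by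
      refine induction (singSdHtpy X 0) 0 (fun σ => ?_) _
      rw [← pushSing_verts, singSdHtpy_pushSing]
      exact map_zero _
    rw [h3, map_zero] at h2
    exact sub_eq_zero.1 h2.symm
  | succ n =>
    have h1 := bd_singSdHtpy n (bd (sing X).chains (n + 1) x)
    rw [bd_bd, map_zero, add_zero, h2] at h1
    exact (sub_right_injective h1).symm

lemma pushSing_mem {U : Set X} {r : SimplexCategory} {σ : Sing X r} (hσ : σ ∈ (within U).P r)
    (q : SimplexCategory) (x) : pushSing σ q x ∈ (within U).chains.N q :=
  forall_mem _ _ (fun v => by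
    rw [pushSing_sg]
    exact sg_mem _ fun t => hσ _) x

end singular

end
end BorelO2

namespace BorelO2

noncomputable section

open Simplicial SMod SimpSet

/-! ### Excision -/

/-- The affine chains spanned by a set of affine simplices. -/
def affSpan {r : SimplexCategory} {n : ℕ} (A : Set ((tup r).T ⦋n⦌)) :
    Submodule ℚ (AffChains r n) := Submodule.span ℚ ((tup r).sg '' A)

lemma sg_mem_affSpan {r : SimplexCategory} {n : ℕ} {A : Set ((tup r).T ⦋n⦌)}
    {v : (tup r).T ⦋n⦌} (hv : v ∈ A) : (tup r).sg v ∈ affSpan A :=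
  Submodule.subset_span ⟨v, hv, rfl⟩

lemma map_mem_of_mem_affSpan {r : SimplexCategory} {n : ℕ} {A : Set ((tup r).T ⦋n⦌)}
    {M : Type v} [AddCommGroup M] [Module ℚ M] (f : AffChains r n →ₗ[ℚ] M) (N : Submodule ℚ M)
    (h : ∀ v ∈ A, f ((tup r).sg v) ∈ N) {x : AffChains r n} (hx : x ∈ affSpan A) : f x ∈ N := by
  suffices h' : affSpan A ≤ N.comap f from h' hx
  rw [affSpan, Submodule.span_le]
  rintro _ ⟨v, hv, rfl⟩
  exact h v hv

lemma dist_aff_le {p r : SimplexCategory} {v : Fin (p.len + 1) → Simplex r} {x : Simplex r} {d : ℝ}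
    (h : ∀ i, dist (v i) x ≤ d) (s : Simplex p) : dist (aff v s) x ≤ d :=
  (convex_closedBall x.1 d).sum_mem (fun i _ => s.2.1 i) s.2.2 (fun i _ => h i)

lemma dist_bary_le {p r : SimplexCategory} {v : Fin (p.len + 1) → Simplex r} {d : ℝ}
    (h : ∀ i j, dist (v i) (v j) ≤ d) (j : Fin (p.len + 1)) :
    dist (bary v) (v j) ≤ p.len / (p.len + 1) * d := by
  have hp : (0 : ℝ) < p.len + 1 := by positivity
  have hb : ∀ i, (stdSimplex.barycenter (𝕜 := ℝ) (X := Fin (p.len + 1))).1 i =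
      ((p.len : ℝ) + 1)⁻¹ := by
    intro i
    simp [stdSimplex.barycenter]
  have h1 : (bary v).1 - (v j).1 = ∑ i, ((p.len : ℝ) + 1)⁻¹ • ((v i).1 - (v j).1) := by
    rw [← Finset.smul_sum, Finset.sum_sub_distrib, Finset.sum_const, Finset.card_univ,
      Fintype.card_fin, smul_sub, ← Nat.cast_smul_eq_nsmul ℝ, smul_smul]
    push_cast
    rw [inv_mul_cancel₀ hp.ne', one_smul]
    congr 1
    rw [Finset.smul_sum]
    exact (Finset.sum_congr rfl fun i _ => congrArg (· • (v i).1) (hb i) :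
      ∑ i, (stdSimplex.barycenter (𝕜 := ℝ) (X := Fin (p.len + 1))).1 i • (v i).1 = _)
  change dist (bary v).1 (v j).1 ≤ _
  rw [dist_eq_norm, h1]
  calc ‖∑ i, ((p.len : ℝ) + 1)⁻¹ • ((v i).1 - (v j).1)‖
      ≤ ∑ i, ‖((p.len : ℝ) + 1)⁻¹ • ((v i).1 - (v j).1)‖ := norm_sum_le _ _
    -- The summand of `j` vanishes, which is where the factor `p / (p + 1)` comes from.
    _ = ∑ i ∈ Finset.univ.erase j, ‖((p.len : ℝ) + 1)⁻¹ • ((v i).1 - (v j).1)‖ := by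
        rw [Finset.sum_erase]
        simp
    _ ≤ ∑ i ∈ Finset.univ.erase j, ((p.len : ℝ) + 1)⁻¹ * d := by
        apply Finset.sum_le_sum
        intro i _
        rw [norm_smul, Real.norm_of_nonneg (by positivity)]
        exact mul_le_mul_of_nonneg_left (by rw [← dist_eq_norm]; exact h i j) (by positivity)
    _ = p.len / (p.len + 1) * d := by
        rw [Finset.sum_const, Finset.card_erase_of_mem (Finset.mem_univ _), Finset.card_univ,
          Fintype.card_fin, Nat.add_sub_cancel, nsmul_eq_mul]
        ring

/-- The affine simplices all of whose edges have length at most `d`. -/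
def small (r : SimplexCategory) (n : ℕ) (d : ℝ) : Set ((tup r).T ⦋n⦌) :=
  {v | ∀ i j, dist (v i) (v j) ≤ d}

/-- Barycentric subdivision of an `n`-simplex decreases the lengths of edges by the factor
`n / (n + 1)`. -/
lemma sd_sg_mem {r : SimplexCategory} (n : ℕ) : ∀ {v : (tup r).T ⦋n⦌} {d : ℝ}, v ∈ small r n d →
    sd r n ((tup r).sg v) ∈ affSpan
      {w | w ∈ small r n (n / (n + 1) * d) ∧ ∀ i, w i ∈ Set.range (aff (p := ⦋n⦌) v)} := by
  induction n with
  | zero =>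
    intro v d _
    refine sg_mem_affSpan ⟨fun i j => ?_, fun i => ⟨verts ⦋0⦌ i, aff_vertex (p := ⦋0⦌) v i⟩⟩
    have : i = j := Subsingleton.elim (α := Fin 1) i j
    rw [this, dist_self]
    simp
  | succ n ih =>
    intro v d hv
    have hd : 0 ≤ d := dist_nonneg.trans (hv 0 0)
    have hle : (n : ℝ) / (n + 1) * d ≤ (n + 1 : ℕ) / ((n + 1 : ℕ) + 1) * d := by
      refine mul_le_mul_of_nonneg_right ?_ hd
      push_cast
      rw [div_le_div_iff₀ (by positivity) (by positivity)]
      nlinarith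
    -- The subdivision is the cone from the barycenter on the subdivided faces: edges in the faces
    -- are short by induction, and those at the cone point by the bound for the barycenter.
    rw [sd_sg, bd_sg, map_sum, map_sum]
    refine Submodule.sum_mem _ fun k _ => ?_
    rw [map_smul, map_smul]
    refine Submodule.smul_mem _ _ (map_mem_of_mem_affSpan (cone (bary (p := ⦋n + 1⦌) v) n) _ ?_
      (ih (v := (tup r).pull (SimplexCategory.δ k) v) (d := d) fun i j => hv _ _))
    rintro w ⟨hw, hwr⟩
    have hwr' : ∀ i, ∃ s, aff (p := ⦋n + 1⦌) v s = w i := by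
      intro i
      obtain ⟨s, hs⟩ := hwr i
      exact ⟨Simplex.map (SimplexCategory.δ k) s, (aff_map (q := ⦋n + 1⦌) v _ s).trans hs⟩
    have hb : ∀ i, dist (w i) (bary (p := ⦋n + 1⦌) v) ≤ (n + 1 : ℕ) / ((n + 1 : ℕ) + 1) * d := by
      intro i
      obtain ⟨s, hs⟩ := hwr' i
      rw [← hs]
      refine dist_aff_le (p := ⦋n + 1⦌) (fun j => ?_) s
      rw [dist_comm]
      exact dist_bary_le (p := ⦋n + 1⦌) hv j
    rw [cone_sg]
    refine sg_mem_affSpan ⟨fun i j => ?_, fun i => ?_⟩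
    · refine Fin.cases ?_ (fun i => ?_) i
      · refine Fin.cases ?_ (fun j => ?_) j
        · rw [dist_self]
          positivity
        · rw [dist_comm]
          exact hb j
      · refine Fin.cases ?_ (fun j => ?_) j
        · exact hb i
        · exact (hw i j).trans hle
    · refine Fin.cases ?_ (fun i => ?_) i
      · exact ⟨_, rfl⟩
      · exact hwr' i

lemma sd_pow_mem {r : SimplexCategory} (n k : ℕ) {d : ℝ} {x : AffChains r n}
    (hx : x ∈ affSpan (small r n d)) :
    (sd r n ^ k) x ∈ affSpan (small r n ((n / (n + 1) : ℝ) ^ k * d)) := by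
  induction k with
  | zero => simpa using hx
  | succ k ih =>
    rw [pow_succ' (sd r n), Module.End.mul_apply]
    refine map_mem_of_mem_affSpan (sd r n) _ (fun v hv => ?_) ih
    refine Submodule.span_mono (Set.image_mono fun w hw => ?_) (sd_sg_mem n hv)
    rw [pow_succ', mul_assoc]
    exact hw.1

section singular

variable {X : Type u} [TopologicalSpace X] {U W : Set X}

/-- The sum of the chains in `U` and the chains in `W`. -/
def chainsSup (U W : Set X) : (sing X).chains.SubMod where
  N q := (within U).chains.N q ⊔ (within W).chains.N q
  stable {p q} θ x hx := by
    obtain ⟨y, hy, z, hz, rfl⟩ := Submodule.mem_sup.1 hx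
    rw [map_add]
    exact add_mem (Submodule.mem_sup_left ((within U).chains.stable θ y hy))
      (Submodule.mem_sup_right ((within W).chains.stable θ z hz))

lemma within_mono (h : U ⊆ W) (q : SimplexCategory) :
    (within U).chains.N q ≤ (within W).chains.N q := fun _ hx =>
  mem_of_forall_sg (within U) LinearMap.id _ (fun _ hσ => sg_mem (within W) fun t => h (hσ t)) hx

lemma chainsSup_le (q : SimplexCategory) :
    (chainsSup U W).N q ≤ (within (U ∪ W)).chains.N q :=
  sup_le (within_mono Set.subset_union_left q) (within_mono Set.subset_union_right q)

lemma singSd_mem {n : ℕ} {x : (sing X).chains.obj (op ⦋n⦌)} (hx : x ∈ (within U).chains.N ⦋n⦌) :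
    singSd X n x ∈ (within U).chains.N ⦋n⦌ :=
  mem_of_forall_sg (within U) (singSd X n) _ (fun σ hσ => by
    rw [singSd, lift_sg]
    exact pushSing_mem hσ _ _) hx

lemma singSdHtpy_mem {n : ℕ} {x : (sing X).chains.obj (op ⦋n⦌)}
    (hx : x ∈ (within U).chains.N ⦋n⦌) :
    singSdHtpy X n x ∈ (within U).chains.N ⦋n + 1⦌ :=
  mem_of_forall_sg (within U) (singSdHtpy X n) _ (fun σ hσ => by
    rw [singSdHtpy, lift_sg]
    exact pushSing_mem hσ _ _) hx

lemma singSd_mem_sup {n : ℕ} {x : (sing X).chains.obj (op ⦋n⦌)}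
    (hx : x ∈ (chainsSup U W).N ⦋n⦌) : singSd X n x ∈ (chainsSup U W).N ⦋n⦌ := by
  obtain ⟨y, hy, z, hz, rfl⟩ := Submodule.mem_sup.1 hx
  rw [map_add]
  exact add_mem (Submodule.mem_sup_left (singSd_mem hy)) (Submodule.mem_sup_right (singSd_mem hz))

lemma singSdHtpy_mem_sup {n : ℕ} {x : (sing X).chains.obj (op ⦋n⦌)}
    (hx : x ∈ (chainsSup U W).N ⦋n⦌) : singSdHtpy X n x ∈ (chainsSup U W).N ⦋n + 1⦌ := by
  obtain ⟨y, hy, z, hz, rfl⟩ := Submodule.mem_sup.1 hx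
  rw [map_add]
  exact add_mem (Submodule.mem_sup_left (singSdHtpy_mem hy))
    (Submodule.mem_sup_right (singSdHtpy_mem hz))

lemma singSd_pow_mem_sup {n : ℕ} {x : (sing X).chains.obj (op ⦋n⦌)} {k l : ℕ} (hkl : k ≤ l)
    (hx : (singSd X n ^ k) x ∈ (chainsSup U W).N ⦋n⦌) :
    (singSd X n ^ l) x ∈ (chainsSup U W).N ⦋n⦌ := by
  induction l, hkl using Nat.le_induction with
  | base => exact hx
  | succ l _ ih =>
    rw [pow_succ', Module.End.mul_apply]
    exact singSd_mem_sup ih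

/-- A singular simplex in `U ∪ W` becomes small of order `{U, W}` after sufficiently many
subdivisions: by the Lebesgue number lemma. -/
lemma exists_singSd_pow_sg_mem (hU : IsOpen U) (hW : IsOpen W) {n : ℕ} {σ : Sing X ⦋n⦌}
    (hσ : σ ∈ (within (U ∪ W)).P ⦋n⦌) :
    ∃ k, (singSd X n ^ k) ((sing X).sg (q := ⦋n⦌) σ) ∈ (chainsSup U W).N ⦋n⦌ := by
  obtain ⟨ε, hε, hball⟩ := lebesgue_number_lemma_of_metric (s := (Set.univ : Set (Simplex ⦋n⦌)))
    (c := fun b : Bool => if b then σ ⁻¹' U else σ ⁻¹' W) isCompact_univ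
    (fun b => by cases b <;> simp [hU.preimage σ.continuous, hW.preimage σ.continuous])
    (fun t _ => by
      rcases hσ t with h | h
      · exact Set.mem_iUnion.2 ⟨true, h⟩
      · exact Set.mem_iUnion.2 ⟨false, h⟩)
  let D := Metric.diam (Set.univ : Set (Simplex ⦋n⦌))
  have hD : verts ⦋n⦌ ∈ small ⦋n⦌ n D := fun i j =>
    Metric.dist_le_diam_of_mem isCompact_univ.isBounded trivial trivial
  -- After `k` subdivisions, each simplex lies in a ball of radius `ε` about its zeroth vertex.
  obtain ⟨k, hk⟩ : ∃ k : ℕ, (n / (n + 1) : ℝ) ^ k * D < ε := by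
    have hlim := (tendsto_pow_atTop_nhds_zero_of_lt_one (r := (n / (n + 1) : ℝ)) (by positivity)
      (by rw [div_lt_one (by positivity)]; linarith)).mul_const D
    rw [zero_mul] at hlim
    exact (hlim.eventually_lt_const hε).exists
  refine ⟨k, ?_⟩
  rw [← pushSing_verts, singSd_pow_pushSing]
  refine map_mem_of_mem_affSpan (pushSing σ ⦋n⦌) _ (fun w hw => ?_)
    (sd_pow_mem n k (sg_mem_affSpan hD))
  obtain ⟨b, hb⟩ := hball (w 0) trivial
  have hin : ∀ s : Simplex ⦋n⦌, aff (p := ⦋n⦌) w s ∈ Metric.ball (w 0) ε := fun s =>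
    (dist_aff_le (p := ⦋n⦌) (fun i => hw i 0) s).trans_lt hk
  rw [pushSing_sg]
  cases b with
  | true => exact Submodule.mem_sup_left (sg_mem (within U) fun s => hb (hin s))
  | false => exact Submodule.mem_sup_right (sg_mem (within W) fun s => hb (hin s))

lemma exists_singSd_pow_mem (hU : IsOpen U) (hW : IsOpen W) {n : ℕ}
    {x : (sing X).chains.obj (op ⦋n⦌)} (hx : x ∈ (within (U ∪ W)).chains.N ⦋n⦌) :
    ∃ k, (singSd X n ^ k) x ∈ (chainsSup U W).N ⦋n⦌ := by
  let N : Submodule ℚ ((sing X).chains.obj (op ⦋n⦌)) :=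
    { carrier := {x | ∃ k, (singSd X n ^ k) x ∈ (chainsSup U W).N ⦋n⦌}
      add_mem' := by
        rintro x y ⟨k, hk⟩ ⟨l, hl⟩
        refine ⟨max k l, ?_⟩
        rw [map_add]
        exact add_mem (singSd_pow_mem_sup (le_max_left k l) hk)
          (singSd_pow_mem_sup (le_max_right k l) hl)
      zero_mem' := ⟨0, by rw [map_zero]; exact zero_mem _⟩
      smul_mem' := by
        rintro c x ⟨k, hk⟩
        refine ⟨k, ?_⟩
        rw [map_smul]
        exact Submodule.smul_mem _ c hk }
  exact mem_of_forall_sg (within (U ∪ W)) LinearMap.id N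
    (fun σ hσ => exists_singSd_pow_sg_mem hU hW hσ) hx

/-- Excision, in the form of small simplices: for open sets `U` and `W`, the sum of the chains in
`U` and in `W` has the same relative homology as the chains in `U ∪ W`. -/
theorem bijective_hm_excision (hU : IsOpen U) (hW : IsOpen W) (n : ℕ) :
    Function.Bijective (hm n ((chainsSup U W).mapQ (within (U ∪ W)).chains (𝟙 _)
      fun q _ hx => chainsSup_le q hx)) := by
  refine bijective_hm_mapQ (fun q => chainsSup_le q) (fun n x hx hbd => ?_) n
  obtain ⟨k, hk⟩ := exists_singSd_pow_mem hU hW hx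
  cases n with
  | zero =>
    have h1 : ∀ k, (singSd X 0 ^ k) x = x := by
      intro k
      induction k with
      | zero => rfl
      | succ k ih => rw [pow_succ', Module.End.mul_apply, ih, singSd_zero]
    refine ⟨0, zero_mem _, ?_⟩
    rwa [map_zero, sub_zero, ← h1 k]
  | succ n =>
    rw [bd'_succ] at hbd
    induction k generalizing x with
    | zero => exact ⟨0, zero_mem _, by rwa [map_zero, sub_zero]⟩
    | succ k ih =>
      rw [pow_succ, Module.End.mul_apply] at hk
      obtain ⟨y, hy, hxy⟩ := ih (singSd X (n + 1) x) (singSd_mem hx)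
        (by rw [← singSd_bd]; exact singSd_mem_sup hbd) hk
      -- The subdivision of `x` differs from `x` by the boundary of `singSdHtpy x` and a chain that
      -- is small because the boundary of `x` is.
      refine ⟨y + singSdHtpy X (n + 1) x, add_mem hy (singSdHtpy_mem hx), ?_⟩
      have h1 : x - bd (sing X).chains (n + 1) (y + singSdHtpy X (n + 1) x) =
          (singSd X (n + 1) x - bd (sing X).chains (n + 1) y) +
            singSdHtpy X n (bd (sing X).chains n x) := by
        have h2 := bd_singSdHtpy n x
        rw [map_add]
        linear_combination (norm := module) (-1 : ℚ) • h2
      rw [h1]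
      exact add_mem hxy (singSdHtpy_mem_sup hbd)

end singular

end
end BorelO2

namespace BorelO2

noncomputable section

open Simplicial SMod SimpSet

/-! ### Relative singular chains and homotopies -/

namespace SMod

/-- A short exact sequence with acyclic middle term shifts concentrated homology by one degree. -/
lemma Conc.of_ses {X Y Z : SMod.{u}} {i : X ⟶ Y} {p : Y ⟶ Z} (h : Ses i p)
    (hY : ∀ n, Subsingleton ((Hn n).obj Y)) {a : X ⟶ X} (b : Y ⟶ Y) {c : Z ⟶ Z}
    (hab : i ≫ b = a ≫ i) (hbc : p ≫ c = b ≫ p) {m k : ℕ} (hX : Conc X a m k) :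
    Conc Z c (m + 1) k := by
  let e := fun n => LinearEquiv.ofBijective (h.δ n) (h.δ_bijective n (hY _) (hY _))
  refine hX.of_equiv (k' := 0) (fun n hn => ?_) (e m).symm (fun x => ?_)
  · cases n with
    | zero =>
      have := hY 0
      exact h.surjective_zero.subsingleton
    | succ n =>
      have := hX.vanish n (fun hnm => hn (by rw [hnm]))
      exact (e n).toEquiv.subsingleton
  · obtain ⟨x, rfl⟩ := (e m).surjective x
    rw [pow_zero, one_smul, LinearEquiv.symm_apply_apply, LinearEquiv.eq_symm_apply]
    exact h.δ_naturality h a b c hab hbc m x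

/-- In the Mayer–Vietoris sequence of two contractible quotients, an endomorphism that preserves both
subspaces acts in the same way on both ends. -/
lemma Conc.mayerVietoris {X : SMod.{u}} {S T I J : X.SubMod} (hI : ∀ q, I.N q = S.N q ⊓ T.N q)
    (hJ : ∀ q, J.N q = S.N q ⊔ T.N q) (HS : Htpy (0 : S.quot ⟶ S.quot) (𝟙 _))
    (HT : Htpy (0 : T.quot ⟶ T.quot) (𝟙 _)) (φ : X ⟶ X)
    (hφI : ∀ q x, x ∈ I.N q → ap φ q x ∈ I.N q) (hφJ : ∀ q x, x ∈ J.N q → ap φ q x ∈ J.N q)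
    (hφS : ∀ q x, x ∈ S.N q → ap φ q x ∈ S.N q) (hφT : ∀ q x, x ∈ T.N q → ap φ q x ∈ T.N q)
    {m k : ℕ} (h : Conc I.quot (I.mapQ I φ hφI) m k) :
    Conc J.quot (J.mapQ J φ hφJ) (m + 1) k := by
  let b : S.quot.prod T.quot ⟶ S.quot.prod T.quot :=
    homMk (fun q => (ap (S.mapQ S φ hφS) q).prodMap (ap (T.mapQ T φ hφT) q))
      (fun θ x => Prod.ext (ap_pl (S.mapQ S φ hφS) θ x.1) (ap_pl (T.mapQ T φ hφT) θ x.2))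
  refine h.of_ses (ses_mayerVietoris hI hJ) (subsingleton_of_htpy (HS.prod HT)) b ?_ ?_
  · exact I.quot_hom_ext fun q x => rfl
  · refine hom_ext' fun q x => ?_
    obtain ⟨x, y⟩ := x
    obtain ⟨x, rfl⟩ := S.ses.surj q x
    obtain ⟨y, rfl⟩ := T.ses.surj q y
    change ap J.π q (ap φ q (x - y)) = ap J.π q (ap φ q x) - ap J.π q (ap φ q y)
    rw [map_sub, map_sub]

lemma Conc.neg {X : SMod.{u}} {φ : X ⟶ X} {m k : ℕ} (h : Conc X φ m k) :
    Conc X (-φ) m (k + 1) := by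
  refine ⟨h.vanish, ?_⟩
  obtain ⟨z, h0, h1, h2⟩ := h.gen
  exact ⟨z, h0, h1, by
    rw [hm_neg, pow_succ, mul_neg_one, neg_smul, ← h2]⟩

/-- In the Mayer–Vietoris sequence of two contractible quotients, exchanging the two subspaces
introduces a sign. -/
lemma Conc.mayerVietoris_swap {X : SMod.{u}} {S T I J : X.SubMod}
    (hI : ∀ q, I.N q = S.N q ⊓ T.N q)
    (hJ : ∀ q, J.N q = S.N q ⊔ T.N q) (HS : Htpy (0 : S.quot ⟶ S.quot) (𝟙 _))
    (HT : Htpy (0 : T.quot ⟶ T.quot) (𝟙 _)) (φ : X ⟶ X)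
    (hφI : ∀ q x, x ∈ I.N q → ap φ q x ∈ I.N q) (hφJ : ∀ q x, x ∈ J.N q → ap φ q x ∈ J.N q)
    (hφS : ∀ q x, x ∈ S.N q → ap φ q x ∈ T.N q) (hφT : ∀ q x, x ∈ T.N q → ap φ q x ∈ S.N q)
    {m k : ℕ} (h : Conc I.quot (I.mapQ I φ hφI) m k) :
    Conc J.quot (J.mapQ J φ hφJ) (m + 1) (k + 1) := by
  let b : S.quot.prod T.quot ⟶ S.quot.prod T.quot :=
    homMk (fun q => ((ap (T.mapQ S φ hφT) q).comp (LinearMap.snd ℚ _ _)).prod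
        ((ap (S.mapQ T φ hφS) q).comp (LinearMap.fst ℚ _ _)))
      (fun θ x => Prod.ext (ap_pl (T.mapQ S φ hφT) θ x.2) (ap_pl (S.mapQ T φ hφS) θ x.1))
  rw [← neg_neg (J.mapQ J φ hφJ)]
  refine Conc.neg (h.of_ses (ses_mayerVietoris hI hJ) (subsingleton_of_htpy (HS.prod HT)) b ?_ ?_)
  · exact I.quot_hom_ext fun q x => rfl
  · refine hom_ext' fun q x => ?_
    obtain ⟨x, y⟩ := x
    obtain ⟨x, rfl⟩ := S.ses.surj q x
    obtain ⟨y, rfl⟩ := T.ses.surj q y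
    change -ap J.π q (ap φ q (x - y)) = ap J.π q (ap φ q y) - ap J.π q (ap φ q x)
    rw [map_sub, map_sub, neg_sub]

end SMod

namespace SimpSet

variable {X Y Z : Type u} [TopologicalSpace X] [TopologicalSpace Y] [TopologicalSpace Z]

/-- The map of singular chains induced by a continuous map. -/
def post (f : C(X, Y)) : (sing X).chains ⟶ (sing Y).chains :=
  SimpSet.map (fun _ σ => f.comp σ) (fun _ _ => rfl)

lemma post_sg (f : C(X, Y)) (q : SimplexCategory) (σ : Sing X q) :
    ap (post f) q ((sing X).sg (q := q) σ) = (sing Y).sg (q := q) (f.comp σ) :=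
  ap_map_sg (X := sing X) (Y := sing Y) (fun _ σ => f.comp σ) (fun _ _ => rfl) q σ

lemma post_mem (f : C(X, Y)) {U : Set X} {U' : Set Y} (h : ∀ x ∈ U, f x ∈ U')
    {q : SimplexCategory} {x : (sing X).chains.obj (op q)} (hx : x ∈ (within U).chains.N q) :
    ap (post f) q x ∈ (within U').chains.N q :=
  mem_of_forall_sg (within U) (ap (post f) q) _ (fun σ hσ => by
    rw [post_sg]
    exact sg_mem (within U') fun t => h _ (hσ t)) hx

/-- The map of relative singular chains induced by a map of pairs. -/
def relPost (f : C(X, Y)) {U : Set X} {U' : Set Y} (h : ∀ x ∈ U, f x ∈ U') :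
    (within U).rel ⟶ (within U').rel :=
  relMap (X := sing X) (Y := sing Y) _ _ (fun _ σ => f.comp σ) (fun _ _ => rfl)
    (fun _ _ hσ t => h _ (hσ t))

lemma relPost_sg (f : C(X, Y)) {U : Set X} {U' : Set Y} (h : ∀ x ∈ U, f x ∈ U')
    (q : SimplexCategory) (σ : Sing X q) :
    ap (relPost f h) q (ap (within U).chains.π q ((sing X).sg (q := q) σ)) =
      ap (within U').chains.π q ((sing Y).sg (q := q) (f.comp σ)) :=
  relMap_sg (X := sing X) (Y := sing Y) (within U) (within U') (fun _ σ => f.comp σ)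
    (fun _ _ => rfl) _ q σ

lemma relPost_comp (f : C(X, Y)) (g : C(Y, Z)) {U : Set X} {U' : Set Y} {U'' : Set Z}
    (h : ∀ x ∈ U, f x ∈ U') (h' : ∀ x ∈ U', g x ∈ U'') :
    relPost f h ≫ relPost g h' = relPost (g.comp f) fun x hx => h' _ (h x hx) :=
  rel_hom_ext fun q σ => by
    rw [ap_comp, relPost_sg, relPost_sg, relPost_sg]
    rfl

/-- The coordinate of the vertex `1`, pulled back along an operator `q ⟶ ⦋1⦌`. -/
def coord {q : SimplexCategory} (θ : q ⟶ ⦋1⦌) : C(Simplex q, unitInterval) where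
  toFun s := ⟨(Simplex.map θ s).1 1, (Simplex.map θ s).2.1 1, by
    rw [← (Simplex.map θ s).2.2]
    exact Finset.single_le_sum (fun i _ => (Simplex.map θ s).2.1 i) (Finset.mem_univ _)⟩
  continuous_toFun := ((continuous_apply _).comp
    (continuous_subtype_val.comp (Simplex.map θ).continuous)).subtype_mk _

lemma coord_comp {p q : SimplexCategory} (η : p ⟶ q) (θ : q ⟶ ⦋1⦌) (s : Simplex p) :
    coord (η ≫ θ) s = coord θ (Simplex.map η s) := by
  apply Subtype.ext
  exact congrArg (fun σ : Simplex ⦋1⦌ => σ.1 1)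
    (stdSimplex.map_comp_apply η.toOrderHom θ.toOrderHom s).symm

lemma coord_c0 (q : SimplexCategory) (s : Simplex q) : coord (c0 q) s = 0 := by
  apply Subtype.ext
  change (Simplex.map (c0 q) s).1 1 = 0
  rw [simplexMap_eq_aff, aff_coe]
  refine Finset.sum_eq_zero fun i _ => ?_
  have : (verts ⦋1⦌ ((c0 q).toOrderHom i)).1 1 = 0 := by
    change (verts ⦋1⦌ 0).1 1 = 0
    simp [verts]
  rw [this, mul_zero]

lemma coord_c1 (q : SimplexCategory) (s : Simplex q) : coord (c1 q) s = 1 := by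
  apply Subtype.ext
  change (Simplex.map (c1 q) s).1 1 = 1
  rw [simplexMap_eq_aff, aff_coe]
  refine Eq.trans (Finset.sum_congr rfl fun i _ => ?_) s.2.2
  have : (verts ⦋1⦌ ((c1 q).toOrderHom i)).1 1 = 1 := by
    change (verts ⦋1⦌ 1).1 1 = 1
    simp [verts]
  rw [this, mul_one]

/-- A homotopy of maps of pairs induces a homotopy of relative singular chains. -/
def spaceHtpy (H : C(unitInterval × X, Y)) {U : Set X} {U' : Set Y}
    (hH : ∀ t x, x ∈ U → H (t, x) ∈ U') {f g : (within U).rel ⟶ (within U').rel}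
    (hf : ∀ q (σ : Sing X q), ap f q (ap (within U).chains.π q ((sing X).sg (q := q) σ)) =
      ap (within U').chains.π q ((sing Y).sg (q := q)
        (H.comp ((ContinuousMap.const _ 0).prodMk σ))))
    (hg : ∀ q (σ : Sing X q), ap g q (ap (within U).chains.π q ((sing X).sg (q := q) σ)) =
      ap (within U').chains.π q ((sing Y).sg (q := q)
        (H.comp ((ContinuousMap.const _ 1).prodMk σ)))) : Htpy f g :=
  relHtpy (X := sing X) (Y := sing Y) (P := within U) (Q := within U')
    (fun _ θ σ => H.comp ((coord θ).prodMk σ))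
    (fun η θ σ => by
      ext s
      change H (coord θ (Simplex.map η s), σ (Simplex.map η s)) = H (coord (η ≫ θ) s, _)
      rw [coord_comp]
      rfl)
    (fun _ _ _ hσ t => hH _ _ (hσ t))
    (fun q σ => by
      refine (hf q σ).trans ?_
      congr 2
      ext s
      exact congrArg (fun t => H (t, σ s)) (coord_c0 q s).symm)
    (fun q σ => by
      refine (hg q σ).trans ?_
      congr 2
      ext s
      exact congrArg (fun t => H (t, σ s)) (coord_c1 q s).symm)

/-- The relative chains of a pair `(X, U)` such that `X` can be deformed into `U` are
contractible. -/
def contractHtpy (H : C(unitInterval × X, X)) {U : Set X} (hH : ∀ t x, x ∈ U → H (t, x) ∈ U)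
    (h0 : ∀ x, H (0, x) ∈ U) (h1 : ∀ x, H (1, x) = x) :
    Htpy (0 : (within U).rel ⟶ (within U).rel) (𝟙 _) :=
  spaceHtpy H hH
    (fun q σ => ((within U).chains.π_eq_zero_iff.2 (sg_mem _ fun _ => h0 _)).symm)
    (fun q σ => by
      rw [ap_id]
      congr 2
      ext s
      exact (h1 _).symm)

section star

variable {V : Type u} [NormedAddCommGroup V] [NormedSpace ℝ V]

/-- The straight line homotopy from the point `e` to the identity. -/
def lineHtpy (e : V) : C(unitInterval × V, V) where
  toFun p := (1 - (p.1 : ℝ)) • e + (p.1 : ℝ) • p.2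
  continuous_toFun := by fun_prop

/-- The chains of a normed space relative to a star-shaped subset are contractible. -/
def starHtpy {A : Set V} {e : V} (he : e ∈ A) (hA : StarConvex ℝ e A) :
    Htpy (0 : (within A).rel ⟶ (within A).rel) (𝟙 _) :=
  contractHtpy (lineHtpy e)
    (fun t v hv => hA hv (sub_nonneg.2 t.2.2) t.2.1 (sub_add_cancel _ _))
    (fun v => by simpa [lineHtpy] using he) (fun v => by simp [lineHtpy])

/-- The homology of a normed space is that of a point. -/
lemma conc_rel_empty (f : C(V, V)) (hf : f 0 = 0) :
    Conc (within (∅ : Set V)).rel (relPost f fun _ h => h.elim) 0 0 := by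
  let c : C(V, V) := ContinuousMap.const _ 0
  let g : (within (∅ : Set V)).rel ⟶ (within (∅ : Set V)).rel := relPost c fun _ h => h.elim
  have H : Htpy g (𝟙 _) := spaceHtpy (lineHtpy 0) (fun _ _ h => h.elim)
    (fun q σ => by
      rw [relPost_sg]
      congr 2
      ext s
      simp [lineHtpy, c])
    (fun q σ => by
      rw [ap_id]
      congr 2
      ext s
      simp [lineHtpy])
  have hz : ∀ y : (Hn 0).obj (within (∅ : Set V)).rel, ∃ a : ℚ, y =
      a • cls0 (within (∅ : Set V)).rel (ap (within (∅ : Set V)).chains.π ⦋0⦌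
        ((sing V).sg (q := ⦋0⦌) (ContinuousMap.const _ 0))) := by
    intro y
    obtain ⟨y, rfl⟩ := cls0_surjective _ y
    obtain ⟨y, rfl⟩ := (within (∅ : Set V)).chains.ses.surj _ y
    have h1 : ap g ⦋0⦌ (ap (within (∅ : Set V)).chains.π ⦋0⦌ y) ∈
        Submodule.span ℚ {ap (within (∅ : Set V)).chains.π ⦋0⦌
          ((sing V).sg (q := ⦋0⦌) (ContinuousMap.const _ 0))} :=
      forall_mem (ap g ⦋0⦌ ∘ₗ ap (within (∅ : Set V)).chains.π ⦋0⦌) _ (fun σ => by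
        rw [LinearMap.comp_apply, relPost_sg]
        exact Submodule.subset_span rfl) y
    obtain ⟨a, ha⟩ := Submodule.mem_span_singleton.1 h1
    refine ⟨a, ?_⟩
    rw [← map_smul, ha, ← hm_cls0 g, H.hm_eq, hm_id]
  refine ⟨fun n hn => ?_, _, fun h0 => ?_, hz, ?_⟩
  · obtain ⟨n, rfl⟩ := Nat.exists_eq_succ_of_ne_zero hn
    refine subsingleton_of_htpy_discrete (f := g) H (fun q x => ?_) n
    obtain ⟨x, rfl⟩ := (within (∅ : Set V)).chains.ses.surj _ x
    refine induction (pl (within (∅ : Set V)).rel (cst q q 0) ∘ₗ ap g q ∘ₗ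
      ap (within (∅ : Set V)).chains.π q) (ap g q ∘ₗ ap (within (∅ : Set V)).chains.π q)
      (fun σ => ?_) x
    rw [LinearMap.comp_apply, LinearMap.comp_apply, relPost_sg, ← ap_pl,
      pl_sg]
    rfl
  · rw [cls0_eq_zero_iff] at h0
    obtain ⟨y, hy⟩ := h0
    obtain ⟨y, rfl⟩ := (within (∅ : Set V)).chains.ses.surj _ y
    rw [← ap_bd, ← sub_eq_zero, ← map_sub, SubMod.π_eq_zero_iff] at hy
    -- The augmentation separates the vertex `0` from the boundaries.
    let aug : ∀ q, (sing V).chains.obj (op q) →ₗ[ℚ] ℚ := fun q => (sing V).lift fun _ => 1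
    have h1 : aug ⦋0⦌ (bd (sing V).chains 0 y) = 0 := by
      refine induction (aug ⦋0⦌ ∘ₗ bd (sing V).chains 0) 0 (fun σ => ?_) y
      rw [LinearMap.comp_apply, bd_sg, map_sum, Fin.sum_univ_two, map_smul, map_smul, lift_sg,
        lift_sg]
      simp
    have h2 := mem_of_forall_sg (within (∅ : Set V)) (aug ⦋0⦌) ⊥
      (fun σ hσ => (hσ (verts ⦋0⦌ 0)).elim) hy
    rw [Submodule.mem_bot, map_sub, h1, lift_sg] at h2
    norm_num at h2
  · rw [hm_cls0, relPost_sg, pow_zero, one_smul]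
    congr 4
    ext t
    exact hf

lemma conc_chains (f : C(V, V)) (hf : f 0 = 0) : Conc (sing V).chains (post f) 0 0 := by
  refine (conc_rel_empty f hf).comap (within (∅ : Set V)).chains.π
    (fun n => hm_bijective_of_bijective _ (fun q => ?_) n) rfl
  refine ⟨?_, (within (∅ : Set V)).chains.ses.surj q⟩
  rw [injective_iff_map_eq_zero]
  intro x hx
  rw [SubMod.π_eq_zero_iff] at hx
  exact mem_of_forall_sg (within (∅ : Set V)) LinearMap.id ⊥
    (fun σ hσ => (hσ (verts q 0)).elim) hx

end star

section linear

variable {V : Type u} [NormedAddCommGroup V] [NormedSpace ℝ V] [FiniteDimensional ℝ V]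
  {ι : Type} (b : Module.Basis ι ℝ V)

/-- The vectors with a non-zero coordinate in the given set. -/
def nz (s : Finset ι) : Set V := {v | ∃ i ∈ s, b.coord i v ≠ 0}

variable {b}

lemma continuous_coord (i : ι) : Continuous (b.coord i) :=
  LinearMap.continuous_of_finiteDimensional _

lemma isOpen_nz (s : Finset ι) : IsOpen (nz b s) := by
  have : nz b s = ⋃ i ∈ s, {v | b.coord i v ≠ 0} := by
    ext v
    simp [nz]
  rw [this]
  exact isOpen_biUnion fun i _ => isOpen_ne_fun (continuous_coord i) continuous_const

omit [FiniteDimensional ℝ V] in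
lemma starConvex_nz (s : Finset ι) {j : ι} (hj : j ∉ s) {c : ℝ} (hc : c * c = 1) :
    StarConvex ℝ (c • b j) (nz b s ∪ {v | 0 < c * b.coord j v}) := by
  intro v hv α β hα hβ hαβ
  rcases hβ.eq_or_lt with rfl | hβ
  · right
    have : α = 1 := by linarith
    simp [this, hc]
  rcases hv with ⟨i, hi, hv⟩ | hv
  · left
    refine ⟨i, hi, ?_⟩
    have hij : j ≠ i := fun h => hj (h ▸ hi)
    rw [map_add, map_smul, map_smul, map_smul, Module.Basis.coord_apply, Module.Basis.repr_self,
      Finsupp.single_eq_of_ne hij.symm]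
    simpa using ⟨hβ.ne', hv⟩
  · right
    have hv' : 0 < c * b.coord j v := hv
    change 0 < c * b.coord j _
    rw [map_add, map_smul, map_smul, map_smul, Module.Basis.coord_apply, Module.Basis.repr_self,
      Finsupp.single_eq_same]
    simp only [smul_eq_mul]
    nlinarith [mul_pos hβ hv']

variable {ε : ι → ℝ} {f : C(V, V)}

omit [FiniteDimensional ℝ V] in
lemma nz_of_nz (hε : ∀ i, ε i * ε i = 1) (hf : ∀ i v, b.coord i (f v) = ε i * b.coord i v)
    {s : Finset ι} (v : V) (hv : v ∈ nz b s) : f v ∈ nz b s := by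
  obtain ⟨i, hi, h⟩ := hv
  refine ⟨i, hi, ?_⟩
  rw [hf]
  exact mul_ne_zero (fun h0 => by simpa [h0] using hε i) h

open Classical in
/-- The relative homology of the pair `(V, nz b s)`, by induction on `s`: the set `nz b (insert j s)`
is the union of two sets that are star-shaped about `± b j` and have the intersection `nz b s`. -/
theorem conc_nz (hε : ∀ i, ε i * ε i = 1) (hf : ∀ i v, b.coord i (f v) = ε i * b.coord i v)
    (s : Finset ι) : Conc (within (nz b s)).rel (relPost f (nz_of_nz hε hf)) s.card
      (s.filter fun i => ε i = -1).card := by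
  induction s using Finset.induction_on with
  | empty =>
    have h0 : f 0 = 0 := b.ext_elem fun i => by
      have := hf i 0
      simpa using this
    suffices h : ∀ (U : Set V) (hU : ∀ v ∈ U, f v ∈ U), U = ∅ →
        Conc (within U).rel (relPost f hU) 0 0 from h _ _ (by ext; simp [nz])
    rintro U hU rfl
    exact conc_rel_empty f h0
  | insert j s hj ih =>
    -- `A` and `B` are the union of `nz b s` with the open half-spaces on either side of `b j`.
    let A : Set V := nz b s ∪ {v | 0 < (1 : ℝ) * b.coord j v}
    let B : Set V := nz b s ∪ {v | 0 < (-1 : ℝ) * b.coord j v}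
    have hopen : ∀ c : ℝ, IsOpen (nz b s ∪ {v | 0 < c * b.coord j v}) := fun c =>
      (isOpen_nz s).union (isOpen_lt continuous_const (continuous_const.mul (continuous_coord j)))
    have hAB : nz b (insert j s) = A ∪ B := by
      ext v
      simp only [nz, A, B, Finset.mem_insert, exists_eq_or_imp, Set.mem_ofPred_eq, Set.mem_union]
      rw [ne_iff_lt_or_gt]
      simp only [one_mul, neg_mul, Left.neg_pos_iff]
      constructor
      · rintro ((h | h) | h)
        exacts [.inr (.inr h), .inl (.inr h), .inl (.inl h)]
      · rintro ((h | h) | (h | h))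
        exacts [.inr h, .inl (.inr h), .inr h, .inl (.inl h)]
    have hI : ∀ q, (within (nz b s)).chains.N q = (within A).chains.N q ⊓ (within B).chains.N q := by
      intro q
      have : (within (nz b s)).P q = (within A).P q ∩ (within B).P q := by
        ext σ
        constructor
        · exact fun h => ⟨fun t => Or.inl (h t), fun t => Or.inl (h t)⟩
        · rintro ⟨h1, h2⟩ t
          rcases h1 t with h | h
          · exact h
          rcases h2 t with h' | h'
          · exact h'
          simp only [Set.mem_ofPred_eq] at h h'
          linarith
      change Finsupp.supported ℚ ℚ ((within (nz b s)).P q) = _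
      rw [this]
      exact Finsupp.supported_inter _ _
    have hA : ∀ c : ℝ, c * c = 1 → Htpy
        (0 : (within (nz b s ∪ {v | 0 < c * b.coord j v})).rel ⟶ _) (𝟙 _) := fun c hc =>
      starHtpy (e := c • b j) (Or.inr (by simp [hc])) (starConvex_nz s hj hc)
    suffices h : ∀ (U : Set V) (hU : ∀ v ∈ U, f v ∈ U), U = A ∪ B →
        Conc (within U).rel (relPost f hU) (insert j s).card
          ((insert j s).filter fun i => ε i = -1).card from h _ _ hAB
    rintro U hU rfl
    have hpost : ∀ (C C' : Set V), (∀ v ∈ C, f v ∈ C') → ∀ q x, x ∈ (within C).chains.N q →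
        ap (post f) q x ∈ (within C').chains.N q := fun C C' h q x hx => post_mem f h hx
    -- The involution preserves `A` and `B` if `ε j = 1`, and exchanges them if `ε j = -1`.
    have hεj : ε j = 1 ∨ ε j = -1 := mul_self_eq_one_iff.1 (hε j)
    have hpos : ε j = 1 → ∀ c : ℝ, ∀ v ∈ nz b s ∪ {v | 0 < c * b.coord j v},
        f v ∈ nz b s ∪ {v | 0 < c * b.coord j v} := by
      rintro h c v (hv | hv)
      · exact Or.inl (nz_of_nz hε hf v hv)
      · right
        simpa only [Set.mem_ofPred_eq, hf, h, one_mul] using hv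
    have hneg : ε j = -1 → ∀ c : ℝ, ∀ v ∈ nz b s ∪ {v | 0 < c * b.coord j v},
        f v ∈ nz b s ∪ {v | 0 < -c * b.coord j v} := by
      rintro h c v (hv | hv)
      · exact Or.inl (nz_of_nz hε hf v hv)
      · right
        simpa only [Set.mem_ofPred_eq, hf, h, neg_mul, one_mul, mul_neg, neg_neg] using hv
    have hneg' : ε j = -1 → ∀ v ∈ B, f v ∈ A := fun h => by
      have := hneg h (-1)
      rwa [neg_neg] at this
    rw [Finset.card_insert_of_notMem hj, Finset.filter_insert]
    have hJ : ∀ q x, x ∈ (chainsSup A B).N q → ap (post f) q x ∈ (chainsSup A B).N q := by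
      rintro q _ hx
      obtain ⟨y, hy, z, hz, rfl⟩ := Submodule.mem_sup.1 hx
      rw [map_add]
      rcases hεj with h | h
      · exact add_mem (Submodule.mem_sup_left (hpost A A (hpos h 1) q y hy))
          (Submodule.mem_sup_right (hpost B B (hpos h (-1)) q z hz))
      · exact add_mem (Submodule.mem_sup_right (hpost A B (hneg h 1) q y hy))
          (Submodule.mem_sup_left (hpost B A (hneg' h) q z hz))

    have key : Conc (chainsSup A B).quot ((chainsSup A B).mapQ (chainsSup A B) (post f) hJ)
        (s.card + 1) (if ε j = -1 then insert j (s.filter fun i => ε i = -1)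
          else s.filter fun i => ε i = -1).card := by
      have hφI := hpost (nz b s) (nz b s) (nz_of_nz hε hf)
      rcases hεj with h | h
      · rw [if_neg (by rw [h]; norm_num)]
        exact Conc.mayerVietoris hI (fun _ => rfl) (hA 1 (by norm_num)) (hA (-1) (by norm_num))
          (post f) hφI hJ (hpost A A (hpos h 1)) (hpost B B (hpos h (-1))) ih
      · rw [if_pos h, Finset.card_insert_of_notMem (by simp [hj])]
        exact Conc.mayerVietoris_swap hI (fun _ => rfl) (hA 1 (by norm_num))
          (hA (-1) (by norm_num)) (post f) hφI hJ (hpost A B (hneg h 1)) (hpost B A (hneg' h)) ih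
    refine key.map _ (bijective_hm_excision (hopen _) (hopen _)) ?_
    exact (chainsSup A B).quot_hom_ext fun q x => rfl

end linear

end SimpSet

end
end BorelO2

namespace BorelO2

noncomputable section

open Simplicial SMod SimpSet

/-! ### Spheres -/

section eigenbasis

variable {V : Type u} [NormedAddCommGroup V] [NormedSpace ℝ V]

/-- A linear involution is diagonal, with entries `± 1`, in a suitable basis. -/
lemma exists_eigenbasis [FiniteDimensional ℝ V] (φ : V →ₗ[ℝ] V) (hφ : ∀ v, φ (φ v) = v) :
    ∃ (n : ℕ) (b : Module.Basis (Fin n) ℝ V) (ε : Fin n → ℝ), (∀ i, ε i * ε i = 1) ∧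
      ∀ i v, b.coord i (φ v) = ε i * b.coord i v := by
  let P := LinearMap.ker (φ - LinearMap.id)
  let N := LinearMap.ker (φ + LinearMap.id)
  have hP : ∀ v ∈ P, φ v = v := fun v hv => sub_eq_zero.1 hv
  have hN : ∀ v ∈ N, φ v = -v := fun v hv => eq_neg_of_add_eq_zero_left hv
  have hc : IsCompl P N := by
    constructor
    · rw [Submodule.disjoint_def]
      intro v h1 h2
      have h := (hP v h1).symm.trans (hN v h2)
      linear_combination (norm := module) (1 / 2 : ℝ) • h
    · rw [codisjoint_iff, eq_top_iff]
      intro v _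
      refine Submodule.mem_sup.2 ⟨(2⁻¹ : ℝ) • (v + φ v), ?_, (2⁻¹ : ℝ) • (v - φ v), ?_, ?_⟩
      · change φ _ - _ = (0 : V)
        rw [LinearMap.id_apply, map_smul, map_add, hφ, add_comm, sub_self]
      · change φ _ + _ = (0 : V)
        rw [LinearMap.id_apply, map_smul, map_sub, hφ, ← smul_add]
        simp
      · module
  -- Join bases of the eigenspaces for `1` and `-1`.
  let b₀ := ((Module.finBasis ℝ P).prod (Module.finBasis ℝ N)).map (P.prodEquivOfIsCompl N hc)
  let e := finSumFinEquiv (m := Module.finrank ℝ P) (n := Module.finrank ℝ N)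
  let ε₀ : Fin (Module.finrank ℝ P) ⊕ Fin (Module.finrank ℝ N) → ℝ := Sum.elim (fun _ => 1) fun _ => -1
  have hb : ∀ i, φ (b₀ i) = ε₀ i • b₀ i := by
    rintro (i | i)
    · simpa [b₀, ε₀] using hP _ (Module.finBasis ℝ P i).2
    · simpa [b₀, ε₀] using hN _ (Module.finBasis ℝ N i).2
  refine ⟨_, b₀.reindex e, ε₀ ∘ e.symm, fun i => ?_, fun i v => ?_⟩
  · rcases h : e.symm i with j | j <;> simp [h, ε₀]
  · have : (b₀.reindex e).coord i ∘ₗ φ = (ε₀ (e.symm i)) • (b₀.reindex e).coord i := by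
      refine (b₀.reindex e).ext fun j => ?_
      simp only [LinearMap.comp_apply, Module.Basis.reindex_apply, hb, map_smul,
        LinearMap.smul_apply, Module.Basis.coord_apply, Module.Basis.repr_reindex,
        Module.Basis.repr_self, Finsupp.mapDomain_equiv_apply, smul_eq_mul]
      by_cases hij : e.symm i = e.symm j
      · rw [hij]
      · rw [Finsupp.single_eq_of_ne hij, mul_zero, mul_zero]
    exact LinearMap.congr_fun this v

/-- The pair `(V, V ∖ 0)` has the homology of a sphere, and a linear involution acts on it by its
determinant. The determinant is recorded through the trace. -/
lemma exists_conc_ne_zero [FiniteDimensional ℝ V] (φ : V →ₗ[ℝ] V) (hφ : ∀ v, φ (φ v) = v) (f : C(V, V))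
    (hf : ∀ v, f v = φ v) (hf0 : ∀ v ∈ ({0}ᶜ : Set V), f v ∈ ({0}ᶜ : Set V)) :
    ∃ k : ℕ, LinearMap.trace ℝ V φ = Module.finrank ℝ V - 2 * k ∧
      Conc (within ({0}ᶜ : Set V)).rel (relPost f hf0) (Module.finrank ℝ V) k := by
  obtain ⟨n, b, ε, hε, hφε⟩ := exists_eigenbasis φ hφ
  have hfin : Module.finrank ℝ V = n := by
    rw [Module.finrank_eq_card_basis b, Fintype.card_fin]
  have hε' : ∀ i, ε i = 1 ∨ ε i = -1 := fun i => mul_self_eq_one_iff.1 (hε i)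
  classical
  refine ⟨((Finset.univ : Finset (Fin n)).filter fun i => ε i = -1).card, ?_, ?_⟩
  -- The exponent is the number of eigenvalues `-1`.
  · have h1 : LinearMap.trace ℝ V φ = ∑ i, ε i := by
      rw [LinearMap.trace_eq_matrix_trace ℝ b, Matrix.trace]
      refine Finset.sum_congr rfl fun i _ => ?_
      rw [Matrix.diag_apply, LinearMap.toMatrix_apply]
      have := hφε i (b i)
      simpa using this
    have h2 : ∀ i, ε i = 1 - 2 * (if ε i = -1 then 1 else 0) := by
      intro i
      rcases hε' i with h | h <;> rw [h] <;> norm_num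
    rw [h1, hfin, Finset.sum_congr rfl fun i _ => h2 i, Finset.sum_sub_distrib, ← Finset.mul_sum,
      Finset.sum_boole]
    simp
  · suffices h : ∀ (U : Set V) (hU : ∀ v ∈ U, f v ∈ U), U = nz b Finset.univ →
        Conc (within U).rel (relPost f hU) (Module.finrank ℝ V)
          ((Finset.univ : Finset (Fin n)).filter fun i => ε i = -1).card by
      refine h _ _ ?_
      ext v
      change v ≠ 0 ↔ ∃ i ∈ Finset.univ, b.coord i v ≠ 0
      rw [← not_iff_not]
      push Not
      rw [← b.forall_coord_eq_zero_iff]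
      simp
    rintro U hU rfl
    have := conc_nz (b := b) hε (f := f) (fun i v => by rw [hf, hφε]) Finset.univ
    rw [hfin]
    rwa [Finset.card_univ, Fintype.card_fin] at this

end eigenbasis

section inversion

variable {V : Type u} [NormedAddCommGroup V] [NormedSpace ℝ V]

/-- Inversion in the unit sphere of a normed space. -/
def sphInv (v : V) : V := (‖v‖⁻¹ * ‖v‖⁻¹) • v

lemma norm_sphInv (v : V) : ‖sphInv v‖ = ‖v‖⁻¹ := by
  rw [sphInv, norm_smul, Real.norm_of_nonneg (by positivity)]
  by_cases h : ‖v‖ = 0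
  · simp [h]
  · field_simp

lemma sphInv_sphInv (v : V) : sphInv (sphInv v) = v := by
  by_cases h : v = 0
  · simp [h, sphInv]
  · have : ‖v‖ ≠ 0 := norm_ne_zero_iff.2 h
    rw [sphInv, norm_sphInv, sphInv, smul_smul]
    have : ‖v‖⁻¹⁻¹ * ‖v‖⁻¹⁻¹ * (‖v‖⁻¹ * ‖v‖⁻¹) = 1 := by field_simp
    rw [this, one_smul]

lemma continuousAt_sphInv {v : V} (h : v ≠ 0) : ContinuousAt (sphInv : V → V) v := by
  have : ‖v‖ ≠ 0 := norm_ne_zero_iff.2 h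
  unfold sphInv
  fun_prop (disch := assumption)

variable [FiniteDimensional ℝ V]

/-- Inversion as a map from `V` to its one-point compactification. -/
def invCoe (v : V) : OnePoint V := by
  classical exact if v = 0 then OnePoint.infty else (sphInv v : V)

/-- Inversion as a map from the one-point compactification of `V`, with junk value at `0`. -/
def invOnePoint (x : OnePoint V) : V := x.elim 0 sphInv

omit [FiniteDimensional ℝ V] in
lemma invCoe_zero : invCoe (0 : V) = OnePoint.infty := if_pos rfl

omit [FiniteDimensional ℝ V] in
lemma invCoe_of_ne {v : V} (h : v ≠ 0) : invCoe v = (sphInv v : V) := if_neg h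

omit [FiniteDimensional ℝ V] in
lemma invCoe_invOnePoint {x : OnePoint V} (hx : x ≠ ((0 : V) : OnePoint V)) : invCoe (invOnePoint x) = x := by
  induction x using OnePoint.rec with
  | infty => exact invCoe_zero
  | coe v =>
    have hv : v ≠ 0 := fun h => hx (by rw [h])
    have : sphInv v ≠ 0 := by
      rw [← norm_ne_zero_iff, norm_sphInv]
      exact inv_ne_zero (norm_ne_zero_iff.2 hv)
    change invCoe (sphInv v) = _
    rw [invCoe_of_ne this, sphInv_sphInv]

omit [FiniteDimensional ℝ V] in
lemma invCoe_ne (v : V) : invCoe v ≠ ((0 : V) : OnePoint V) := by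
  by_cases h : v = 0
  · rw [h, invCoe_zero]
    exact OnePoint.infty_ne_coe _
  · rw [invCoe_of_ne h]
    intro h'
    have := congrArg norm (OnePoint.coe_injective h')
    rw [norm_sphInv, norm_zero, inv_eq_zero, norm_eq_zero] at this
    exact h this

lemma continuous_invCoe : Continuous (invCoe : V → OnePoint V) := by
  have : ProperSpace V := FiniteDimensional.proper_real V
  rw [continuous_iff_continuousAt]
  intro v
  by_cases h : v = 0
  · subst h
    rw [continuousAt_iff_punctured_nhds, invCoe_zero]
    have h1 : Filter.Tendsto (sphInv : V → V) (nhdsWithin 0 {0}ᶜ) (Filter.cocompact V) := by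
      rw [← Metric.cobounded_eq_cocompact, ← tendsto_norm_atTop_iff_cobounded]
      simp only [norm_sphInv]
      exact tendsto_inv_nhdsGT_zero.comp tendsto_norm_nhdsNE_zero
    have h2 : Filter.Tendsto (fun v : V => ((sphInv v : V) : OnePoint V)) (nhdsWithin 0 {0}ᶜ)
        (nhds OnePoint.infty) := by
      refine OnePoint.tendsto_coe_infty.comp ?_
      rwa [Filter.coclosedCompact_eq_cocompact]
    refine h2.congr' ?_
    filter_upwards [self_mem_nhdsWithin] with w hw
    exact (invCoe_of_ne hw).symm
  · have h1 : ContinuousAt (fun v : V => ((sphInv v : V) : OnePoint V)) v :=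
      OnePoint.continuous_coe.continuousAt.comp (continuousAt_sphInv h)
    refine h1.congr ?_
    filter_upwards [isOpen_compl_singleton.mem_nhds h] with w hw
    exact (invCoe_of_ne hw).symm

lemma continuousAt_invOnePoint {x : OnePoint V} (hx : x ≠ ((0 : V) : OnePoint V)) :
    ContinuousAt invOnePoint x := by
  have : ProperSpace V := FiniteDimensional.proper_real V
  induction x using OnePoint.rec with
  | infty =>
    rw [OnePoint.continuousAt_infty', Filter.coclosedCompact_eq_cocompact,
      ← Metric.cobounded_eq_cocompact]
    change Filter.Tendsto (sphInv : V → V) _ (nhds 0)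
    rw [tendsto_zero_iff_norm_tendsto_zero]
    simp only [norm_sphInv]
    exact tendsto_inv_atTop_zero.comp tendsto_norm_cobounded_atTop
  | coe v =>
    rw [OnePoint.continuousAt_coe]
    exact continuousAt_sphInv fun h => hx (by rw [h])

/-- The contraction of the complement of `0` in the one-point compactification to `∞`. -/
def sphereContract : C(unitInterval × ({((0 : V) : OnePoint V)}ᶜ : Set (OnePoint V)), ({((0 : V) : OnePoint V)}ᶜ : Set (OnePoint V))) where
  toFun p := ⟨invCoe ((p.1 : ℝ) • invOnePoint p.2.1), invCoe_ne _⟩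
  continuous_toFun := by
    refine (continuous_invCoe.comp ?_).subtype_mk _
    refine (continuous_subtype_val.comp continuous_fst).smul ?_
    have : Continuous fun x : ({((0 : V) : OnePoint V)}ᶜ : Set (OnePoint V)) => invOnePoint x.1 := by
      rw [continuous_iff_continuousAt]
      intro x
      exact (continuousAt_invOnePoint x.2).comp continuous_subtype_val.continuousAt
    exact this.comp continuous_snd

end inversion

section embedding

variable {X Z : Type u} [TopologicalSpace X] [TopologicalSpace Z]

/-- The simplices in the image of an embedding are the images of simplices. -/
lemma within_range_eq (c : C(Z, X)) (hc : Topology.IsInducing c) (q : SimplexCategory) :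
    (within (Set.range c)).P q = Set.range fun σ : Sing Z q => (c.comp σ : Sing X q) := by
  ext σ
  constructor
  · intro hσ
    choose τ hτ using hσ
    have h : c ∘ τ = σ := funext hτ
    refine ⟨⟨τ, ?_⟩, ContinuousMap.ext hτ⟩
    rw [hc.continuous_iff, h]
    exact σ.continuous
  · rintro ⟨τ, rfl⟩ t
    exact ⟨τ t, rfl⟩

/-- Excision for an open embedding `c : Z → X` and an open set `U` which together cover `X`. -/
lemma bijective_hm_relPost (c : C(Z, X)) (hc : Topology.IsOpenEmbedding c) {U : Set X}
    (hU : IsOpen U) (hcov : U ∪ Set.range c = Set.univ) {P : Set Z} (hP : P = c ⁻¹' U) (n : ℕ) :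
    Function.Bijective (hm n (relPost c (U := P) (U' := U) fun _ hx => hP.le hx)) := by
  have h := ses_of_injective (Z := sing Z) (X := sing X) (fun q σ => c.comp σ) (fun _ _ => rfl)
    (fun q σ τ hστ => ContinuousMap.ext fun t => hc.injective (DFunLike.congr_fun hστ t))
    (within P) (within U)
    (fun q σ => by subst hP; rfl) (chainsSup U (Set.range c)) (within (Set.range c))
    (within_range_eq c hc.isInducing) (fun _ => rfl)
  have hJ : ∀ n, Subsingleton ((Hn n).obj (chainsSup U (Set.range c)).quot) := by
    intro n
    have h1 : Subsingleton ((Hn n).obj (within (U ∪ Set.range c)).rel) := by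
      refine subsingleton_of_htpy (contractHtpy ⟨Prod.snd, continuous_snd⟩ (fun _ _ hx => hx)
        (fun x => ?_) fun _ => rfl) n
      rw [hcov]
      trivial
    exact (bijective_hm_excision hU hc.isOpen_range n).1.subsingleton
  exact ⟨h.injective_hm_i n (hJ _), h.surjective_hm_i n (hJ _)⟩

end embedding

namespace RealRep

variable (V : RealRep.{u})

/-- The action of an element of `O(2)` on `V`, as a continuous map. -/
def actMap (g : O2) : C(V.carrier, V.carrier) :=
  ⟨V.ρ g, V.continuous_act.comp (by fun_prop : Continuous fun v : V.carrier => (g, v))⟩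

/-- The action of an element of `O(2)` on the sphere `S^V`, as a continuous map. -/
def sphereMap (g : O2) : C(OnePoint V.carrier, OnePoint V.carrier) :=
  ⟨V.sphereAct g, V.continuous_sphereAct.comp
    (by fun_prop : Continuous fun v : OnePoint V.carrier => (g, v))⟩

/-- The inclusion of `V` into `S^V`. -/
def coeMap : C(V.carrier, OnePoint V.carrier) := ⟨_, OnePoint.continuous_coe⟩

lemma actMap_ne_zero (g : O2) (v : V.carrier) (hv : v ∈ ({0}ᶜ : Set V.carrier)) :
    V.actMap g v ∈ ({0}ᶜ : Set V.carrier) := by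
  intro h
  apply hv
  have h1 : V.ρ g v = 0 := h
  rw [← Module.End.one_apply (R := ℝ) v, ← map_one V.ρ, ← inv_mul_cancel g, map_mul,
    Module.End.mul_apply, h1, map_zero]
  rfl

/-- The complement of the origin in `S^V`. -/
def punctured : Set (OnePoint V.carrier) := {((0 : V.carrier) : OnePoint V.carrier)}ᶜ

lemma sphereMap_punctured (g : O2) (x : OnePoint V.carrier) (hx : x ∈ V.punctured) :
    V.sphereMap g x ∈ V.punctured := by
  induction x using OnePoint.rec with
  | infty => exact OnePoint.infty_ne_coe _
  | coe v =>
    intro h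
    exact V.actMap_ne_zero g v (fun hv => hx (congrArg OnePoint.some hv))
      (OnePoint.coe_injective h)

lemma sphereMap_infty (g : O2) (x : OnePoint V.carrier)
    (hx : x ∈ ({OnePoint.infty} : Set (OnePoint V.carrier))) :
    V.sphereMap g x ∈ ({OnePoint.infty} : Set (OnePoint V.carrier)) := by
  rw [Set.mem_singleton_iff.1 hx]
  rfl

lemma isOpen_punctured : IsOpen V.punctured := isOpen_compl_singleton

lemma infty_subset_punctured : {OnePoint.infty} ⊆ V.punctured := by
  rintro x rfl
  exact OnePoint.infty_ne_coe _

lemma conc_punctured {m k : ℕ} (g : O2)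
    (h : Conc (within ({0}ᶜ : Set V.carrier)).rel (relPost (V.actMap g) (V.actMap_ne_zero g)) m k) :
    Conc (within V.punctured).rel (relPost (V.sphereMap g) (V.sphereMap_punctured g)) m k := by
  have hP : ({0}ᶜ : Set V.carrier) = V.coeMap ⁻¹' V.punctured := by
    ext v
    exact not_congr OnePoint.coe_injective.eq_iff.symm
  refine h.map _ (bijective_hm_relPost V.coeMap OnePoint.isOpenEmbedding_coe V.isOpen_punctured
    ?_ hP) ?_
  · rw [Set.eq_univ_iff_forall]
    intro x
    induction x using OnePoint.rec with
    | infty => exact Or.inl (OnePoint.infty_ne_coe _)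
    | coe v => exact Or.inr ⟨v, rfl⟩
  · rw [relPost_comp, relPost_comp]
    rfl

/-- The reduced chains of the sphere and its chains relative to the complement of the origin have
the same homology, since the latter set contracts to `∞`. -/
lemma bijective_hm_infty (n : ℕ) :
    Function.Bijective (hm n ((within ({OnePoint.infty} : Set (OnePoint V.carrier))).chains.mapQ
      (within V.punctured).chains (𝟙 _) fun q _ hx =>
        within_mono V.infty_subset_punctured q hx)) := by
  let c : C(V.punctured, OnePoint V.carrier) := ⟨Subtype.val, continuous_subtype_val⟩
  have hr : Set.range c = V.punctured := Subtype.range_coe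
  -- The kernel of the comparison map is the chains on the punctured sphere relative to `∞`.
  have h := ses_of_injective (Z := sing V.punctured) (X := sing (OnePoint V.carrier))
    (fun q σ => c.comp σ) (fun _ _ => rfl)
    (fun q σ τ hστ => ContinuousMap.ext fun t => Subtype.ext (DFunLike.congr_fun hστ t))
    (within (c ⁻¹' {OnePoint.infty})) (within {OnePoint.infty})
    (fun q σ => Iff.rfl) (within V.punctured).chains (within V.punctured)
    (fun q => by
      rw [← within_range_eq c Topology.IsInducing.subtypeVal, hr])
    (fun q => (sup_eq_right.2 (within_mono V.infty_subset_punctured q)).symm)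
  refine h.bijective_hm_p (fun n => subsingleton_of_htpy ?_ n) n
  have h0 : ∀ x : V.punctured, (sphereContract (0, x)).1 = OnePoint.infty := by
    intro x
    change invCoe ((0 : ℝ) • _) = _
    rw [zero_smul, invCoe_zero]
  refine contractHtpy sphereContract (fun t x hx => ?_) h0 (fun x => ?_)
  · change invCoe ((t : ℝ) • invOnePoint x.1) = _
    have hx' : x.1 = OnePoint.infty := hx
    rw [hx']
    change invCoe ((t : ℝ) • 0) = _
    rw [smul_zero, invCoe_zero]
  · apply Subtype.ext
    change invCoe ((1 : ℝ) • invOnePoint x.1) = _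
    rw [one_smul, invCoe_invOnePoint x.2]

lemma baseChains_eq (q : SimplexCategory) :
    (within ({OnePoint.infty} : Set (OnePoint V.carrier))).chains.N q = V.baseChains q := by
  change Finsupp.supported ℚ ℚ _ = _
  rw [Finsupp.supported_eq_span_single, baseChains]
  congr 1
  have : (within ({OnePoint.infty} : Set (OnePoint V.carrier))).P q =
      {ContinuousMap.const _ OnePoint.infty} := by
    ext σ
    constructor
    · exact fun h => ContinuousMap.ext h
    · rintro rfl t
      rfl
  rw [this, Set.image_singleton]

/-- The chains relative to the base point, in the two descriptions. -/
def toSphereEquiv (q : SimplexCategory) :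
    (within ({OnePoint.infty} : Set (OnePoint V.carrier))).rel.obj (op q) ≃ₗ[ℚ]
      V.sphereChains.obj.obj (op q) :=
  show ((Sing (OnePoint V.carrier) q →₀ ℚ) ⧸
      (show Submodule ℚ (Sing (OnePoint V.carrier) q →₀ ℚ) from
        (within ({OnePoint.infty} : Set (OnePoint V.carrier))).chains.N q)) ≃ₗ[ℚ] V.RelChains q from
    Submodule.quotEquivOfEq _ _ (V.baseChains_eq q)

/-- The comparison map of chains relative to the base point. -/
def toSphereChains : (within ({OnePoint.infty} : Set (OnePoint V.carrier))).rel ⟶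
    V.sphereChains.obj :=
  homMk (fun q => (V.toSphereEquiv q).toLinearMap) (fun θ x => by
    obtain ⟨x, rfl⟩ := (within ({OnePoint.infty} : Set (OnePoint V.carrier))).chains.ses.surj _ x
    rfl)

lemma toSphereChains_sg (q : SimplexCategory) (σ : Sing (OnePoint V.carrier) q) :
    ap V.toSphereChains q (ap (within {OnePoint.infty}).chains.π q
      ((sing (OnePoint V.carrier)).sg (q := q) σ)) = V.simplexClass σ := rfl

/-- The reduced homology of the sphere `S^V` is concentrated in the dimension of `V`, and the
reflection acts on it by the determinant. -/
theorem exists_conc_sphereChains : ∃ k : ℕ,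
    LinearMap.trace ℝ V.carrier (V.ρ refl) = V.dim - 2 * k ∧
      Conc V.sphereChains.obj (V.sphereChains.act refl) V.dim k := by
  have hρ : ∀ v, V.ρ refl (V.ρ refl v) = v := by
    intro v
    rw [← Module.End.mul_apply, ← map_mul, refl_mul_self, map_one]
    rfl
  obtain ⟨k, htr, h⟩ := exists_conc_ne_zero (V.ρ refl) hρ (V.actMap refl) (fun _ => rfl)
    (V.actMap_ne_zero refl)
  refine ⟨k, htr, ?_⟩
  have h1 := (V.conc_punctured refl h).comap (φ := relPost (V.sphereMap refl)
    (V.sphereMap_infty refl)) _ V.bijective_hm_infty (rel_hom_ext fun q σ => rfl)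
  refine h1.map V.toSphereChains (fun n => hm_bijective_of_bijective V.toSphereChains
    (fun q => (V.toSphereEquiv q).bijective) n) ?_
  refine rel_hom_ext fun q σ => ?_
  rw [ap_comp, ap_comp, relPost_sg, toSphereChains_sg, toSphereChains_sg]
  exact (V.chainAct_class (ContinuousMap.const _ refl) σ).symm

end RealRep

end
end BorelO2

namespace BorelO2

noncomputable section

open Simplicial SMod SimpSet SimplicialRep

/-! ### Chains on spaces with an action of `O(2)` -/

namespace SimplicialRep

/-- The quotient of a simplicial representation by an invariant simplicial subspace. -/
def quotRep (A : SimplicialRep.{u}) (S : SubMod A.obj)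
    (hS : ∀ q (g : Sing O2 q) x, x ∈ S.N q → A.ρ q g x ∈ S.N q) : SimplicialRep.{u} where
  obj := S.quot
  ρ q :=
    { toFun g := Submodule.mapQ _ _ (A.ρ q g) (hS q g)
      map_one' := by
        apply LinearMap.ext
        intro x
        obtain ⟨x, rfl⟩ := Submodule.mkQ_surjective _ x
        change (S.N q).mkQ (A.ρ q 1 x) = (S.N q).mkQ x
        rw [map_one]
        rfl
      map_mul' g h := by
        apply LinearMap.ext
        intro x
        obtain ⟨x, rfl⟩ := Submodule.mkQ_surjective _ x
        change (S.N q).mkQ (A.ρ q (g * h) x) = (S.N q).mkQ (A.ρ q g (A.ρ q h x))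
        rw [map_mul]
        rfl }
  map_act {p q} θ g a := by
    obtain ⟨a, rfl⟩ := S.ses.surj q a
    exact congrArg (S.N p).mkQ (A.pl_ρ θ g a)

/-- The projection to the quotient by an invariant simplicial subspace. -/
def quotπ (A : SimplicialRep.{u}) (S : SubMod A.obj)
    (hS : ∀ q (g : Sing O2 q) x, x ∈ S.N q → A.ρ q g x ∈ S.N q) : RHom A (A.quotRep S hS) where
  f := S.π
  equivariant _ _ _ := rfl

end SimplicialRep

section chainsRep

variable (X : Type u) [TopologicalSpace X] [MulAction O2 X] [ContinuousSMul O2 X]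

variable {X} in
/-- The pointwise action of singular simplices of `O(2)`. -/
def smulSing {q : SimplexCategory} (g : Sing O2 q) (σ : Sing X q) : Sing X q :=
  ⟨fun t => g t • σ t, g.continuous.smul σ.continuous⟩

/-- The action of a singular simplex of `O(2)` on singular chains. -/
def smulChains {q : SimplexCategory} (g : Sing O2 q) :
    (sing X).chains.obj (op q) →ₗ[ℚ] (sing X).chains.obj (op q) :=
  (sing X).lift fun σ => (sing X).sg (q := q) (smulSing g σ)

variable {X} in
lemma smulChains_sg {q : SimplexCategory} (g : Sing O2 q) (σ : Sing X q) :
    smulChains X g ((sing X).sg (q := q) σ) = (sing X).sg (q := q) (smulSing g σ) :=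
  lift_sg _ _ _

/-- The singular chains of a space with an action of `O(2)`. -/
def chainsRep : SimplicialRep.{u} where
  obj := (sing X).chains
  ρ q :=
    { toFun g := smulChains X g
      map_one' := by
        apply LinearMap.ext
        refine induction _ LinearMap.id fun σ => ?_
        rw [smulChains_sg]
        exact congrArg (fun τ : Sing X q => (sing X).sg (q := q) τ)
          (ContinuousMap.ext fun t => one_smul _ (σ t))
      map_mul' g h := by
        apply LinearMap.ext
        refine induction _ (smulChains X g ∘ₗ smulChains X h) fun σ => ?_
        rw [LinearMap.comp_apply, smulChains_sg, smulChains_sg, smulChains_sg]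
        exact congrArg (fun τ : Sing X q => (sing X).sg (q := q) τ)
          (ContinuousMap.ext fun t => mul_smul _ _ (σ t)) }
  map_act {p q} θ g a := by
    refine induction (pl (sing X).chains θ ∘ₗ smulChains X g)
      (smulChains X (Sing.pull θ g) ∘ₗ pl (sing X).chains θ) (fun σ => ?_) a
    rw [LinearMap.comp_apply, LinearMap.comp_apply, smulChains_sg, pl_sg, pl_sg, smulChains_sg]
    rfl

variable {X}

lemma chainsRep_ρ_sg {q : SimplexCategory} (g : Sing O2 q) (σ : Sing X q) :
    (chainsRep X).ρ q g ((sing X).sg (q := q) σ) = (sing X).sg (q := q) (smulSing g σ) :=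
  smulChains_sg g σ

/-- The map of chains induced by an equivariant map. -/
def chainsRepMap {Y : Type u} [TopologicalSpace Y] [MulAction O2 Y] [ContinuousSMul O2 Y]
    (c : C(X, Y)) (hc : ∀ (g : O2) x, c (g • x) = g • c x) : RHom (chainsRep X) (chainsRep Y) where
  f := post c
  equivariant q g a := by
    refine induction (ap (post c) q ∘ₗ smulChains X g) (smulChains Y g ∘ₗ ap (post c) q)
      (fun σ => ?_) a
    rw [LinearMap.comp_apply, LinearMap.comp_apply, smulChains_sg, post_sg, post_sg, smulChains_sg]
    exact congrArg (fun τ : Sing Y q => (sing Y).sg (q := q) τ)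
      (ContinuousMap.ext fun t => hc _ (σ t))

lemma within_stable {U : Set X} (hU : ∀ (g : O2), ∀ x ∈ U, g • x ∈ U) (q : SimplexCategory)
    (g : Sing O2 q) (x) (hx : x ∈ (within U).chains.N q) :
    (chainsRep X).ρ q g x ∈ (within U).chains.N q :=
  mem_of_forall_sg (within U) (smulChains X g) _ (fun σ hσ => by
    rw [smulChains_sg]
    exact sg_mem (within U) fun t => hU _ _ (hσ t)) hx

omit [MulAction O2 X] [ContinuousSMul O2 X] in
/-- The exact sequence of a pair, for a subspace that is given by an embedding. -/
lemma ses_post {Z : Type u} [TopologicalSpace Z] (c : C(Z, X)) (hc : Topology.IsEmbedding c)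
    {U : Set X} (hU : U = Set.range c) : Ses (post c) (within U).chains.π where
  inj q := by
    intro x y hxy
    -- The map of chains is the pushforward of finitely supported functions along an injection.
    have h1 : ∀ z, ap (post c) q z =
        Finsupp.mapDomain (fun σ : Sing Z q => c.comp σ) (show Sing Z q →₀ ℚ from z) :=
      induction (ap (post c) q) (show (sing Z).chains.obj (op q) →ₗ[ℚ] (sing X).chains.obj (op q)
        from Finsupp.lmapDomain ℚ ℚ (fun σ : Sing Z q => c.comp σ)) (fun σ =>
          (post_sg c q σ).trans (Finsupp.mapDomain_single (f := fun σ : Sing Z q => c.comp σ)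
            (a := σ) (b := (1 : ℚ))).symm)
    rw [h1, h1] at hxy
    exact Finsupp.mapDomain_injective (fun σ τ hστ => ContinuousMap.ext fun t =>
      hc.injective (DFunLike.congr_fun hστ t)) hxy
  exact q x := by
    subst hU
    rw [SubMod.π_eq_zero_iff]
    constructor
    · intro hx
      refine mem_of_forall_sg (within (Set.range c)) LinearMap.id
        (LinearMap.range (ap (post c) q)) (fun σ hσ => ?_) hx
      rw [within_range_eq c hc.isInducing] at hσ
      obtain ⟨τ, rfl⟩ := hσ
      exact ⟨(sing Z).sg (q := q) τ, post_sg c q τ⟩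
    · rintro ⟨z, rfl⟩
      refine forall_mem (ap (post c) q) _ (fun σ => ?_) z
      rw [post_sg]
      exact sg_mem (within (Set.range c)) fun t => ⟨σ t, rfl⟩
  surj q := (within U).chains.ses.surj q

end chainsRep

/-! ### The plane and the punctured plane -/

/-- The plane, with the defining action of `O(2)`. -/
def Plane : Type u := ULift.{u} (Fin 2 → ℝ)

namespace Plane

instance : NormedAddCommGroup Plane.{u} := inferInstanceAs (NormedAddCommGroup (ULift (Fin 2 → ℝ)))
instance : NormedSpace ℝ Plane.{u} := inferInstanceAs (NormedSpace ℝ (ULift (Fin 2 → ℝ)))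
instance : FiniteDimensional ℝ Plane.{u} :=
  inferInstanceAs (FiniteDimensional ℝ (ULift (Fin 2 → ℝ)))

/-- A coordinate of a point of the plane. -/
def co (i : Fin 2) (x : Plane.{u}) : ℝ := ULift.down x i

/-- The point with the given coordinates. -/
def of (a b : ℝ) : Plane.{u} := ULift.up ![a, b]

lemma ext {x y : Plane.{u}} (h : ∀ i, co i x = co i y) : x = y := ULift.ext _ _ (funext h)

@[simp] lemma co_zero_of (a b : ℝ) : co 0 (of.{u} a b) = a := rfl
@[simp] lemma co_smul (i : Fin 2) (c : ℝ) (x : Plane.{u}) : co i (c • x) = c * co i x := rfl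
@[simp] lemma co_zero (i : Fin 2) : co i (0 : Plane.{u}) = 0 := rfl

@[fun_prop] lemma continuous_co (i : Fin 2) : Continuous (co.{u} i) :=
  (continuous_apply i).comp continuous_uliftDown

instance : SMul O2 Plane.{u} where
  smul g x := of (g.1 0 0 * co 0 x + g.1 0 1 * co 1 x) (g.1 1 0 * co 0 x + g.1 1 1 * co 1 x)

lemma co_act (g : O2) (x : Plane.{u}) (i : Fin 2) :
    co i (g • x) = g.1 i 0 * co 0 x + g.1 i 1 * co 1 x := by
  fin_cases i <;> rfl

instance : MulAction O2 Plane.{u} where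
  one_smul x := ext fun i => by
    rw [co_act]
    fin_cases i <;> simp
  mul_smul g h x := ext fun i => by
    have h1 : ∀ j, (g * h).1 i j = g.1 i 0 * h.1 0 j + g.1 i 1 * h.1 1 j := fun j => by
      change (g.1 * h.1) i j = _
      rw [Matrix.mul_apply, Fin.sum_univ_two]
    rw [co_act, co_act, co_act, co_act, h1, h1]
    ring

@[fun_prop] lemma continuous_of {X : Type*} [TopologicalSpace X] {a b : X → ℝ}
    (ha : Continuous a) (hb : Continuous b) : Continuous fun t => of.{u} (a t) (b t) := by
  refine continuous_uliftUp.comp (continuous_pi fun i => ?_)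
  fin_cases i
  exacts [ha, hb]

instance : ContinuousSMul O2 Plane.{u} where
  continuous_smul := by
    have h : ∀ i j, Continuous fun p : O2 × Plane.{u} => p.1.1 i j := fun i j =>
      (continuous_subtype_val.comp continuous_fst).matrix_elem i j
    have h0 : ∀ i, Continuous fun p : O2 × Plane.{u} => co i p.2 := fun i =>
      (continuous_co i).comp continuous_snd
    exact continuous_of (((h 0 0).mul (h0 0)).add ((h 0 1).mul (h0 1)))
      (((h 1 0).mul (h0 0)).add ((h 1 1).mul (h0 1)))

@[simp] lemma co_add (i : Fin 2) (x y : Plane.{u}) : co i (x + y) = co i x + co i y := rfl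

/-- The linear map through which an element of `O(2)` acts on the plane. -/
def lin (g : O2) : Plane.{u} →ₗ[ℝ] Plane.{u} where
  toFun x := g • x
  map_add' x y := ext fun i => by
    rw [co_act, co_add, co_add, co_add, co_act, co_act]
    ring
  map_smul' c x := ext fun i => by
    rw [co_act, co_smul, co_smul, RingHom.id_apply, co_smul, co_act]
    ring

/-- The Euclidean norm. -/
def rad (x : Plane.{u}) : ℝ := √(co 0 x ^ 2 + co 1 x ^ 2)

@[fun_prop] lemma continuous_rad : Continuous rad.{u} := by
  unfold rad
  fun_prop

lemma rad_sq (x : Plane.{u}) : rad x ^ 2 = co 0 x ^ 2 + co 1 x ^ 2 := Real.sq_sqrt (by positivity)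

lemma rad_pos {x : Plane.{u}} (hx : x ≠ 0) : 0 < rad x := by
  refine Real.sqrt_pos.2 ((by positivity : 0 ≤ co 0 x ^ 2 + co 1 x ^ 2).lt_of_ne' fun h => hx ?_)
  refine ext fun i => ?_
  fin_cases i
  · change co 0 x = 0
    nlinarith [sq_nonneg (co 0 x), sq_nonneg (co 1 x)]
  · change co 1 x = 0
    nlinarith [sq_nonneg (co 0 x), sq_nonneg (co 1 x)]

lemma rad_act {k : O2} (hk : k ∈ SO2) (x : Plane.{u}) : rad (k • x) = rad x := by
  obtain ⟨α, rfl⟩ := exists_rot_eq hk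
  unfold rad
  congr 1
  rw [co_act, co_act]
  change (Real.cos α * _ + -Real.sin α * _) ^ 2 + (Real.sin α * _ + Real.cos α * _) ^ 2 = _
  linear_combination (co 0 x ^ 2 + co 1 x ^ 2) * Real.sin_sq_add_cos_sq α

lemma smul_ne_zero' (g : O2) {x : Plane.{u}} (hx : x ≠ 0) : g • x ≠ 0 := by
  intro h
  apply hx
  rw [← inv_smul_smul g x, h]
  exact (lin g⁻¹).map_zero

end Plane

/-- The punctured plane. -/
abbrev Punctured : Type u := {x : Plane.{u} // x ≠ 0}

namespace Punctured

open Plane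

instance : MulAction O2 Punctured.{u} where
  smul g x := ⟨g • x.1, smul_ne_zero' g x.2⟩
  one_smul x := Subtype.ext (one_smul _ x.1)
  mul_smul g h x := Subtype.ext (mul_smul g h x.1)

instance : ContinuousSMul O2 Punctured.{u} where
  continuous_smul := Continuous.subtype_mk
    (continuous_fst.smul (continuous_subtype_val.comp continuous_snd)) _

/-- The rotation that takes the first basis vector to the direction of `x`. -/
def rotTo (x : Punctured.{u}) : O2 :=
  ⟨!![co 0 x.1 / rad x.1, -(co 1 x.1 / rad x.1); co 1 x.1 / rad x.1, co 0 x.1 / rad x.1], by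
    rw [Matrix.mem_orthogonalGroup_iff]
    have h := rad_sq x.1
    have h0 := (rad_pos x.2).ne'
    have h1 : co 0 x.1 / rad x.1 * (co 0 x.1 / rad x.1) +
        co 1 x.1 / rad x.1 * (co 1 x.1 / rad x.1) = 1 := by
      field_simp
      linarith
    ext i j
    fin_cases i <;> fin_cases j <;> simp [Matrix.mul_apply, Fin.sum_univ_two] <;> linarith⟩

lemma rotTo_mem (x : Punctured.{u}) : rotTo x ∈ SO2 := by
  change Matrix.det !![co 0 x.1 / rad x.1, -(co 1 x.1 / rad x.1);
    co 1 x.1 / rad x.1, co 0 x.1 / rad x.1] = 1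
  have h := rad_sq x.1
  have h0 := (rad_pos x.2).ne'
  rw [Matrix.det_fin_two_of]
  field_simp
  linarith

lemma continuous_rotTo : Continuous rotTo.{u} := by
  have h0 : ∀ x : Punctured.{u}, rad x.1 ≠ 0 := fun x => (rad_pos x.2).ne'
  refine Continuous.subtype_mk (continuous_matrix fun i j => ?_) _
  fin_cases i <;> fin_cases j <;> simp <;> fun_prop (disch := assumption)

lemma rotTo_act {k : O2} (hk : k ∈ SO2) (x : Punctured.{u}) : rotTo (k • x) = k * rotTo x := by
  have hr : rad (k • x).1 = rad x.1 := rad_act hk x.1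
  obtain ⟨α, rfl⟩ := exists_rot_eq hk
  have h0 : co 0 (rot α • x).1 = Real.cos α * co 0 x.1 + -Real.sin α * co 1 x.1 := co_act _ x.1 0
  have h1 : co 1 (rot α • x).1 = Real.sin α * co 0 x.1 + Real.cos α * co 1 x.1 := co_act _ x.1 1
  apply Subtype.ext
  ext i j
  have h2 : ((rot α * rotTo x : O2).1) i j = (rot α).1 i 0 * (rotTo x).1 0 j +
      (rot α).1 i 1 * (rotTo x).1 1 j := by
    change ((rot α).1 * (rotTo x).1) i j = _
    rw [Matrix.mul_apply, Fin.sum_univ_two]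
  have e : (rotTo (rot α • x)).1 = !![co 0 (rot α • x).1 / rad (rot α • x).1,
      -(co 1 (rot α • x).1 / rad (rot α • x).1); co 1 (rot α • x).1 / rad (rot α • x).1,
      co 0 (rot α • x).1 / rad (rot α • x).1] := rfl
  rw [h2, e, h0, h1, hr]
  fin_cases i <;> fin_cases j <;> simp [rotTo, rot] <;> ring

/-- The first basis vector. -/
def base : Punctured.{u} := ⟨of 1 0, fun h => by simpa using congrArg (co 0) h⟩

/-- The radial deformation from the unit circle to the identity. -/
def radial : C(unitInterval × Punctured.{u}, Punctured.{u}) where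
  toFun p := ⟨((p.1 : ℝ) + (1 - p.1) / rad p.2.1) • p.2.1, by
    have h0 := rad_pos p.2.2
    have h1 : 0 ≤ 1 - (p.1 : ℝ) := sub_nonneg.2 p.1.2.2
    have h2 : 0 ≤ (p.1 : ℝ) := p.1.2.1
    refine smul_ne_zero (ne_of_gt ?_) p.2.2
    rcases h2.eq_or_lt with h | h
    · rw [← h]
      simpa using h0
    · positivity⟩
  continuous_toFun := by
    have h0 : ∀ p : unitInterval × Punctured.{u}, rad p.2.1 ≠ 0 := fun p => (rad_pos p.2.2).ne'
    refine Continuous.subtype_mk ?_ _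
    fun_prop (disch := assumption)

lemma radial_one (x : Punctured.{u}) : radial (1, x) = x := by
  apply Subtype.ext
  change ((1 : ℝ) + (1 - 1) / rad x.1) • x.1 = x.1
  rw [sub_self, zero_div, add_zero, one_smul]

lemma radial_zero (x : Punctured.{u}) : radial (0, x) = rotTo x • base := by
  apply Subtype.ext
  refine Plane.ext fun i => ?_
  refine Eq.trans ?_ (co_act (rotTo x) base.1 i).symm
  change co i (((0 : ℝ) + (1 - 0) / rad x.1) • x.1) = _
  rw [co_smul]
  change _ = _ * (1 : ℝ) + _ * (0 : ℝ)
  fin_cases i <;> simp [rotTo] <;> ring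

lemma radial_act {k : O2} (hk : k ∈ SO2) (t : unitInterval) (x : Punctured.{u}) :
    radial (t, k • x) = k • radial (t, x) := by
  apply Subtype.ext
  change ((t : ℝ) + (1 - t) / rad (k • x.1)) • (k • x.1) = k • (((t : ℝ) + (1 - t) / rad x.1) • x.1)
  rw [rad_act hk]
  exact ((lin k).map_smul _ _).symm

end Punctured

end
end BorelO2

namespace BorelO2

noncomputable section

open Simplicial SMod SimpSet SimplicialRep

/-! ### The Borel homology of the punctured plane -/

section bsg

variable {X : Type u} [TopologicalSpace X] [MulAction O2 X] [ContinuousSMul O2 X]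

/-- The class of a simplex of `E O(2) × Sing X` in the Borel construction of the chains on `X`. -/
def bsg {q : SimplexCategory} (e : EO2 q) (σ : Sing X q) : (chainsRep X).borel.obj (op q) :=
  (chainsRep X).bmk e ((sing X).sg (q := q) σ)

lemma bsg_smul {q : SimplexCategory} {k : Sing O2 q} (hk : k ∈ SingSO2 q) (e : EO2 q)
    (σ : Sing X q) : bsg (fun i => k * e i) (smulSing k σ) = bsg e σ :=
  (congrArg ((chainsRep X).bmk _) (chainsRep_ρ_sg k σ).symm).trans
    ((chainsRep X).bmk_smul hk e ((sing X).sg (q := q) σ))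

lemma pl_bsg {p q : SimplexCategory} (η : p ⟶ q) (e : EO2 q) (σ : Sing X q) :
    pl (chainsRep X).borel η (bsg e σ) = bsg (EO2.pull η e) (Sing.pull η σ) :=
  ((chainsRep X).pl_bmk η e ((sing X).sg (q := q) σ)).trans
    (congrArg ((chainsRep X).bmk _) (pl_sg (sing X) η σ))

/-- Linear maps on the Borel construction of the chains on `X` are determined by simplices. -/
lemma bsg_induction {q : SimplexCategory} {M : Type v} [AddCommGroup M] [Module ℚ M]
    (f f' : (chainsRep X).borel.obj (op q) →ₗ[ℚ] M)
    (h : ∀ e (σ : Sing X q), f (bsg e σ) = f' (bsg e σ)) (x) : f x = f' x :=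
  borel_induction f f' (fun e a => induction (f ∘ₗ (chainsRep X).bmkₗ e)
    (f' ∘ₗ (chainsRep X).bmkₗ e) (h e) a) x

end bsg

namespace Punctured

/-- The singular simplex of rotations towards the points of a singular simplex. -/
def rotSing {q : SimplexCategory} (σ : Sing Punctured.{u} q) : Sing O2 q :=
  ⟨fun t => rotTo (σ t), continuous_rotTo.comp σ.continuous⟩

/-- The simplex of `E O(2)` whose vertices over `1` are those of `e` and whose vertices over `0` are
the rotations towards the points of `σ`. -/
def mix {q : SimplexCategory} (θ : q ⟶ ⦋1⦌) (e : EO2 q) (σ : Sing Punctured.{u} q) : EO2 q :=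
  fun i => if θ.toOrderHom i = 1 then e i else rotSing σ

/-- The radial deformation of a singular simplex. -/
def radialSing {q : SimplexCategory} (θ : q ⟶ ⦋1⦌) (σ : Sing Punctured.{u} q) :
    Sing Punctured.{u} q := radial.comp ((coord θ).prodMk σ)

lemma smul_rotSing {q : SimplexCategory} {k : Sing O2 q} (hk : k ∈ SingSO2 q)
    (σ : Sing Punctured.{u} q) : rotSing (smulSing k σ) = k * rotSing σ :=
  ContinuousMap.ext fun t => rotTo_act (hk t) (σ t)

lemma smul_mix {q : SimplexCategory} (θ : q ⟶ ⦋1⦌) {k : Sing O2 q} (hk : k ∈ SingSO2 q)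
    (e : EO2 q) (σ : Sing Punctured.{u} q) :
    mix θ (fun i => k * e i) (smulSing k σ) = fun i => k * mix θ e σ i := by
  funext i
  unfold mix
  split_ifs
  · rfl
  · exact smul_rotSing hk σ

lemma smul_radialSing {q : SimplexCategory} (θ : q ⟶ ⦋1⦌) {k : Sing O2 q} (hk : k ∈ SingSO2 q)
    (σ : Sing Punctured.{u} q) : radialSing θ (smulSing k σ) = smulSing k (radialSing θ σ) :=
  ContinuousMap.ext fun t => radial_act (hk t) (coord θ t) (σ t)

/-- The homotopy that deforms the Borel construction of the punctured plane to a point: it moves the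
plane radially to the circle, which is an orbit of the free action of `SO(2)`. -/
def borelContract (q : SimplexCategory) (θ : q ⟶ ⦋1⦌) :
    (chainsRep Punctured.{u}).borel.obj (op q) →ₗ[ℚ] (chainsRep Punctured.{u}).borel.obj (op q) :=
  (chainsRep Punctured.{u}).borelLift
    (fun e => (sing Punctured.{u}).lift fun σ => bsg (mix θ e σ) (radialSing θ σ))
    (fun k hk e a => by
      refine induction (((sing Punctured.{u}).lift fun σ => bsg
        (mix θ (fun i => k * e i) σ) (radialSing θ σ)) ∘ₗ
          smulChains Punctured.{u} k) _ (fun σ => ?_) a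
      rw [LinearMap.comp_apply, smulChains_sg, lift_sg, lift_sg, smul_mix θ hk,
        smul_radialSing θ hk, bsg_smul hk])

lemma borelContract_bsg {q : SimplexCategory} (θ : q ⟶ ⦋1⦌) (e : EO2 q)
    (σ : Sing Punctured.{u} q) :
    borelContract q θ (bsg e σ) = bsg (mix θ e σ) (radialSing θ σ) := by
  refine (borelLift_bmk (chainsRep Punctured.{u}) _ _ e _).trans ?_
  exact lift_sg _ _ _

lemma pull_mix {p q : SimplexCategory} (η : p ⟶ q) (θ : q ⟶ ⦋1⦌) (e : EO2 q)
    (σ : Sing Punctured.{u} q) :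
    EO2.pull η (mix θ e σ) = mix (η ≫ θ) (EO2.pull η e) (Sing.pull η σ) := by
  funext i
  change Sing.pull η (mix θ e σ (η.toOrderHom i)) =
    if θ.toOrderHom (η.toOrderHom i) = 1 then _ else _
  unfold mix
  split_ifs <;> rfl

lemma pull_radialSing {p q : SimplexCategory} (η : p ⟶ q) (θ : q ⟶ ⦋1⦌)
    (σ : Sing Punctured.{u} q) :
    Sing.pull η (radialSing θ σ) = radialSing (η ≫ θ) (Sing.pull η σ) := by
  refine ContinuousMap.ext fun t => ?_
  change radial (coord θ (Simplex.map η t), _) = radial (coord (η ≫ θ) t, _)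
  rw [coord_comp]
  rfl

lemma pl_borelContract {p q : SimplexCategory} (η : p ⟶ q) (θ : q ⟶ ⦋1⦌)
    (x : (chainsRep Punctured.{u}).borel.obj (op q)) :
    pl (chainsRep Punctured.{u}).borel η (borelContract q θ x) =
      borelContract p (η ≫ θ) (pl (chainsRep Punctured.{u}).borel η x) := by
  refine bsg_induction (pl (chainsRep Punctured.{u}).borel η ∘ₗ borelContract q θ)
    (borelContract p (η ≫ θ) ∘ₗ pl (chainsRep Punctured.{u}).borel η) (fun e σ => ?_) x
  rw [LinearMap.comp_apply, LinearMap.comp_apply, borelContract_bsg, pl_bsg, pl_bsg,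
    borelContract_bsg, pull_mix, pull_radialSing]

lemma mix_c1 {q : SimplexCategory} (e : EO2 q) (σ : Sing Punctured.{u} q) : mix (c1 q) e σ = e :=
  rfl

lemma mix_c0 {q : SimplexCategory} (e : EO2 q) (σ : Sing Punctured.{u} q) :
    mix (c0 q) e σ = fun _ => rotSing σ * 1 := by
  funext i
  rw [mul_one]
  rfl

lemma radialSing_c1 {q : SimplexCategory} (σ : Sing Punctured.{u} q) : radialSing (c1 q) σ = σ := by
  refine ContinuousMap.ext fun t => ?_
  change radial (coord (c1 q) t, σ t) = _
  rw [coord_c1, radial_one]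

lemma radialSing_c0 {q : SimplexCategory} (σ : Sing Punctured.{u} q) :
    radialSing (c0 q) σ = smulSing (rotSing σ) (ContinuousMap.const _ base) := by
  refine ContinuousMap.ext fun t => ?_
  change radial (coord (c0 q) t, σ t) = _
  rw [coord_c0, radial_zero]
  rfl

/-- The group `SO(2)` acts freely on the punctured plane, with contractible orbit space. -/
lemma subsingleton_borel_punctured (n : ℕ) :
    Subsingleton ((Hn (n + 1)).obj (chainsRep Punctured.{u}).borel) := by
  let f : (chainsRep Punctured.{u}).borel ⟶ (chainsRep Punctured.{u}).borel :=
    homMk (fun q => borelContract q (c0 q)) (fun {p q} η x => by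
      rw [pl_borelContract, comp_cst])
  let H : Htpy f (𝟙 _) :=
    { K := borelContract
      nat := pl_borelContract
      zero := fun _ _ => rfl
      one := fun q x => by
        rw [ap_id]
        refine bsg_induction (borelContract q (c1 q)) LinearMap.id (fun e σ => ?_) x
        rw [borelContract_bsg, mix_c1, radialSing_c1]
        rfl }
  refine subsingleton_of_htpy_discrete H (fun q x => ?_) n
  -- At the end of the deformation every simplex is a translate, by a rotation, of the constant one.
  have hf : ∀ e (σ : Sing Punctured.{u} q),
      ap f q (bsg e σ) = bsg (fun _ => 1) (ContinuousMap.const _ base) := by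
    intro e σ
    refine (borelContract_bsg (c0 q) e σ).trans ?_
    rw [mix_c0, radialSing_c0]
    exact bsg_smul (k := rotSing σ) (fun t => rotTo_mem _) _ _
  refine bsg_induction (pl (chainsRep Punctured.{u}).borel (cst q q 0) ∘ₗ ap f q)
    (ap f q) (fun e σ => ?_) x
  rw [LinearMap.comp_apply, hf, pl_bsg]
  rfl

end Punctured

/-! ### The Gysin sequence -/

lemma lin_refl_refl (v : Plane.{u}) : Plane.lin refl (Plane.lin refl v) = v := by
  change refl • refl • v = v
  rw [smul_smul, refl_mul_self, one_smul]

/-- The reflection of the plane. -/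
def reflMap : C(Plane.{u}, Plane.{u}) := ⟨fun v => refl • v, continuous_const_smul refl⟩

lemma act_refl_chains : (chainsRep Plane.{u}).act refl = post reflMap.{u} :=
  hom_ext' fun q => induction _ _ fun σ => (smulChains_sg _ σ).trans (post_sg reflMap q σ).symm

lemma conc_chains_plane :
    Conc (chainsRep Plane.{u}).obj ((chainsRep Plane.{u}).act refl) 0 0 := by
  rw [act_refl_chains]
  exact conc_chains reflMap.{u} (Plane.lin refl).map_zero

lemma ne_zero_stable (g : O2) (x : Plane.{u}) (hx : x ∈ ({0}ᶜ : Set Plane.{u})) :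
    g • x ∈ ({0}ᶜ : Set Plane.{u}) := Plane.smul_ne_zero' g hx

/-- The chains on the punctured plane, inside the chains on the plane. -/
def puncturedChains : SubMod (chainsRep Plane.{u}).obj := (within ({0}ᶜ : Set Plane.{u})).chains

/-- The chains on the plane relative to the punctured plane. -/
def relPlane : SimplicialRep.{u} :=
  (chainsRep Plane.{u}).quotRep puncturedChains (within_stable ne_zero_stable)

/-- The projection to relative chains. -/
def relPlaneπ : RHom (chainsRep Plane.{u}) relPlane.{u} :=
  (chainsRep Plane.{u}).quotπ puncturedChains (within_stable ne_zero_stable)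

lemma trace_lin_refl : LinearMap.trace ℝ Plane.{u} (Plane.lin refl) = 0 := by
  let b : Module.Basis (Fin 2) ℝ Plane.{u} :=
    (Pi.basisFun ℝ (Fin 2)).map ULift.moduleEquiv.symm
  rw [LinearMap.trace_eq_matrix_trace ℝ b, Matrix.trace_fin_two, LinearMap.toMatrix_apply,
    LinearMap.toMatrix_apply]
  have h : ∀ i j, b.repr (Plane.lin refl (b j)) i = refl.1 i j := by
    intro i j
    change Plane.co i (refl • b j) = _
    rw [Plane.co_act]
    have : ∀ i, Plane.co i (b j) = if j = i then 1 else 0 := fun i => by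
      change (Pi.basisFun ℝ (Fin 2) j) i = _
      rw [Pi.basisFun_apply, Pi.single_apply]
      simp only [eq_comm]
    rw [this, this]
    fin_cases j <;> simp
  rw [h, h]
  simp [refl]

lemma conc_relPlane : Conc relPlane.{u}.obj (relPlane.{u}.act refl) 2 1 := by
  obtain ⟨k, hk, h⟩ := exists_conc_ne_zero (Plane.lin.{u} refl) lin_refl_refl reflMap
    (fun _ => rfl) (ne_zero_stable refl)
  have hfin : Module.finrank ℝ Plane.{u} = 2 :=
    (ULift.moduleEquiv (R := ℝ) (M := Fin 2 → ℝ)).finrank_eq.trans (by simp)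
  rw [trace_lin_refl, hfin] at hk
  have hk1 : k = 1 := by
    have : (k : ℝ) = 1 := by push_cast at hk; linarith
    exact_mod_cast this
  rw [hfin, hk1] at h
  have e : relPlane.{u}.act refl = relPost reflMap (ne_zero_stable refl) :=
    rel_hom_ext fun q σ => by
      refine Eq.trans ?_ (relPost_sg _ _ q σ).symm
      exact congrArg (ap (within ({0}ᶜ : Set Plane.{u})).chains.π q) (smulChains_sg _ σ)
  rw [e]
  exact h

lemma ses_relPlane : Ses (chainsRepMap (⟨Subtype.val, continuous_subtype_val⟩ :
    C(Punctured.{u}, Plane.{u})) fun _ _ => rfl).f relPlaneπ.f :=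
  ses_post _ Topology.IsEmbedding.subtypeVal Subtype.range_coe.symm

lemma injective_hm_relPlane (n : ℕ) : Function.Injective (hm (n + 1) (borelHom relPlaneπ.{u})) :=
  (borel_ses ses_relPlane).injective_hm_p _ (Punctured.subsingleton_borel_punctured n)

lemma surjective_hm_relPlane (n : ℕ) : Function.Surjective (hm (n + 2) (borelHom relPlaneπ.{u})) :=
  (borel_ses ses_relPlane).surjective_hm_p_succ _ (Punctured.subsingleton_borel_punctured n)

/-- The Borel homology of a point vanishes in degree one. -/
lemma subsingleton_borel_one : Subsingleton ((Hn 1).obj (constRep.{u} 0).borel) := by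
  have h1 := subsingleton_borel_of_lt conc_relPlane.{u} 1 (by norm_num)
  have h2 := (injective_hm_relPlane.{u} 0).subsingleton
  exact (tw_of_conc conc_chains_plane.{u} 1).symm.subsingleton h2

/-- The periodicity of the Borel homology of a point: the generator of `H_2` is twisted by the sign,
since the reflection reverses the orientation of the plane. -/
lemma tw_periodicity (n : ℕ) : Tw 1 (constRep.{u} 0) (n + 2) (constRep.{u} 0) n := by
  have h1 : Tw 0 (chainsRep Plane.{u}) (n + 2) relPlane.{u} (n + 2) := by
    have hb : Function.Bijective (hm (n + 2) (borelHom relPlaneπ.{u})) :=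
      ⟨injective_hm_relPlane.{u} (n + 1), surjective_hm_relPlane.{u} n⟩
    refine ⟨LinearEquiv.ofBijective _ hb, fun g x => ?_⟩
    rw [pow_zero, one_smul, LinearEquiv.ofBijective_apply, LinearEquiv.ofBijective_apply,
      ← hm_comp, ← hm_comp]
    exact congrArg (fun φ => hm (n + 2) φ x) (borelHom_act _ g).symm
  have h2 := ((tw_of_conc conc_chains_plane.{u} (n + 2)).symm.trans h1).trans
    (tw_of_conc conc_relPlane.{u} n)
  simpa using h2

end
end BorelO2

namespace BorelO2

noncomputable section

/-! ### The trace of the reflection -/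

lemma rot_add (α β : ℝ) : rot (α + β) = rot α * rot β := by
  apply Subtype.ext
  change _ = (rot α).1 * (rot β).1
  ext i j
  rw [Matrix.mul_apply, Fin.sum_univ_two]
  fin_cases i <;> fin_cases j <;> simp [rot, Real.cos_add, Real.sin_add] <;> ring

lemma rot_two_pi : rot (2 * Real.pi) = 1 := by
  rw [← rot_zero]
  apply Subtype.ext
  simp [rot]

lemma refl_mul_rot (α : ℝ) : refl * rot α = rot (-α) * refl := by
  apply Subtype.ext
  change refl.1 * (rot α).1 = (rot (-α)).1 * refl.1
  ext i j
  rw [Matrix.mul_apply, Matrix.mul_apply, Fin.sum_univ_two, Fin.sum_univ_two]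
  fin_cases i <;> fin_cases j <;> simp [rot, refl]

namespace RealRep

variable (V : RealRep.{u})

/-- The action of an element of `O(2)`, as a continuous linear map. -/
def clm (g : O2) : V.carrier →L[ℝ] V.carrier := (V.ρ g).toContinuousLinearMap

lemma ρ_mul_apply (g h : O2) (v : V.carrier) : V.ρ (g * h) v = V.ρ g (V.ρ h v) := by
  rw [map_mul]
  rfl

lemma continuous_clm_rot : Continuous fun θ => V.clm (rot θ) := by
  rw [continuous_clm_apply]
  intro v
  exact V.continuous_act.comp (continuous_rot.prodMk continuous_const)

/-- The average of the action of `SO(2)`. -/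
def avg : V.carrier →L[ℝ] V.carrier :=
  (2 * Real.pi)⁻¹ • ∫ θ in (0 : ℝ)..(2 * Real.pi), V.clm (rot θ)

lemma intervalIntegrable_clm (a b : ℝ) :
    IntervalIntegrable (fun θ => V.clm (rot θ)) MeasureTheory.volume a b :=
  V.continuous_clm_rot.intervalIntegrable a b

/-- Linear functionals of the average that are constant on rotations. -/
lemma map_avg {E : Type*} [NormedAddCommGroup E] [NormedSpace ℝ E] [CompleteSpace E]
    (L : (V.carrier →L[ℝ] V.carrier) →L[ℝ] E) (c : E) (h : ∀ θ, L (V.clm (rot θ)) = c) :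
    L V.avg = c := by
  rw [avg, map_smul, ← L.intervalIntegral_comp_comm (V.intervalIntegrable_clm _ _)]
  simp only [h]
  rw [intervalIntegral.integral_const, sub_zero, smul_smul, inv_mul_cancel₀ Real.two_pi_pos.ne',
    one_smul]

lemma avg_of_fixed {v : V.carrier} (hv : ∀ θ, V.ρ (rot θ) v = v) : V.avg v = v :=
  V.map_avg (ContinuousLinearMap.apply ℝ V.carrier v) v hv

lemma ρ_rot_avg (α : ℝ) (v : V.carrier) : V.ρ (rot α) (V.avg v) = V.avg v := by
  have : CompleteSpace V.carrier := FiniteDimensional.complete ℝ _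
  let L := ContinuousLinearMap.compL ℝ V.carrier V.carrier V.carrier (V.clm (rot α))
  have h : L V.avg = V.avg := by
    rw [avg, map_smul, ← L.intervalIntegral_comp_comm (V.intervalIntegrable_clm _ _)]
    congr 1
    have h1 : ∀ θ, L (V.clm (rot θ)) = V.clm (rot (θ + α)) := by
      intro θ
      apply ContinuousLinearMap.ext
      intro v
      change V.ρ (rot α) (V.ρ (rot θ) v) = V.ρ (rot (θ + α)) v
      rw [add_comm, rot_add, ρ_mul_apply]
    simp only [h1]
    rw [intervalIntegral.integral_comp_add_right (fun θ => V.clm (rot θ))]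
    have hp : Function.Periodic (fun θ => V.clm (rot θ)) (2 * Real.pi) := by
      intro θ
      change V.clm _ = V.clm _
      rw [rot_add, rot_two_pi, mul_one]
    have := hp.intervalIntegral_add_eq α 0
    rw [zero_add] at this
    rw [zero_add, add_comm (2 * Real.pi), this]
  exact congrArg (fun T : V.carrier →L[ℝ] V.carrier => T v) h

lemma trace_refl_rot (α : ℝ) :
    LinearMap.trace ℝ _ (V.ρ (refl * rot α)) = LinearMap.trace ℝ _ (V.ρ refl) := by
  have h : refl * rot α = rot (-(α / 2)) * (refl * rot (α / 2)) := by
    rw [← mul_assoc, ← refl_mul_rot, mul_assoc, ← rot_add, add_halves]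
  rw [h, map_mul, LinearMap.trace_mul_comm, ← map_mul, mul_assoc, ← rot_add, add_neg_cancel,
    rot_zero, mul_one]

lemma trace_refl_avg :
    LinearMap.trace ℝ _ (V.ρ refl ∘ₗ (V.avg : V.carrier →ₗ[ℝ] V.carrier)) =
      LinearMap.trace ℝ _ (V.ρ refl) := by
  let L : (V.carrier →L[ℝ] V.carrier) →ₗ[ℝ] ℝ :=
    LinearMap.trace ℝ V.carrier ∘ₗ (LinearMap.lcomp ℝ V.carrier LinearMap.id ∘ₗ
      LinearMap.llcomp ℝ V.carrier V.carrier V.carrier (V.ρ refl)) ∘ₗ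
        ContinuousLinearMap.coeLM ℝ
  refine V.map_avg L.toContinuousLinearMap _ fun θ => ?_
  refine Eq.trans ?_ (V.trace_refl_rot θ)
  rw [map_mul]
  rfl

/-- The subspace on which `O(2)` acts through the determinant. -/
def detPart : Submodule ℝ V.carrier where
  carrier := {v | ∀ g, V.ρ g v = det g • v}
  add_mem' hv hw g := by rw [map_add, hv g, hw g, smul_add]
  zero_mem' g := by rw [map_zero, smul_zero]
  smul_mem' c v hv g := by rw [map_smul, hv g, smul_comm]

lemma finrank_detPart : Module.finrank ℝ V.detPart = V.mult := by
  let one : delta.carrier := (1 : ℝ)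
  have h : ∀ (f : Representation.IntertwiningMap delta.ρ V.ρ) g,
      V.ρ g (f one) = det g • f one := fun f g => by
    have h1 : delta.ρ g one = det g • one := rfl
    refine (Representation.IntertwiningMap.isIntertwining _ _ f g one).symm.trans ?_
    rw [h1]
    exact map_smul f.toLinearMap (det g) one
  let e : Representation.IntertwiningMap delta.ρ V.ρ ≃ₗ[ℝ] V.detPart :=
    { toFun f := ⟨f one, h f⟩
      map_add' _ _ := rfl
      map_smul' _ _ := rfl
      invFun v :=
        ⟨LinearMap.toSpanSingleton ℝ V.carrier v.1, fun g => LinearMap.ext fun c : ℝ => by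
          change (det g * c) • v.1 = V.ρ g (c • v.1)
          rw [map_smul, v.2 g, smul_smul, mul_comm]⟩
      left_inv f := by
        apply DFunLike.ext
        intro (c : ℝ)
        have h2 : f.toLinearMap (c • one) = c • f.toLinearMap one := map_smul _ _ _
        refine h2.symm.trans (congrArg f.toLinearMap ?_)
        exact mul_one c
      right_inv v := Subtype.ext (one_smul ℝ v.1) }
  exact e.finrank_eq.symm

/-- On the subspace fixed by `SO(2)`, elements of `O(2)` act through the reflection. -/
lemma ρ_eq_of_refl {v : V.carrier} (hv : ∀ θ, V.ρ (rot θ) v = v) (g : O2) :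
    (g ∈ SO2 ∧ V.ρ g v = v) ∨ (det g = -1 ∧ V.ρ g v = V.ρ refl v) := by
  rcases mem_or_refl_mul_mem g with hg | hg
  · obtain ⟨θ, rfl⟩ := exists_rot_eq hg
    exact Or.inl ⟨hg, hv θ⟩
  · right
    obtain ⟨θ, hθ⟩ := exists_rot_eq hg
    have h1 : g = refl * rot θ := by rw [← hθ, ← mul_assoc, refl_mul_self, one_mul]
    refine ⟨?_, ?_⟩
    · have h2 : det (rot θ) = 1 := rot_mem θ
      rw [h1, map_mul, det_refl, h2, mul_one]
    · rw [h1, ρ_mul_apply, hv]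

lemma ρ_rot_refl_avg (θ : ℝ) (v : V.carrier) :
    V.ρ (rot θ) (V.ρ refl (V.avg v)) = V.ρ refl (V.avg v) := by
  have : rot θ * refl = refl * rot (-θ) := by rw [refl_mul_rot, neg_neg]
  rw [← ρ_mul_apply, this, ρ_mul_apply, ρ_rot_avg]

lemma ρ_refl_refl (v : V.carrier) : V.ρ refl (V.ρ refl v) = v := by
  rw [← ρ_mul_apply, refl_mul_self, map_one]
  rfl

/-- The character of the reflection counts the trivial summands against the copies of `δ`: it
vanishes on the irreducible representations of dimension two. -/
theorem trace_refl_eq :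
    LinearMap.trace ℝ V.carrier (V.ρ refl) = (V.fixedDim : ℝ) - V.mult := by
  -- With the projection `P` to the `SO(2)`-fixed vectors and the reflection `r`, the projections
  -- `(P + r P) / 2` and `(P - r P) / 2` have the invariants and the `δ`-part as images, and
  -- `r P` has the trace of `r`, because all `r * rot θ` are conjugate.
  let P : V.carrier →ₗ[ℝ] V.carrier := V.avg
  have hfix : LinearMap.IsProj V.ρ.invariants ((2⁻¹ : ℝ) • (P + V.ρ refl ∘ₗ P)) := by
    constructor
    · intro v g
      have hr : ∀ θ, V.ρ (rot θ) (((2⁻¹ : ℝ) • (P + V.ρ refl ∘ₗ P)) v) =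
          ((2⁻¹ : ℝ) • (P + V.ρ refl ∘ₗ P)) v := fun θ => by
        change V.ρ (rot θ) ((2⁻¹ : ℝ) • (V.avg v + V.ρ refl (V.avg v))) =
          (2⁻¹ : ℝ) • (V.avg v + V.ρ refl (V.avg v))
        rw [map_smul, map_add, ρ_rot_avg, ρ_rot_refl_avg]
      rcases V.ρ_eq_of_refl hr g with ⟨-, h⟩ | ⟨-, h⟩
      · exact h
      · rw [h]
        change V.ρ refl ((2⁻¹ : ℝ) • (V.avg v + V.ρ refl (V.avg v))) =
          (2⁻¹ : ℝ) • (V.avg v + V.ρ refl (V.avg v))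
        rw [map_smul, map_add, ρ_refl_refl, add_comm]
    · intro v hv
      change (2⁻¹ : ℝ) • (V.avg v + V.ρ refl (V.avg v)) = v
      rw [V.avg_of_fixed fun θ => hv _, hv refl]
      module
  have hdet : LinearMap.IsProj V.detPart ((2⁻¹ : ℝ) • (P - V.ρ refl ∘ₗ P)) := by
    constructor
    · intro v g
      have hr : ∀ θ, V.ρ (rot θ) (((2⁻¹ : ℝ) • (P - V.ρ refl ∘ₗ P)) v) =
          ((2⁻¹ : ℝ) • (P - V.ρ refl ∘ₗ P)) v := fun θ => by
        change V.ρ (rot θ) ((2⁻¹ : ℝ) • (V.avg v - V.ρ refl (V.avg v))) =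
          (2⁻¹ : ℝ) • (V.avg v - V.ρ refl (V.avg v))
        rw [map_smul, map_sub, ρ_rot_avg, ρ_rot_refl_avg]
      rcases V.ρ_eq_of_refl hr g with ⟨hg, h⟩ | ⟨hg, h⟩
      · have hg' : det g = 1 := hg
        rw [h, hg', one_smul]
      · rw [h, hg]
        change V.ρ refl ((2⁻¹ : ℝ) • (V.avg v - V.ρ refl (V.avg v))) =
          (-1 : ℝ) • (2⁻¹ : ℝ) • (V.avg v - V.ρ refl (V.avg v))
        rw [map_smul, map_sub, ρ_refl_refl]
        module
    · intro v hv
      change (2⁻¹ : ℝ) • (V.avg v - V.ρ refl (V.avg v)) = v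
      have h1 : ∀ θ, V.ρ (rot θ) v = v := fun θ => by
        have h2 : det (rot θ) = 1 := rot_mem θ
        rw [hv, h2, one_smul]
      rw [V.avg_of_fixed h1, hv refl, det_refl]
      module
  have h1 := hfix.trace
  have h2 := hdet.trace
  rw [map_smul, map_add, V.trace_refl_avg] at h1
  rw [map_smul, map_sub, V.trace_refl_avg, finrank_detPart] at h2
  rw [fixedDim, ← h1, ← h2, smul_eq_mul, smul_eq_mul]
  ring

end RealRep

end
end BorelO2

namespace BorelO2

noncomputable section

open SMod

/-! ### Borel homology of virtual spheres, as a representation of `W` -/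

namespace SimplicialRep

lemma tw_refl (A : SimplicialRep.{u}) (n : ℕ) : Tw 0 A n A n :=
  ⟨LinearEquiv.refl ℚ _, fun g x => by rw [pow_zero, one_smul]; rfl⟩

lemma tw_constRep_even (i : ℕ) : Tw i (constRep.{u} 0) (2 * i) (constRep.{u} 0) 0 := by
  induction i with
  | zero => exact tw_refl _ _
  | succ i ih =>
    have := (tw_periodicity (2 * i)).trans ih
    rwa [add_comm 1 i] at this

lemma subsingleton_constRep_odd (i : ℕ) :
    Subsingleton ((Hn (2 * i + 1)).obj (constRep.{u} 0).borel) := by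
  induction i with
  | zero => exact subsingleton_borel_one
  | succ i ih => exact (tw_periodicity (2 * i + 1)).subsingleton ih

lemma subsingleton_borelHomology_of_neg (A : SimplicialRep.{u}) {a : ℤ} (ha : a < 0) :
    Subsingleton (A.borelHomology a) := by
  obtain ⟨m, rfl⟩ := Int.eq_negSucc_of_lt_zero ha
  exact inferInstanceAs (Subsingleton PUnit)

/-- The Borel homology of an object with one-dimensional homology in degree `p`, which the
reflection multiplies by `(-1) ^ k`, can only be non-zero in the degrees `p + 2 * i`. -/
lemma borelHomology_dichotomy (A : SimplicialRep.{u}) {p k : ℕ}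
    (h : Conc A.obj (A.act refl) p k) (a : ℤ) :
    Subsingleton (A.borelHomology a) ∨
      ∃ i : ℕ, a = ((2 * i + p : ℕ) : ℤ) ∧ Tw (k + i) A (2 * i + p) (constRep.{u} 0) 0 := by
  rcases lt_or_ge a 0 with ha | ha
  · exact Or.inl (A.subsingleton_borelHomology_of_neg ha)
  lift a to ℕ using ha with m
  rcases lt_or_ge m p with hm | hm
  · exact Or.inl (subsingleton_borel_of_lt h m hm)
  obtain ⟨j, rfl⟩ := Nat.exists_eq_add_of_le' hm
  have hj := tw_of_conc h j
  rcases Nat.even_or_odd' j with ⟨i, rfl | rfl⟩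
  · exact Or.inr ⟨i, rfl, hj.trans (tw_constRep_even i)⟩
  · exact Or.inl (hj.subsingleton (subsingleton_constRep_odd i))

/-- Even powers of the sign are trivial. -/
lemma Tw.nonempty_equiv {k : ℕ} {A B : SimplicialRep.{u}} {n m : ℕ} (h : Tw k A n B m)
    (hk : Even k) :
    Nonempty ((A.borelHomologyRep (n : ℤ)).Equiv (B.borelHomologyRep (m : ℤ))) := by
  obtain ⟨e, he⟩ := h
  refine ⟨Representation.Equiv.mk e fun g => ?_⟩
  induction g using QuotientGroup.induction_on with
  | H g =>
    apply LinearMap.ext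
    intro x
    obtain ⟨j, rfl⟩ := hk
    refine (he g x).trans ?_
    rw [pow_add, ← mul_pow, sgn_mul_self, one_pow, one_smul]
    rfl

lemma Tw.nonempty_equiv_tprod {k : ℕ} {A B : SimplicialRep.{u}} {n m : ℕ} (h : Tw k A n B m)
    (hk : Odd k) :
    Nonempty ((A.borelHomologyRep (n : ℤ)).Equiv
      ((B.borelHomologyRep (m : ℤ)).tprod signRep)) := by
  obtain ⟨e, he⟩ := h
  let r := (TensorProduct.rid ℚ (B.borelHomology (m : ℤ))).symm
  refine ⟨Representation.Equiv.mk (LinearEquiv.trans e r) fun g => ?_⟩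
  induction g using QuotientGroup.induction_on with
  | H g =>
    apply LinearMap.ext
    intro x
    have h1 : e (hm n (A.borelAct g) x) = sgn g • hm m (B.borelAct g) (e x) := by
      obtain ⟨j, rfl⟩ := hk
      refine (he g x).trans ?_
      rw [pow_succ, pow_mul, pow_two, sgn_mul_self, one_pow, one_mul]
    refine (congrArg r h1).trans ?_
    change TensorProduct.tmul ℚ (sgn g • hm m (B.borelAct g) (e x)) (1 : ℚ) =
      TensorProduct.tmul ℚ (hm m (B.borelAct g) (e x)) (sgn g * 1)
    rw [TensorProduct.smul_tmul, smul_eq_mul]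

end SimplicialRep

lemma nonempty_equiv_of_subsingleton {V V' : Type*} [AddCommGroup V] [Module ℚ V]
    [AddCommGroup V'] [Module ℚ V'] [Subsingleton V] [Subsingleton V']
    (ρ : Representation ℚ W V) (σ : Representation ℚ W V') : Nonempty (ρ.Equiv σ) :=
  ⟨Representation.Equiv.mk 0 fun _ => LinearMap.ext fun _ => Subsingleton.elim _ _⟩

namespace RealRep

lemma trace_sum (V : RealRep.{u}) (V' : RealRep.{v}) (g : O2) :
    LinearMap.trace ℝ (V.sum V').carrier ((V.sum V').ρ g) =
      LinearMap.trace ℝ V.carrier (V.ρ g) + LinearMap.trace ℝ V'.carrier (V'.ρ g) :=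
  LinearMap.trace_prodMap' (V.ρ g) (V'.ρ g)

lemma dim_sum (V : RealRep.{u}) (V' : RealRep.{v}) : (V.sum V').dim = V.dim + V'.dim :=
  Module.finrank_prod

lemma dim_triv (n : ℕ) : (triv n).dim = n := Module.finrank_fin_fun ℝ

lemma dim_delta : delta.dim = 1 := Module.finrank_self ℝ

lemma trace_triv (n : ℕ) (g : O2) :
    LinearMap.trace ℝ (triv n).carrier ((triv n).ρ g) = n := by
  have : (triv n).ρ g = 1 := rfl
  rw [this, LinearMap.trace_one]
  exact congrArg _ (dim_triv n)

lemma trace_delta : LinearMap.trace ℝ delta.carrier (delta.ρ refl) = -1 := by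
  have : delta.ρ refl = (-1 : ℝ) • (1 : delta.carrier →ₗ[ℝ] delta.carrier) :=
    LinearMap.ext fun c : ℝ => by
      change det refl * c = (-1 : ℝ) * c
      rw [det_refl]
  rw [this, map_smul, LinearMap.trace_one]
  change (-1 : ℝ) * (Module.finrank ℝ ℝ : ℝ) = -1
  rw [Module.finrank_self, Nat.cast_one, mul_one]

end RealRep

namespace VirtualRep

variable (U : VirtualRep.{u})

/-- The homology of the suspended virtual sphere is one-dimensional and concentrated in degree
`dim U.pos`; the parity of the exponent `k` of the sign of the reflection on it is determined by the
virtual character of the reflection. -/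
lemma exists_conc_suspendedSphere : ∃ (k : ℕ) (l : ℤ),
    LinearMap.trace ℝ U.pos.carrier (U.pos.ρ refl) -
      LinearMap.trace ℝ U.neg.carrier (U.neg.ρ refl) =
        U.pos.dim - U.neg.dim - 2 * k + 4 * l ∧
    Conc U.suspendedSphere.obj (U.suspendedSphere.act refl) U.pos.dim k := by
  obtain ⟨k₀, h₀, hc₀⟩ := U.neg.exists_conc_sphereChains
  obtain ⟨k₁, h₁, hc₁⟩ := (U.pos.sum (RealRep.triv U.neg.dim)).exists_conc_sphereChains
  rw [RealRep.dim_sum, RealRep.dim_triv] at h₁ hc₁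
  rw [RealRep.trace_sum, RealRep.trace_triv] at h₁
  rw [add_comm] at hc₁
  refine ⟨k₁ + k₀, k₀, ?_, SimplicialRep.conc_hom hc₀ hc₁⟩
  push_cast at h₁ ⊢
  linarith

/-- With no `O(2)`-fixed points, the character of the reflection on `U` is `-b(U)`. This fixes the
twist of the homology of the sphere by the sign, and with it the twist in degree `b(U) + n`, in
terms of `n` and the parity of `b(U)`. -/
theorem nonempty_equiv_of_even_sub {U U' : VirtualRep.{u}} (hU : U.fixedDim = 0)
    (hU' : U'.fixedDim = 0) (hb : Even (U.b - U'.b)) (n : ℤ) (h : Nontrivial (U.H (U.b + n)))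
    (h' : Nontrivial (U'.H (U'.b + n))) :
    Nonempty ((U.HRep (U.b + n)).Equiv (U'.HRep (U'.b + n))) := by
  -- The degree `m` is `p + 2 * i` for the dimension `p` of the suspended sphere, and the exponent `k`
  -- is that of the suspended sphere plus `i`, which the character of the reflection ties to `n`.
  have key : ∀ {U : VirtualRep.{u}}, U.fixedDim = 0 → Nontrivial (U.H (U.b + n)) →
      ∃ (m k : ℕ) (c : ℤ), U.b + n + U.neg.dim = m ∧ n = 2 * (k - U.b) + 4 * c ∧
        SimplicialRep.Tw k U.suspendedSphere m (SimplicialRep.constRep.{u} 0) 0 := by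
    intro U hU h
    obtain ⟨k, l, hk, hc⟩ := U.exists_conc_suspendedSphere
    rw [RealRep.trace_refl_eq, RealRep.trace_refl_eq] at hk
    have hk' : ((U.pos.fixedDim : ℤ) - U.pos.mult) - (U.neg.fixedDim - U.neg.mult) =
        U.pos.dim - U.neg.dim - 2 * k + 4 * l := by exact_mod_cast hk
    rcases U.suspendedSphere.borelHomology_dichotomy hc (U.b + n + U.neg.dim) with hs | ⟨i, hi, ht⟩
    · exact absurd hs (not_subsingleton_iff_nontrivial.2 h)
    · refine ⟨_, _, -l, hi, ?_, ht⟩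
      unfold VirtualRep.fixedDim at hU
      unfold VirtualRep.b at hi ⊢
      push_cast at hi ⊢
      linarith
  obtain ⟨m, k, c, hm, hn, ht⟩ := key hU h
  obtain ⟨m', k', c', hm', hn', ht'⟩ := key hU' h'
  have he : Even (k + k') := by
    have := hb
    rw [Int.even_iff] at this
    rw [Nat.even_iff]
    omega
  change Nonempty ((U.suspendedSphere.borelHomologyRep (U.b + n + U.neg.dim)).Equiv
    (U'.suspendedSphere.borelHomologyRep (U'.b + n + U'.neg.dim)))
  rw [hm, hm']
  exact (ht.trans ht'.symm).nonempty_equiv he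

/-- Adding `δ` raises the dimension of the sphere by one and lowers the character of the reflection
by one, so that the action on the homology of the sphere changes by one factor of the sign. -/
theorem nonempty_equiv_addDelta (n : ℤ) :
    Nonempty ((U.addDelta.HRep (n + 1)).Equiv ((U.HRep n).tprod signRep)) := by
  obtain ⟨k, l, hk, hc⟩ := U.exists_conc_suspendedSphere
  obtain ⟨k', l', hk', hc'⟩ := U.addDelta.exists_conc_suspendedSphere
  have hp : U.addDelta.pos.dim = U.pos.dim + 1 := by
    change (U.pos.sum RealRep.delta).dim = _
    rw [RealRep.dim_sum, RealRep.dim_delta]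
  have htr : LinearMap.trace ℝ U.addDelta.pos.carrier (U.addDelta.pos.ρ refl) =
      LinearMap.trace ℝ U.pos.carrier (U.pos.ρ refl) - 1 := by
    refine (RealRep.trace_sum U.pos RealRep.delta refl).trans ?_
    rw [RealRep.trace_delta]
    rfl
  -- The dimension goes up by one and the trace down by one, so that the exponent is `k + 1` modulo
  -- two.
  have hodd : Odd (k' + k) := by
    rw [htr, hp] at hk'
    change _ - LinearMap.trace ℝ U.neg.carrier (U.neg.ρ refl) =
      ((U.pos.dim + 1 : ℕ) : ℝ) - (U.neg.dim : ℝ) - _ + _ at hk'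
    have h1 : (k' : ℝ) + k = 2 * k + 1 + 2 * l' - 2 * l := by
      push_cast at hk'
      linarith
    have h2 : (k' : ℤ) + k = 2 * k + 1 + 2 * l' - 2 * l := by exact_mod_cast h1
    rw [Nat.odd_iff]
    omega
  rw [hp] at hc'
  have hdeg : n + 1 + (U.addDelta.neg.dim : ℤ) = n + U.neg.dim + 1 := by
    change n + 1 + (U.neg.dim : ℤ) = _
    ring
  change Nonempty ((U.addDelta.suspendedSphere.borelHomologyRep
    (n + 1 + (U.addDelta.neg.dim : ℤ))).Equiv
      ((U.suspendedSphere.borelHomologyRep (n + U.neg.dim)).tprod signRep))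
  rw [hdeg]
  generalize n + (U.neg.dim : ℤ) = a
  rcases lt_or_ge a U.pos.dim with ha | ha
  · have hs : Subsingleton (U.suspendedSphere.borelHomology a) := by
      rcases U.suspendedSphere.borelHomology_dichotomy hc a with hs | ⟨i, hi, -⟩
      · exact hs
      · omega
    have hs' : Subsingleton (U.addDelta.suspendedSphere.borelHomology (a + 1)) := by
      rcases U.addDelta.suspendedSphere.borelHomology_dichotomy hc' (a + 1) with hs | ⟨i, hi, -⟩
      · exact hs
      · omega
    have := (TensorProduct.rid ℚ (U.suspendedSphere.borelHomology a)).toEquiv.subsingleton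
    exact nonempty_equiv_of_subsingleton _ _
  · obtain ⟨j, rfl⟩ : ∃ j : ℕ, a = ((j + U.pos.dim : ℕ) : ℤ) :=
      ⟨(a - U.pos.dim).toNat, by omega⟩
    exact ((SimplicialRep.tw_of_conc hc' j).trans
      (SimplicialRep.tw_of_conc hc j).symm).nonempty_equiv_tprod hodd

end VirtualRep

end
end BorelO2

theorem mainTheorem6 :
    (∀ U U' : BorelO2.VirtualRep.{u}, U.fixedDim = 0 → U'.fixedDim = 0 →
      Even (U.b - U'.b) → ∀ n : ℤ,
        Nontrivial (U.H (U.b + n)) → Nontrivial (U'.H (U'.b + n)) →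
          Nonempty ((U.HRep (U.b + n)).Equiv (U'.HRep (U'.b + n)))) ∧
    (∀ U : BorelO2.VirtualRep.{u}, U.fixedDim = 0 → ∀ n : ℤ,
      Nonempty ((U.addDelta.HRep (n + 1)).Equiv ((U.HRep n).tprod BorelO2.signRep))) := by
  exact ⟨fun _ _ hU hU' hb n h h' =>
      BorelO2.VirtualRep.nonempty_equiv_of_even_sub hU hU' hb n h h',
    fun U _ n => U.nonempty_equiv_addDelta n⟩
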